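/- **Problem B.** Let $r\ge 1$, $N_e,N_h\ge 0$, and let $F:\mathbb R^r\times\mathbb R\to\mathbb R$, $E:\mathbb R^r\times\mathbb R^r\to\mathbb R$, $f,g:\mathbb R^r\to\mathbb R$, $e:\mathbb R^r\times\mathbb R^r\to\mathbb R^{N_e}$, $h:\mathbb R^r\times\mathbb R\to\mathbb R^{N_h}$ be (locally) Lipschitz continuous, with $g(x)\ne 0$ for all $x$. Minimize $$J(x,u)=\int_{-1}^1F(x(t),u(t))\,dt+E(x(-1),x(1))$$ over all pairs $(x,u)$ on $[-1,1]$ with $x$ continuous and $F(x(\cdot),u(\cdot))$ integrable, subject to $\dot x_i=x_{i+1}$ $(1\le i<r)$ and $\dot x_r=f(x)+g(x)u$ (derivatives are integrable weak derivatives), $e(x(-1),x(1))=0$, and $h(x(t),u(t))\le 0$ for a.e. $t$. **Problem B$^N$.** Let $L_n$ be the Legendre polynomials, $t_0=-1<t_1<\dots<t_N=1$ the Legendre–Gauss–Lobatto nodes ($t_1,\dots,t_{N-1}$ are the roots of $\dot L_N$), $w_k=\frac{2}{N(N+1)}L_N(t_k)^{-2}$, and $D$ the $(N+1)\times(N+1)$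 differentiation matrix: $D_{ik}=\frac{L_N(t_i)}{L_N(t_k)}\frac1{t_i-t_k}$ for $i\ne k$, $D_{00}=-\frac{N(N+1)}4$, $D_{NN}=\frac{N(N+1)}4$, and $D_{kk}=0$ otherwise. Given $m_1\in\mathbb N$, $\beta>0$, bounds $\underline b,\bar b\in\mathbb R^{r+1}$, $\underline b_j,\bar b_j\in\mathbb R$ and $d\in\mathbb R$, all independent of $N$, minimize $$\bar J^N(\bar x,\bar u)=\sum_{k=0}^NF(\bar x^k,\bar u^k)w_k+E(\bar x^0,\bar x^N)$$ over $\bar x^k\in\mathbb R^r$, $\bar u^k\in\mathbb R$ $(0\le k\le N)$. Writing $\bar x_i=(\bar x_i^0,\dots,\bar x_i^N)^T$, the constraints are $D\bar x_i=\bar x_{i+1}$ for $1\le i<r$; $(D\bar x_r)_k=f(\bar x^k)+g(\bar x^k)\bar u^k$ for all $k$; $\|e(\bar x^0,\bar x^N)\|_\infty\le (N-r-1)^{-\beta}$; $h(\bar x^k,\bar u^k)\le (N-r-1)^{-\beta}\mathbf 1$ for all $k$; $\underline b\le(\bar x^k,\bar u^k)\le\bar b$ for all $k$; $\underline b_j\le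 (D^j\bar x_r)_0\le\bar b_j$ for $1\le j\le m_1-1$; and $\sum_{n=0}^{N-r-m_1+1}|a_n^N|\le d$, where $a_n^N=(n+\tfrac12)\sum_{k=0}^N L_n(t_k)w_k(D^{m_1}\bar x_r)_k$. The interpolation $(x^N(t),u^N(t))$ of $(\bar x,\bar u)$ consists of the Lagrange interpolation polynomials $x_i^N$ of $\bar x_i$ at the nodes and of $u^N(t)=\dfrac{\dot x_r^N(t)-f(x^N(t))}{g(x^N(t))}$. **Theorem (Convergence).** Suppose Problem B has an optimal solution $(x^*,u^*)$ for which the $m$-th weak derivative $(x_r^*)^{(m)}$ has bounded variation on $[-1,1]$, for some $m\ge 3$. Let $m_1$ be an integer with $2\le m_1\le m-1$ and let $0<\beta<m-m_1-\frac34$. Suppose the bounds of Problem B$^N$ are large enough in the following sense: for a.e. $t\in[-1,1]$ the point $(x^*(t),u^*(t))$ lies in a fixed compact subset of the interior of the box $[\underline b,\bar b]$ (for continuous $u^*$: the trajectory lies in the interior of the box); $\underline b_j<(x_r^*)^{(j)}(-1)<\bar b_j$ for $1\le j\le m_1-1$; and $$d>\Big|\frac12\int_{-1}^1(x_r^*)^{(m_1)}(t)\,dt\Big|+\frac6{\sqrt\pi}\Big(U\big((x_r^*)^{(m_1+1)}\big)+V\big((x_r^*)^{(m_1+1)}\big)\Big)\zeta(3/2),$$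 where $U(w)=\sup_{[-1,1]}|w|$, $V(w)$ is the total variation of $w$ on $[-1,1]$, and $\zeta(3/2)=\sum_{k\ge1}k^{-3/2}$. (Derivatives of $x_r^*$ of order less than $m$ are taken in their continuous representatives, and the one of order $m$ in a representative of bounded variation.) Then for every sequence $\{(\bar x^{*N},\bar u^{*N})\}_{N\ge N_0}$ of optimal solutions of Problem B$^N$, with interpolations $(x^{*N},u^{*N})$, there are indices $N_0\le N_1<N_2<N_3<\cdots$ and an optimal solution $(x^\infty,u^\infty)$ of Problem B such that $x^{*N_j}\to x^\infty$ and $u^{*N_j}\to u^\infty$ uniformly on $[-1,1]$, and $$\lim_{j\to\infty}\bar J^{N_j}(\bar x^{*N_j},\bar u^{*N_j})=J(x^\infty,u^\infty),\qquad \lim_{j\to\infty}J(x^{*N_j},u^{*N_j})=J(x^\infty,u^\infty).$$ -/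

import Mathlib

open MeasureTheory Set Filter Topology Polynomial
open scoped ContDiff Matrix

noncomputable section

namespace PSControl

/-! ### Weak derivatives on `[-1, 1]` -/

/-- `v` is a `j`-th order weak derivative of `ξ` on `(-1, 1)`; both functions are integrable. -/
structure IsWeakDeriv (j : ℕ) (ξ v : ℝ → ℝ) : Prop where
  integrable_left : IntegrableOn ξ (Icc (-1) 1)
  integrable_right : IntegrableOn v (Icc (-1) 1)
  integral_eq : ∀ φ : ℝ → ℝ, ContDiff ℝ ∞ φ → HasCompactSupport φ → tsupport φ ⊆ Ioo (-1) 1 →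
    ∫ t in (-1 : ℝ)..1, ξ t * iteratedDeriv j φ t = (-1) ^ j * ∫ t in (-1 : ℝ)..1, v t * φ t

/-- `y 0, y 1, …, y m` are the weak derivatives of `ξ` of orders `0, …, m`, and the one of order
`m` has bounded variation. The derivatives of order less than `m` have continuous representatives,
and `y j` denotes that representative. -/
structure IsBVDerivFamily (m : ℕ) (ξ : ℝ → ℝ) (y : ℕ → ℝ → ℝ) : Prop where
  weakDeriv : ∀ j ≤ m, IsWeakDeriv j ξ (y j)
  continuousOn : ∀ j < m, ContinuousOn (y j) (Icc (-1) 1)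
  boundedVariation : BoundedVariationOn (y m) (Icc (-1) 1)

/-! ### The optimal control problem -/

/-- The index of the last state variable `x_r`. -/
def lastIdx (r : ℕ) [NeZero r] : Fin r := ⟨r - 1, Nat.sub_one_lt (NeZero.ne r)⟩

/-- The data of the constrained Bolza problem with state dimension `r`, `Ne` endpoint conditions
and `Nh` state-control constraints. -/
structure BolzaProblem (r Ne Nh : ℕ) where
  F : (Fin r → ℝ) × ℝ → ℝ
  E : (Fin r → ℝ) × (Fin r → ℝ) → ℝ
  f : (Fin r → ℝ) → ℝ
  g : (Fin r → ℝ) → ℝ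
  e : (Fin r → ℝ) × (Fin r → ℝ) → Fin Ne → ℝ
  h : (Fin r → ℝ) × ℝ → Fin Nh → ℝ
  lipschitz_F : LocallyLipschitz F
  lipschitz_E : LocallyLipschitz E
  lipschitz_f : LocallyLipschitz f
  lipschitz_g : LocallyLipschitz g
  lipschitz_e : LocallyLipschitz e
  lipschitz_h : LocallyLipschitz h
  g_ne_zero : ∀ z, g z ≠ 0

variable {r Ne Nh : ℕ} [NeZero r]

/-- The cost `J(x, u) = ∫_{-1}^{1} F(x(t), u(t)) dt + E(x(-1), x(1))`. -/
def BolzaProblem.cost (P : BolzaProblem r Ne Nh) (x : ℝ → Fin r → ℝ) (u : ℝ → ℝ) : ℝ :=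
  (∫ t in (-1 : ℝ)..1, P.F (x t, u t)) + P.E (x (-1), x 1)

/-- `(x, u)` satisfies the state equation (in the sense of weak derivatives), the endpoint
conditions and the state-control constraints, and its running cost is integrable. -/
structure BolzaProblem.IsFeasible (P : BolzaProblem r Ne Nh)
    (x : ℝ → Fin r → ℝ) (u : ℝ → ℝ) : Prop where
  continuousOn : ContinuousOn x (Icc (-1) 1)
  chain : ∀ (i : ℕ) (hi : i + 1 < r),
    IsWeakDeriv 1 (fun t => x t ⟨i, Nat.lt_of_succ_lt hi⟩) (fun t => x t ⟨i + 1, hi⟩)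
  control : IsWeakDeriv 1 (fun t => x t (lastIdx r)) (fun t => P.f (x t) + P.g (x t) * u t)
  endpoint : P.e (x (-1), x 1) = 0
  path : ∀ᵐ t ∂(volume.restrict (Icc (-1 : ℝ) 1)), P.h (x t, u t) ≤ 0
  integrable_cost : IntegrableOn (fun t => P.F (x t, u t)) (Icc (-1) 1)

/-- `(x, u)` is an optimal solution of the Bolza problem. -/
def BolzaProblem.IsOptimal (P : BolzaProblem r Ne Nh)
    (x : ℝ → Fin r → ℝ) (u : ℝ → ℝ) : Prop :=
  P.IsFeasible x u ∧ ∀ x' u', P.IsFeasible x' u' → P.cost x u ≤ P.cost x' u'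

/-! ### Legendre-Gauss-Lobatto discretization -/

/-- The Legendre polynomial `L_n = (1 / (2^n n!)) dⁿ/dtⁿ (t² - 1)ⁿ`. -/
def legendre (n : ℕ) : ℝ[X] :=
  C (1 / (2 ^ n * (n.factorial : ℝ))) * derivative^[n] ((X ^ 2 - 1) ^ n)

/-- The set of LGL nodes: `-1`, `1` and the roots of the derivative of `L_N`. -/
def lglNodes (N : ℕ) : Finset ℝ :=
  insert (-1) (insert 1 (derivative (legendre N)).roots.toFinset)

/-- The LGL nodes in increasing order, `t_0 = -1 < t_1 < ⋯ < t_N = 1` (for `N ≥ 1` the set has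
exactly `N + 1` elements, so that the default value is not used). -/
def node (N : ℕ) (k : Fin (N + 1)) : ℝ := ((lglNodes N).sort (· ≤ ·)).getD k 0

/-- `L_n(t_k)`. -/
def legendreAt (N n : ℕ) (k : Fin (N + 1)) : ℝ := (legendre n).eval (node N k)

/-- The LGL quadrature weights. -/
def weight (N : ℕ) (k : Fin (N + 1)) : ℝ :=
  2 / ((N : ℝ) * (N + 1)) * (1 / legendreAt N N k ^ 2)

/-- The differentiation matrix at the LGL nodes. -/
def diffMatrix (N : ℕ) : Matrix (Fin (N + 1)) (Fin (N + 1)) ℝ := fun i k =>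
  if i ≠ k then legendreAt N N i / legendreAt N N k * (1 / (node N i - node N k))
  else if i = 0 then -((N : ℝ) * (N + 1) / 4)
  else if i = Fin.last N then (N : ℝ) * (N + 1) / 4
  else 0

/-- The Lagrange interpolation polynomial of the `i`-th discrete state at the LGL nodes. -/
def interpPoly {N : ℕ} (X : Fin (N + 1) → Fin r → ℝ) (i : Fin r) : ℝ[X] :=
  Lagrange.interpolate Finset.univ (node N) (fun k => X k i)

/-- The interpolated state `x^N(t)`. -/
def interpState {N : ℕ} (X : Fin (N + 1) → Fin r → ℝ) (t : ℝ) : Fin r → ℝ :=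
  fun i => (interpPoly X i).eval t

/-- The interpolated control `u^N(t) = (ẋ_r^N(t) - f(x^N(t))) / g(x^N(t))`. -/
def BolzaProblem.interpControl (P : BolzaProblem r Ne Nh) {N : ℕ}
    (X : Fin (N + 1) → Fin r → ℝ) (t : ℝ) : ℝ :=
  ((derivative (interpPoly X (lastIdx r))).eval t - P.f (interpState X t)) / P.g (interpState X t)

/-- The parameters of the discretized problem: the order `m₁`, the relaxation exponent `β`, the
box `[lo, hi]` for `(x, u)`, the bounds `dlo j, dhi j` for the `j`-th initial derivative of `x_r`
and the bound `d` for the spectral coefficients. -/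
structure DiscParams (r : ℕ) where
  m₁ : ℕ
  β : ℝ
  lo : (Fin r → ℝ) × ℝ
  hi : (Fin r → ℝ) × ℝ
  dlo : ℕ → ℝ
  dhi : ℕ → ℝ
  d : ℝ

/-- The vector `D^j (x̄_r^N)ᵀ`. -/
def lastStateDeriv {N : ℕ} (X : Fin (N + 1) → Fin r → ℝ) (j : ℕ) : Fin (N + 1) → ℝ :=
  (diffMatrix N ^ j) *ᵥ (fun k => X k (lastIdx r))

/-- The spectral coefficient `a_n^N(j) = (n + 1/2) ∑_k L_n(t_k) w_k (D^j (x̄_r^N)ᵀ)_k`. -/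
def spectralCoeff {N : ℕ} (X : Fin (N + 1) → Fin r → ℝ) (j n : ℕ) : ℝ :=
  ((n : ℝ) + 1 / 2) * ∑ k, legendreAt N n k * weight N k * lastStateDeriv X j k

/-- The discrete cost `J̄^N`. -/
def BolzaProblem.discCost (P : BolzaProblem r Ne Nh) {N : ℕ}
    (X : Fin (N + 1) → Fin r → ℝ) (U : Fin (N + 1) → ℝ) : ℝ :=
  (∑ k, P.F (X k, U k) * weight N k) + P.E (X 0, X (Fin.last N))

/-- Feasibility for the discretized problem with `N + 1` nodes. The problem is meant for large `N`
only (`N ≥ r + m₁`, so that all exponents and index ranges make sense); the norm of `Fin Ne → ℝ` is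
the maximum norm. -/
structure BolzaProblem.IsDiscFeasible (P : BolzaProblem r Ne Nh) (R : DiscParams r) {N : ℕ}
    (X : Fin (N + 1) → Fin r → ℝ) (U : Fin (N + 1) → ℝ) : Prop where
  chain : ∀ (i : ℕ) (hi : i + 1 < r),
    diffMatrix N *ᵥ (fun k => X k ⟨i, Nat.lt_of_succ_lt hi⟩) = fun k => X k ⟨i + 1, hi⟩
  control : diffMatrix N *ᵥ (fun k => X k (lastIdx r)) = fun k => P.f (X k) + P.g (X k) * U k
  endpoint : ‖P.e (X 0, X (Fin.last N))‖ ≤ ((N : ℝ) - r - 1) ^ (-R.β)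
  path : ∀ k i, P.h (X k, U k) i ≤ ((N : ℝ) - r - 1) ^ (-R.β)
  box : ∀ k, (X k, U k) ∈ Icc R.lo R.hi
  initialDeriv : ∀ j, 1 ≤ j → j ≤ R.m₁ - 1 → lastStateDeriv X j 0 ∈ Icc (R.dlo j) (R.dhi j)
  spectral : ∑ n ∈ Finset.range (N + 2 - r - R.m₁), |spectralCoeff X R.m₁ n| ≤ R.d

/-- `(X, U)` is an optimal solution of the discretized problem. -/
def BolzaProblem.IsDiscOptimal (P : BolzaProblem r Ne Nh) (R : DiscParams r) {N : ℕ}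
    (X : Fin (N + 1) → Fin r → ℝ) (U : Fin (N + 1) → ℝ) : Prop :=
  P.IsDiscFeasible R X U ∧
    ∀ (X' : Fin (N + 1) → Fin r → ℝ) (U' : Fin (N + 1) → ℝ),
      P.IsDiscFeasible R X' U' → P.discCost X U ≤ P.discCost X' U'

/-! ### The choice of the bounds -/

/-- `U(v)`, the least upper bound of `|v|` on `[-1, 1]`. -/
def supAbs (v : ℝ → ℝ) : ℝ := sSup ((fun t => |v t|) '' Icc (-1) 1)

/-- `V(v)`, the total variation of `v` on `[-1, 1]`. -/
def totalVar (v : ℝ → ℝ) : ℝ := (eVariationOn v (Icc (-1) 1)).toReal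

/-- `|a₀(v)| + (6 / √π) (U(w) + V(w)) ζ(3/2)`, where `a₀(v)` is the zeroth Legendre coefficient of
`v`. It is used with `v` and `w` the derivatives of orders `m₁` and `m₁ + 1` of `x_r*`. -/
def spectralThreshold (v w : ℝ → ℝ) : ℝ :=
  |1 / 2 * ∫ t in (-1 : ℝ)..1, v t| +
    6 / √Real.pi * (supAbs w + totalVar w) * ∑' k : ℕ, 1 / ((k : ℝ) + 1) ^ (3 / 2 : ℝ)

/-- The bounds of the discretized problem are large enough for the trajectory `(x, u)`, where
`y j` is the `j`-th derivative of `x_r`: up to a null set of times, `(x, u)` stays in a compact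
part of the interior of the box (for continuous `u` this says that it stays in the interior), the
initial derivatives lie strictly between their bounds, and `d` exceeds its threshold. -/
structure DiscParams.BoundsAdmissible (R : DiscParams r) (x : ℝ → Fin r → ℝ) (u : ℝ → ℝ)
    (y : ℕ → ℝ → ℝ) : Prop where
  box : ∃ K : Set ((Fin r → ℝ) × ℝ), IsCompact K ∧ K ⊆ interior (Icc R.lo R.hi) ∧
    ∀ᵐ t ∂(volume.restrict (Icc (-1 : ℝ) 1)), (x t, u t) ∈ K
  initialDeriv : ∀ j, 1 ≤ j → j ≤ R.m₁ - 1 → y j (-1) ∈ Ioo (R.dlo j) (R.dhi j)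
  spectral : spectralThreshold (y R.m₁) (y (R.m₁ + 1)) < R.d

end PSControl

end

/-!
Convergence of a Legendre pseudospectral method for the optimal control of a chain of integrators
with nonlinear last equation.

The differentiation matrix is exact on polynomials of degree at most `N`
(`diffMatrix_mulVec`, from an explicit form of the Lagrange basis at the nodes). Hence the
discretized chain `D x̄_i = x̄_{i+1}` says that the discrete states are the samples of
`p, p', …, p^(r-1)` for a single polynomial `p` of degree at most `N` (`exists_eq_sample`), and the
interpolated state and control are functions of the jet `(p, …, p^(r))`. The quadrature rule at the
nodes is exact up to degree `2 N - 1` (`sum_eval_mul_weight`), so that the quantities `a_n^N` are the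
true Legendre coefficients of `p^(r-1+m₁)` (`spectralCoeff_sample`).

Compactness. Since `|L_n| ≤ 1` on `[-1, 1]`, the bound on `∑ |a_n^N|` bounds `p^(r-1+m₁)`, and with
the bounds at the left endpoint all lower derivatives (`exists_bound_of_isDiscFeasible`). As
`m₁ ≥ 2`, the jets are uniformly bounded and uniformly Lipschitz, and the Arzelà-Ascoli theorem gives
a uniformly convergent subsequence. Its limit is feasible, because the relaxation of the constraints
tends to zero and the nodes become dense (`isFeasible_of_tendstoUniformlyOn`), and the discrete and
continuous costs converge to the cost of the limit (`tendsto_discCost`, `tendsto_cost`).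

Optimality. It remains to find feasible points of the discrete problems whose discrete costs tend to
the optimal value (`exists_comparison_sequence`). Weak derivatives are turned into honest
primitives by the du Bois-Reymond lemma. The Legendre expansion of the `m₁`-th derivative of the last
state variable is truncated at degree `N + 1 - r - m₁` and integrated `r - 1 + m₁` times with the
exact initial values. The Legendre coefficients of a function of bounded variation are
`O(n^(-1/2))` (`abs_legendreInt_le`, from a Bernstein-type bound for `L_n'`), and every integration
gains one power of `n`. So the jets converge uniformly with a rate faster than the relaxation
`(N - r - 1)^(-β)`, and the relaxed constraints hold eventually by local Lipschitz continuity. The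
spectral coefficients of the comparison polynomials are Legendre coefficients of the optimal
trajectory, whose absolute sum stays below `d` (`IsPrimitive.sum_abs_legendreCoeff_le`).
-/

namespace PSControl

/-! ### Legendre polynomials: recurrences and the differential equation -/

theorem derivative_sq_sub_one_pow_succ (n : ℕ) :
    derivative ((X ^ 2 - 1 : ℝ[X]) ^ (n + 1)) = C (2 * ((n : ℝ) + 1)) * ((X ^ 2 - 1) ^ n * X) := by
  rw [derivative_pow]
  simp only [derivative_sub, derivative_X_pow, derivative_one, Nat.add_sub_cancel]
  push_cast
  simp only [map_mul, map_add, map_natCast, map_one, map_ofNat]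
  ring

theorem legendre_normalization_succ (n : ℕ) :
    1 / (2 ^ (n + 1) * ((n + 1).factorial : ℝ)) * (2 * ((n : ℝ) + 1))
      = 1 / (2 ^ n * (n.factorial : ℝ)) := by
  have h : (n.factorial : ℝ) ≠ 0 := by positivity
  rw [Nat.factorial_succ]
  push_cast
  field_simp
  ring

/-- Differentiate Rodrigues' formula once and expand the product `(t² - 1)^n t`. This and the next
recurrence imply all the other identities for Legendre polynomials. -/
theorem derivative_legendre_succ (n : ℕ) :
    derivative (legendre (n + 1)) = X * derivative (legendre n) + C ((n : ℝ) + 1) * legendre n := by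
  have key : derivative (legendre (n + 1)) =
      C (1 / (2 ^ n * (n.factorial : ℝ))) * derivative^[n + 1] ((X ^ 2 - 1) ^ n * X) := by
    rw [legendre, derivative_C_mul, ← Function.iterate_succ_apply' derivative (n + 1),
      Function.iterate_succ_apply, derivative_sq_sub_one_pow_succ, iterate_derivative_C_mul,
      ← mul_assoc, ← C_mul, legendre_normalization_succ]
  rw [key, iterate_derivative_mul_X]
  simp only [legendre, derivative_C_mul, ← Function.iterate_succ_apply' derivative,
    Nat.add_sub_cancel, nsmul_eq_mul]
  push_cast
  simp only [map_add, map_natCast, map_one]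
  ring

/-- Differentiate Rodrigues' formula twice. -/
theorem derivative_legendre_add_two (n : ℕ) :
    derivative (legendre (n + 2)) =
      C (2 * (n : ℝ) + 3) * legendre (n + 1) + derivative (legendre n) := by
  have h2 : derivative^[2] ((X ^ 2 - 1 : ℝ[X]) ^ (n + 2)) =
      C (2 * (((n + 1 : ℕ) : ℝ) + 1)) *
        (C (2 * (n : ℝ) + 3) * (X ^ 2 - 1) ^ (n + 1) + C (2 * ((n : ℝ) + 1)) * (X ^ 2 - 1) ^ n) := by
    rw [Function.iterate_succ_apply, Function.iterate_one, derivative_sq_sub_one_pow_succ,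
      derivative_C_mul, derivative_mul, derivative_sq_sub_one_pow_succ, derivative_X]
    push_cast
    simp only [map_mul, map_add, map_natCast, map_one, map_ofNat]
    ring
  have h1 : derivative (legendre (n + 2)) =
      C (1 / (2 ^ (n + 1) * ((n + 1).factorial : ℝ))) * derivative^[n + 1]
        (C (2 * (n : ℝ) + 3) * (X ^ 2 - 1) ^ (n + 1) + C (2 * ((n : ℝ) + 1)) * (X ^ 2 - 1) ^ n) := by
    rw [legendre, derivative_C_mul, ← Function.iterate_succ_apply' derivative (n + 2),
      show (n + 2).succ = n + 1 + 2 by omega, Function.iterate_add_apply, h2, iterate_derivative_C_mul,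
      ← mul_assoc, ← C_mul, legendre_normalization_succ (n + 1)]
  rw [h1, iterate_map_add, iterate_derivative_C_mul, iterate_derivative_C_mul, mul_add,
    ← mul_assoc _ (C (2 * ((n : ℝ) + 1))), ← C_mul, legendre_normalization_succ]
  simp only [legendre, derivative_C_mul, ← Function.iterate_succ_apply' derivative]
  ring

theorem X_mul_derivative_legendre_succ (n : ℕ) :
    X * derivative (legendre (n + 1)) =
      derivative (legendre n) + C ((n : ℝ) + 1) * legendre (n + 1) := by
  have h1 := derivative_legendre_succ (n + 1)
  have h2 := derivative_legendre_add_two n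
  push_cast at h1
  simp only [map_mul, map_add, map_natCast, map_one, map_ofNat] at *
  linear_combination h2 - h1

/-- The node polynomial `(1 - t²) L_N'` of the LGL points. -/
noncomputable def lglPoly (n : ℕ) : ℝ[X] := (1 - X ^ 2) * derivative (legendre n)

theorem lglPoly_succ (n : ℕ) :
    lglPoly (n + 1) = C ((n : ℝ) + 1) * (legendre n - X * legendre (n + 1)) := by
  have h1 := derivative_legendre_succ n
  have h2 := X_mul_derivative_legendre_succ n
  rw [lglPoly]
  linear_combination h1 - X * h2

theorem legendre_zero : legendre 0 = 1 := by simp [legendre]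

theorem lglPoly_zero : lglPoly 0 = 0 := by simp [lglPoly, legendre_zero]

theorem legendre_one : legendre 1 = X := by
  simp only [legendre, Function.iterate_one]
  norm_num
  rw [← mul_assoc, ← C_mul]
  norm_num

/-- The three-term recurrence. -/
theorem legendre_add_two (n : ℕ) :
    C ((n : ℝ) + 2) * legendre (n + 2) =
      C (2 * (n : ℝ) + 3) * (X * legendre (n + 1)) - C ((n : ℝ) + 1) * legendre n := by
  have h1 := lglPoly_succ (n + 1)
  have h2 := lglPoly_succ n
  have h3 := derivative_legendre_succ (n + 1)
  rw [lglPoly] at h1 h2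
  push_cast at h1 h3
  refine mul_left_cancel₀ (X_ne_zero (R := ℝ)) ?_
  simp only [map_mul, map_add, map_natCast, map_one, map_ofNat] at *
  linear_combination h1 - (1 - X ^ 2) * h3 - X * h2

/-- The Legendre differential equation `((1 - t²) L_n')' = -n (n + 1) L_n`. -/
theorem derivative_lglPoly (n : ℕ) :
    derivative (lglPoly n) = - C ((n : ℝ) * (n + 1)) * legendre n := by
  cases n with
  | zero => simp [lglPoly_zero]
  | succ n =>
    have h1 := X_mul_derivative_legendre_succ n
    rw [lglPoly_succ]
    simp only [derivative_mul, derivative_sub, derivative_C, derivative_X]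
    push_cast
    simp only [map_mul, map_add, map_natCast, map_one] at *
    linear_combination - ((n : ℝ[X]) + 1) * h1

/-- Combined with the differential equation, this is the source of the antiderivative of `L_{n+1}`,
and hence of the decay of Legendre coefficients under integration. -/
theorem lglPoly_succ_eq_sub (n : ℕ) :
    C (2 * (n : ℝ) + 3) * lglPoly (n + 1) =
      C (((n : ℝ) + 1) * (n + 2)) * (legendre n - legendre (n + 2)) := by
  have h1 := lglPoly_succ n
  have h2 := legendre_add_two n
  simp only [map_mul, map_add, map_natCast, map_one, map_ofNat] at *
  linear_combination (2 * (n : ℝ[X]) + 3) * h1 + ((n : ℝ[X]) + 1) * h2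

theorem eval_one_legendre (n : ℕ) : (legendre n).eval 1 = 1 := by
  induction n with
  | zero => simp [legendre_zero]
  | succ n ih =>
    have h := congrArg (eval 1) (lglPoly_succ n)
    simp only [lglPoly, eval_mul, eval_sub, eval_one, eval_pow, eval_X, eval_C, ih] at h
    have hn : (n : ℝ) + 1 ≠ 0 := by positivity
    have : (n + 1 : ℝ) * (1 - 1 * eval 1 (legendre (n + 1))) = 0 := by rw [← h]; ring
    have := (mul_eq_zero.1 this).resolve_left hn
    linarith

theorem eval_neg_one_legendre (n : ℕ) : (legendre n).eval (-1) = (-1) ^ n := by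
  induction n with
  | zero => simp [legendre_zero]
  | succ n ih =>
    have h := congrArg (eval (-1)) (lglPoly_succ n)
    simp only [lglPoly, eval_mul, eval_sub, eval_one, eval_pow, eval_X, eval_C, ih] at h
    have hn : (n : ℝ) + 1 ≠ 0 := by positivity
    have : (n + 1 : ℝ) * ((-1) ^ n - -1 * eval (-1) (legendre (n + 1))) = 0 := by rw [← h]; ring
    have := (mul_eq_zero.1 this).resolve_left hn
    rw [pow_succ]
    linarith

theorem natDegree_legendre_le (n : ℕ) : (legendre n).natDegree ≤ n := by
  refine (natDegree_C_mul_le _ _).trans ((natDegree_iterate_derivative _ _).trans ?_)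
  have h : ((X ^ 2 - 1 : ℝ[X]) ^ n).natDegree ≤ n * 2 := by
    refine natDegree_pow_le_of_le n ?_
    compute_degree
  omega

theorem coeff_legendre_ne_zero (n : ℕ) : (legendre n).coeff n ≠ 0 := by
  have h : ((X ^ 2 - 1 : ℝ[X]) ^ n).coeff (n + n) = 1 := by
    have h1 : ((X ^ 2 - 1 : ℝ[X]) ^ n).Monic := by
      refine Monic.pow ?_ n
      exact monic_X_pow_sub_C (1 : ℝ) two_ne_zero
    have h2 : ((X ^ 2 - 1 : ℝ[X]) ^ n).natDegree = n + n := by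
      rw [natDegree_pow, show (X ^ 2 - 1 : ℝ[X]) = X ^ 2 - C 1 by simp, natDegree_X_pow_sub_C]
      ring
    rw [← h2]
    exact h1
  rw [legendre, coeff_C_mul, coeff_iterate_derivative, h]
  have h3 : ((n + n).descFactorial n : ℝ) ≠ 0 := by
    exact_mod_cast (Nat.descFactorial_pos.2 (by omega)).ne'
  have h4 : (n.factorial : ℝ) ≠ 0 := by positivity
  simp only [nsmul_eq_mul, mul_one]
  positivity

theorem natDegree_legendre (n : ℕ) : (legendre n).natDegree = n :=
  le_antisymm (natDegree_legendre_le n) (le_natDegree_of_ne_zero (coeff_legendre_ne_zero n))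

theorem legendre_ne_zero (n : ℕ) : legendre n ≠ 0 := fun h =>
  coeff_legendre_ne_zero n (by simp [h])

/-! ### Pointwise bounds for Legendre polynomials -/

/-- An energy whose derivative has the sign of `t` increases with the distance from `0`. -/
theorem eval_le_of_derivative_eq_mul_X {p q : ℝ[X]} (h : derivative p = X * q)
    (hq : ∀ t, 0 ≤ q.eval t) {s t : ℝ} (hst : (0 ≤ s ∧ s ≤ t) ∨ (t ≤ s ∧ s ≤ 0)) :
    p.eval s ≤ p.eval t := by
  rcases hst with ⟨h0, h1⟩ | ⟨h1, h0⟩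
  · have : MonotoneOn (fun x => p.eval x) (Ici 0) := by
      refine monotoneOn_of_deriv_nonneg (convex_Ici 0) p.continuous.continuousOn
        p.differentiable.differentiableOn fun x hx => ?_
      rw [Polynomial.deriv, h, eval_mul, eval_X]
      rw [interior_Ici] at hx
      exact mul_nonneg (le_of_lt hx) (hq x)
    exact this h0 (mem_Ici.2 (h0.trans h1)) h1
  · have : AntitoneOn (fun x => p.eval x) (Iic 0) := by
      refine antitoneOn_of_deriv_nonpos (convex_Iic 0) p.continuous.continuousOn
        p.differentiable.differentiableOn fun x hx => ?_
      rw [Polynomial.deriv, h, eval_mul, eval_X]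
      rw [interior_Iic] at hx
      exact mul_nonpos_of_nonpos_of_nonneg (le_of_lt hx) (hq x)
    exact this (mem_Iic.2 (h1.trans h0)) h0 h1

/-- The Legendre polynomials are bounded by one on `[-1, 1]`. The energy
`L_n² + (1 - t²) L_n'² / (n (n + 1))` has derivative `2 t L_n'² / (n (n + 1))`, hence is largest at
the endpoints, where it equals one. -/
theorem abs_eval_legendre_le_one (n : ℕ) {t : ℝ} (ht : t ∈ Icc (-1 : ℝ) 1) :
    |(legendre n).eval t| ≤ 1 := by
  rcases Nat.eq_zero_or_pos n with rfl | hn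
  · simp [legendre_zero]
  set c : ℝ := n * (n + 1) with hc
  have hc0 : 0 < c := by positivity
  set p : ℝ[X] := C c * legendre n ^ 2 + lglPoly n * derivative (legendre n) with hp
  have hd : derivative p = X * (C 2 * derivative (legendre n) ^ 2) := by
    have h1 := derivative_lglPoly n
    have h3 : derivative (lglPoly n) = (-(2 * X)) * derivative (legendre n) +
        (1 - X ^ 2) * derivative (derivative (legendre n)) := by
      rw [lglPoly, derivative_mul]
      simp only [derivative_sub, derivative_one, derivative_X_pow]
      push_cast
      simp only [map_ofNat]
      ring
    have h2 : derivative p = C c * (2 * legendre n * derivative (legendre n)) +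
        (derivative (lglPoly n) * derivative (legendre n) +
          lglPoly n * derivative (derivative (legendre n))) := by
      rw [hp, derivative_add, derivative_mul, derivative_mul, derivative_C, derivative_sq, map_ofNat]
      ring
    have h4 : lglPoly n = (1 - X ^ 2) * derivative (legendre n) := rfl
    rw [h2]
    simp only [map_ofNat]
    rw [← hc] at h1
    linear_combination 2 * derivative (legendre n) * h1 - derivative (legendre n) * h3 +
      derivative (derivative (legendre n)) * h4
  have hq : ∀ t, 0 ≤ (C 2 * derivative (legendre n) ^ 2).eval t := fun t => by
    simp only [eval_mul, eval_C, eval_pow]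
    positivity
  have he1 : p.eval 1 = c := by
    simp [hp, lglPoly, eval_one_legendre]
  have he2 : p.eval (-1) = c := by
    simp [hp, lglPoly, eval_neg_one_legendre, ← pow_mul]
  have hle : p.eval t ≤ c := by
    rcases le_total 0 t with h0 | h0
    · exact he1 ▸ eval_le_of_derivative_eq_mul_X hd hq (Or.inl ⟨h0, ht.2⟩)
    · exact he2 ▸ eval_le_of_derivative_eq_mul_X hd hq (Or.inr ⟨ht.1, h0⟩)
  have hpe : p.eval t = c * (legendre n).eval t ^ 2 +
      (1 - t ^ 2) * (derivative (legendre n)).eval t ^ 2 := by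
    simp [hp, lglPoly]
    ring
  have h1t : 0 ≤ 1 - t ^ 2 := by nlinarith [ht.1, ht.2]
  have : c * (legendre n).eval t ^ 2 ≤ c * 1 := by
    nlinarith [mul_nonneg h1t (sq_nonneg ((derivative (legendre n)).eval t))]
  rw [← sq_le_one_iff_abs_le_one]
  exact le_of_mul_le_mul_left this hc0

theorem eval_zero_legendre_add_two (n : ℕ) :
    ((n : ℝ) + 2) * (legendre (n + 2)).eval 0 = -(((n : ℝ) + 1) * (legendre n).eval 0) := by
  have h := congrArg (eval 0) (legendre_add_two n)
  simpa using h

/-- The three-term recurrence at `0` gives `L_n(0)² = O(1/n)`. -/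
theorem eval_zero_legendre_sq_le (n : ℕ) :
    ((n : ℝ) + 1) * (legendre n).eval 0 ^ 2 + ((n : ℝ) + 2) * (legendre (n + 1)).eval 0 ^ 2 ≤ 1 := by
  induction n with
  | zero => simp [legendre_zero, legendre_one]
  | succ n ih =>
    have h := eval_zero_legendre_add_two n
    set a := (legendre n).eval 0
    set b := (legendre (n + 2)).eval 0
    have hb : b = -(((n : ℝ) + 1) * a) / (n + 2) := by
      rw [eq_div_iff (by positivity)]
      linarith
    have key : ((n : ℝ) + 3) * b ^ 2 ≤ ((n : ℝ) + 1) * a ^ 2 := by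
      rw [hb, div_pow, ← mul_div_assoc, div_le_iff₀ (by positivity)]
      have : 0 ≤ a ^ 2 * ((n : ℝ) + 1) := by positivity
      nlinarith
    push_cast
    linarith

/-- The Bernstein-type bound `(1 - t²) |L_n'(t)| ≤ √n`. With `q = (1 - t²) L_n'`, which satisfies
`(1 - t²) q'' = - n (n + 1) q`, the energy `q² + (1 - t²) q'² / (n (n + 1))` is largest at `0`. -/
theorem abs_eval_lglPoly_le (n : ℕ) (t : ℝ) (ht : t ∈ Icc (-1 : ℝ) 1) :
    |(lglPoly n).eval t| ≤ √n := by
  cases n with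
  | zero => simp [lglPoly_zero]
  | succ n =>
    set L := legendre (n + 1) with hL
    set c : ℝ := ((n : ℝ) + 1) * (n + 2) with hc
    have hc0 : 0 < c := by positivity
    set q := lglPoly (n + 1) with hq
    have h1 : derivative q = - C c * L := by
      rw [hq, derivative_lglPoly, hc]
      push_cast
      rw [show (n : ℝ) + 1 + 1 = n + 2 by ring]
    -- `p` is the negative of the energy
    set p : ℝ[X] := -(q ^ 2 + C c * ((1 - X ^ 2) * L ^ 2)) with hp
    have hd : derivative p = X * (C (2 * c) * L ^ 2) := by
      have h2 : derivative p = -(2 * q * derivative q + C c * ((-(2 * X)) * L ^ 2 +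
          (1 - X ^ 2) * (2 * L * derivative L))) := by
        rw [hp]
        simp only [derivative_neg, derivative_add, derivative_mul, derivative_sq, derivative_sub,
          derivative_one, derivative_X, derivative_C, map_ofNat]
        ring
      have h3 : q = (1 - X ^ 2) * derivative L := rfl
      rw [h2, h1, h3, C_mul (a := 2) (b := c)]
      simp only [map_ofNat]
      ring
    have hpos : ∀ t, 0 ≤ (C (2 * c) * L ^ 2).eval t := fun t => by
      simp only [eval_mul, eval_C, eval_pow]
      positivity
    have hle : p.eval 0 ≤ p.eval t := by
      rcases le_total 0 t with h0 | h0
      · exact eval_le_of_derivative_eq_mul_X hd hpos (Or.inl ⟨le_rfl, h0⟩)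
      · exact eval_le_of_derivative_eq_mul_X hd hpos (Or.inr ⟨h0, le_rfl⟩)
    have hq0 : q.eval 0 = (n + 1) * (legendre n).eval 0 := by
      rw [hq, lglPoly_succ]
      simp
    have e1 : p.eval t = -(q.eval t ^ 2 + c * ((1 - t ^ 2) * L.eval t ^ 2)) := by simp [hp]
    have e0 : p.eval 0 = -(((n + 1) * (legendre n).eval 0) ^ 2 + c * L.eval 0 ^ 2) := by
      simp [hp, hq0]
    have h1t : 0 ≤ c * ((1 - t ^ 2) * L.eval t ^ 2) := by
      have : 0 ≤ 1 - t ^ 2 := by nlinarith [ht.1, ht.2]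
      positivity
    have h5 := eval_zero_legendre_sq_le n
    have h6 : q.eval t ^ 2 ≤ (n + 1 : ℕ) := by
      have h7 : ((n + 1) * (legendre n).eval 0) ^ 2 + c * L.eval 0 ^ 2 =
          ((n : ℝ) + 1) * (((n : ℝ) + 1) * (legendre n).eval 0 ^ 2 + ((n : ℝ) + 2) * L.eval 0 ^ 2) := by
        rw [hc]; ring
      have h8 : ((n : ℝ) + 1) * (((n : ℝ) + 1) * (legendre n).eval 0 ^ 2 +
          ((n : ℝ) + 2) * L.eval 0 ^ 2) ≤ ((n : ℝ) + 1) * 1 := by gcongr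
      push_cast
      linarith
    exact Real.abs_le_sqrt h6

/-! ### Signs of Legendre polynomials outside `(-1, 1)` -/

/-- By induction, `L_n` and all `L_n'` with `n ≥ 1` are positive on `[1, ∞)`. -/
theorem legendre_pos_of_one_le (n : ℕ) :
    ∀ t : ℝ, 1 ≤ t → 1 ≤ (legendre n).eval t ∧ 0 ≤ (derivative (legendre n)).eval t ∧
      0 < (derivative (legendre (n + 1))).eval t := by
  induction n with
  | zero => intro t _; simp [legendre_zero, legendre_one]
  | succ n ih =>
    have hder : ∀ t : ℝ, 1 ≤ t → 0 < (derivative (legendre (n + 1))).eval t :=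
      fun t ht => (ih t ht).2.2
    intro t ht
    have hmono : MonotoneOn (fun x => (legendre (n + 1)).eval x) (Ici 1) := by
      refine monotoneOn_of_deriv_nonneg (convex_Ici 1) (legendre (n + 1)).continuous.continuousOn
        (legendre (n + 1)).differentiable.differentiableOn fun x hx => ?_
      rw [Polynomial.deriv]
      rw [interior_Ici] at hx
      exact (hder x (le_of_lt hx)).le
    have h1 : 1 ≤ (legendre (n + 1)).eval t := by
      have := hmono (mem_Ici.2 le_rfl) (mem_Ici.2 ht) ht
      simpa [eval_one_legendre] using this
    refine ⟨h1, (hder t ht).le, ?_⟩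
    rw [derivative_legendre_succ]
    simp only [eval_add, eval_mul, eval_X, eval_C]
    have := hder t ht
    positivity

theorem legendre_comp_neg_X (n : ℕ) :
    (legendre n).comp (-X) = C ((-1) ^ n) * legendre n ∧
      (legendre (n + 1)).comp (-X) = C ((-1) ^ (n + 1)) * legendre (n + 1) := by
  induction n with
  | zero => simp [legendre_zero, legendre_one]
  | succ n ih =>
    refine ⟨ih.2, ?_⟩
    have h := legendre_add_two n
    have h2 := congrArg (fun p => p.comp (-X)) h
    simp only [mul_comp, sub_comp, C_comp, X_comp, ih.1, ih.2] at h2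
    have hn : (C ((n : ℝ) + 2) : ℝ[X]) ≠ 0 := by
      rw [Ne, C_eq_zero]; positivity
    refine mul_left_cancel₀ hn ?_
    rw [h2]
    simp only [map_pow, map_neg, map_one] at *
    linear_combination (-1) ^ (n + 1) * h

theorem eval_derivative_legendre_ne_zero {n : ℕ} (hn : 1 ≤ n) {t : ℝ} (ht : 1 ≤ |t|) :
    (derivative (legendre n)).eval t ≠ 0 := by
  obtain ⟨n, rfl⟩ := Nat.exists_eq_add_of_le' hn
  rcases le_abs.1 ht with h | h
  · exact ((legendre_pos_of_one_le n t h).2.2).ne'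
  · have h1 := congrArg (fun p => (derivative p).eval t) (legendre_comp_neg_X n).2
    simp only [derivative_comp, derivative_C_mul, eval_mul, eval_comp, eval_C, eval_neg, eval_X,
      derivative_neg, derivative_X, eval_one] at h1
    have h2 := (legendre_pos_of_one_le n (-t) h).2.2
    intro h0
    rw [h0] at h1
    simp at h1
    linarith

/-! ### Orthogonality and Legendre expansions of polynomials -/

/-- The integral of a polynomial over `[-1, 1]`, as a linear functional. -/
noncomputable def polyInt : ℝ[X] →ₗ[ℝ] ℝ where
  toFun p := ∫ t in (-1 : ℝ)..1, p.eval t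
  map_add' p q := by
    simp only [eval_add]
    exact intervalIntegral.integral_add (p.continuous.intervalIntegrable _ _)
      (q.continuous.intervalIntegrable _ _)
  map_smul' c p := by simp

theorem polyInt_apply (p : ℝ[X]) : polyInt p = ∫ t in (-1 : ℝ)..1, p.eval t := rfl

theorem polyInt_derivative (p : ℝ[X]) : polyInt (derivative p) = p.eval 1 - p.eval (-1) := by
  rw [polyInt_apply]
  exact intervalIntegral.integral_eq_sub_of_hasDerivAt (fun x _ => p.hasDerivAt x)
    ((derivative p).continuous.intervalIntegrable _ _)

theorem polyInt_derivative_mul (p q : ℝ[X]) :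
    polyInt (derivative p * q) =
      p.eval 1 * q.eval 1 - p.eval (-1) * q.eval (-1) - polyInt (p * derivative q) := by
  have h := polyInt_derivative (p * q)
  rw [derivative_mul, map_add, eval_mul, eval_mul] at h
  linarith

theorem polyInt_C_mul (c : ℝ) (p : ℝ[X]) : polyInt (C c * p) = c * polyInt p := by
  rw [← smul_eq_C_mul, map_smul, smul_eq_mul]

theorem eval_one_lglPoly (n : ℕ) : (lglPoly n).eval 1 = 0 := by simp [lglPoly]

theorem eval_neg_one_lglPoly (n : ℕ) : (lglPoly n).eval (-1) = 0 := by simp [lglPoly]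

theorem polyInt_lglPoly_mul_derivative (n : ℕ) (p : ℝ[X]) :
    polyInt (lglPoly n * derivative p) = n * (n + 1) * polyInt (legendre n * p) := by
  have h := polyInt_derivative_mul (lglPoly n) p
  rw [eval_one_lglPoly, eval_neg_one_lglPoly, derivative_lglPoly, neg_mul, neg_mul, map_neg,
    mul_assoc, polyInt_C_mul] at h
  linarith

theorem polyInt_legendre_mul_legendre_of_ne {m n : ℕ} (h : m ≠ n) :
    polyInt (legendre m * legendre n) = 0 := by
  have h1 := polyInt_lglPoly_mul_derivative m (legendre n)
  have h2 := polyInt_lglPoly_mul_derivative n (legendre m)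
  have h3 : lglPoly n * derivative (legendre m) = lglPoly m * derivative (legendre n) := by
    simp only [lglPoly]; ring
  rw [h3, h1, mul_comm (legendre n)] at h2
  have h4 : ((m : ℝ) - n) * (m + n + 1) * polyInt (legendre m * legendre n) = 0 := by
    linear_combination h2
  have h5 : (m : ℝ) - n ≠ 0 := sub_ne_zero.2 (by exact_mod_cast h)
  have h6 : (m : ℝ) + n + 1 ≠ 0 := by positivity
  simpa [h5, h6] using h4

/-- The Legendre polynomials up to degree `M` span the polynomials of degree at most `M`. -/
theorem exists_eq_sum_legendre (M : ℕ) :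
    ∀ p : ℝ[X], p.natDegree ≤ M →
      ∃ b : ℕ → ℝ, p = ∑ n ∈ Finset.range (M + 1), C (b n) * legendre n := by
  induction M with
  | zero =>
    intro p hp
    refine ⟨fun _ => p.coeff 0, ?_⟩
    simpa [legendre_zero] using eq_C_of_natDegree_le_zero hp
  | succ M ih =>
    intro p hp
    set b := p.coeff (M + 1) / (legendre (M + 1)).coeff (M + 1) with hb
    have hq : (p - C b * legendre (M + 1)).natDegree ≤ M := by
      have h1 : (p - C b * legendre (M + 1)).natDegree ≤ M + 1 := by
        refine (natDegree_sub_le _ _).trans (max_le hp ?_)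
        exact (natDegree_C_mul_le _ _).trans (natDegree_legendre_le _)
      have h2 : (p - C b * legendre (M + 1)).coeff (M + 1) = 0 := by
        rw [coeff_sub, coeff_C_mul, hb, div_mul_cancel₀ _ (coeff_legendre_ne_zero _), sub_self]
      exact Nat.le_of_lt_succ (Nat.lt_of_le_of_ne h1 fun h3 => by
        have : p - C b * legendre (M + 1) = 0 := by
          rw [← leadingCoeff_eq_zero, leadingCoeff, h3]
          exact h2
        rw [this] at h3
        simp at h3)
    obtain ⟨c, hc⟩ := ih _ hq
    refine ⟨Function.update c (M + 1) b, ?_⟩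
    rw [Finset.sum_range_succ, Function.update_self]
    have : ∑ n ∈ Finset.range (M + 1), C (Function.update c (M + 1) b n) * legendre n =
        ∑ n ∈ Finset.range (M + 1), C (c n) * legendre n := by
      refine Finset.sum_congr rfl fun n hn => ?_
      rw [Function.update_of_ne (Finset.mem_range.1 hn).ne]
    rw [this, ← hc]
    ring

theorem polyInt_legendre_mul_of_natDegree_lt {n : ℕ} {p : ℝ[X]} (hp : p.natDegree < n) :
    polyInt (legendre n * p) = 0 := by
  obtain ⟨b, hb⟩ := exists_eq_sum_legendre p.natDegree p le_rfl
  rw [hb, Finset.mul_sum, map_sum]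
  refine Finset.sum_eq_zero fun k hk => ?_
  rw [mul_left_comm, polyInt_C_mul, polyInt_legendre_mul_legendre_of_ne, mul_zero]
  have := Finset.mem_range.1 hk
  omega

theorem polyInt_legendre_sq (n : ℕ) :
    polyInt (legendre n * legendre n) = 2 / (2 * n + 1) := by
  cases n with
  | zero =>
    rw [legendre_zero, polyInt_apply]
    norm_num
  | succ n =>
    have h1 : derivative (legendre (n + 2)) =
      C (2 * (n : ℝ) + 3) * legendre (n + 1) + derivative (legendre n) :=
      derivative_legendre_add_two n
    have h2 := polyInt_derivative_mul (legendre (n + 2)) (legendre (n + 1))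
    have h3 : polyInt (legendre (n + 2) * derivative (legendre (n + 1))) = 0 := by
      refine polyInt_legendre_mul_of_natDegree_lt ?_
      have := natDegree_derivative_le (legendre (n + 1))
      rw [natDegree_legendre] at this
      omega
    have h4 : polyInt (legendre (n + 1) * derivative (legendre n)) = 0 := by
      refine polyInt_legendre_mul_of_natDegree_lt ?_
      have := natDegree_derivative_le (legendre n)
      rw [natDegree_legendre] at this
      omega
    rw [h1, add_mul, map_add, mul_assoc, polyInt_C_mul, mul_comm (derivative _), h3, h4,
      eval_one_legendre, eval_one_legendre, eval_neg_one_legendre, eval_neg_one_legendre] at h2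
    have h5 : ((-1 : ℝ) ^ (n + 2) * (-1) ^ (n + 1)) = -1 := by
      rw [← pow_add, show n + 2 + (n + 1) = 2 * (n + 1) + 1 by ring]
      simp [pow_succ, pow_mul]
    rw [h5] at h2
    push_cast
    rw [eq_div_iff (by positivity)]
    linarith

/-- The `n`-th Legendre coefficient of a function on `[-1, 1]`. -/
noncomputable def legendreCoeff (v : ℝ → ℝ) (n : ℕ) : ℝ :=
  ((n : ℝ) + 1 / 2) * ∫ t in (-1 : ℝ)..1, (legendre n).eval t * v t

theorem legendreCoeff_polynomial (p : ℝ[X]) (n : ℕ) :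
    legendreCoeff (fun t => p.eval t) n = ((n : ℝ) + 1 / 2) * polyInt (legendre n * p) := by
  simp [legendreCoeff, polyInt_apply]

/-- The Legendre expansion truncated after the term of degree `M`. -/
noncomputable def legendreSum (a : ℕ → ℝ) (M : ℕ) : ℝ[X] :=
  ∑ n ∈ Finset.range (M + 1), C (a n) * legendre n

theorem natDegree_legendreSum_le (a : ℕ → ℝ) (M : ℕ) : (legendreSum a M).natDegree ≤ M := by
  refine natDegree_sum_le_of_forall_le _ _ fun n hn => ?_
  refine (natDegree_C_mul_le _ _).trans ((natDegree_legendre_le n).trans ?_)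
  exact Nat.le_of_lt_succ (Finset.mem_range.1 hn)

theorem eval_legendreSum (a : ℕ → ℝ) (M : ℕ) (t : ℝ) :
    (legendreSum a M).eval t = ∑ n ∈ Finset.range (M + 1), a n * (legendre n).eval t := by
  simp [legendreSum, eval_finsetSum]

theorem legendreCoeff_legendreSum (a : ℕ → ℝ) {M n : ℕ} (hn : n ≤ M) :
    legendreCoeff (fun t => (legendreSum a M).eval t) n = a n := by
  rw [legendreCoeff_polynomial, legendreSum, Finset.mul_sum, map_sum,
    Finset.sum_eq_single_of_mem n (Finset.mem_range.2 (Nat.lt_succ_of_le hn)), mul_left_comm,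
    polyInt_C_mul, polyInt_legendre_sq]
  · field_simp
  · intro k _ hk
    rw [mul_left_comm, polyInt_C_mul, polyInt_legendre_mul_legendre_of_ne hk.symm, mul_zero]

theorem eq_legendreSum_legendreCoeff {p : ℝ[X]} {M : ℕ} (hp : p.natDegree ≤ M) :
    p = legendreSum (legendreCoeff fun t => p.eval t) M := by
  obtain ⟨b, hb⟩ := exists_eq_sum_legendre M p hp
  change p = legendreSum b M at hb
  conv_lhs => rw [hb]
  refine Finset.sum_congr rfl fun n hn => ?_
  rw [hb, legendreCoeff_legendreSum b (Nat.le_of_lt_succ (Finset.mem_range.1 hn))]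

/-- A polynomial is bounded on `[-1, 1]` by the sum of its absolute Legendre coefficients. -/
theorem abs_eval_le_sum_legendreCoeff {p : ℝ[X]} {M : ℕ} (hp : p.natDegree ≤ M) {t : ℝ}
    (ht : t ∈ Icc (-1 : ℝ) 1) :
    |p.eval t| ≤ ∑ n ∈ Finset.range (M + 1), |legendreCoeff (fun t => p.eval t) n| := by
  conv_lhs => rw [eq_legendreSum_legendreCoeff hp]
  rw [eval_legendreSum]
  refine (Finset.abs_sum_le_sum_abs _ _).trans (Finset.sum_le_sum fun n _ => ?_)
  rw [abs_mul]
  exact mul_le_of_le_one_right (abs_nonneg _) (abs_eval_legendre_le_one n ht)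

theorem exists_derivative_eq (q : ℝ[X]) (c : ℝ) :
    ∃ p : ℝ[X], derivative p = q ∧ p.eval (-1) = c ∧ p.natDegree ≤ q.natDegree + 1 := by
  obtain ⟨p, hp, hd⟩ : ∃ p : ℝ[X], derivative p = q ∧ p.natDegree ≤ q.natDegree + 1 := by
    refine ⟨∑ i ∈ Finset.range (q.natDegree + 1), C (q.coeff i / (i + 1)) * X ^ (i + 1), ?_, ?_⟩
    · rw [derivative_sum]
      conv_rhs => rw [q.as_sum_range_C_mul_X_pow]
      refine Finset.sum_congr rfl fun i _ => ?_
      rw [derivative_C_mul_X_pow]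
      have : (i : ℝ) + 1 ≠ 0 := by positivity
      push_cast
      rw [div_mul_cancel₀ _ this]
    · refine natDegree_sum_le_of_forall_le _ _ fun i hi => ?_
      refine (natDegree_C_mul_X_pow_le _ _).trans ?_
      have := Finset.mem_range.1 hi
      omega
  refine ⟨p + C (c - p.eval (-1)), ?_, ?_, ?_⟩
  · simp [hp]
  · simp
  · rw [natDegree_add_C]; exact hd

/-- A polynomial with prescribed `k`-th derivative and prescribed lower derivatives at `-1`. -/
theorem exists_iterate_derivative_eq (q : ℝ[X]) (c : ℕ → ℝ) (k : ℕ) :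
    ∃ p : ℝ[X], derivative^[k] p = q ∧ (∀ i < k, (derivative^[i] p).eval (-1) = c i) ∧
      p.natDegree ≤ q.natDegree + k := by
  induction k generalizing c with
  | zero => exact ⟨q, rfl, by simp, le_rfl⟩
  | succ k ih =>
    obtain ⟨p, h1, h2, h3⟩ := ih (fun i => c (i + 1))
    obtain ⟨P, H1, H2, H3⟩ := exists_derivative_eq p (c 0)
    refine ⟨P, by rw [Function.iterate_succ_apply, H1, h1], fun i hi => ?_, by omega⟩
    cases i with
    | zero => exact H2
    | succ i => rw [Function.iterate_succ_apply, H1]; exact h2 i (by omega)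

/-! ### Legendre-Gauss-Lobatto nodes -/

/-- The derivatives of `(t² - 1)^N` of order less than `N` still vanish at the endpoints. -/
theorem eval_iterate_derivative_sq_sub_one_pow {N k : ℕ} (hk : k < N) {t : ℝ} (ht : t ^ 2 = 1) :
    (derivative^[k] ((X ^ 2 - 1 : ℝ[X]) ^ N)).eval t = 0 := by
  obtain ⟨q, hq⟩ := pow_sub_dvd_iterate_derivative_pow (X ^ 2 - 1 : ℝ[X]) N k
  rw [hq, eval_mul, eval_pow, eval_sub, eval_pow, eval_X, eval_one, ht, sub_self,
    zero_pow (by omega), zero_mul]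

theorem iterate_derivative_sq_sub_one_pow_ne_zero {N k : ℕ} (hk : k ≤ N) :
    derivative^[k] ((X ^ 2 - 1 : ℝ[X]) ^ N) ≠ 0 := by
  intro h
  refine legendre_ne_zero N ?_
  rw [legendre, ← Nat.sub_add_cancel hk, Function.iterate_add_apply, Nat.sub_add_cancel hk, h,
    iterate_derivative_zero, mul_zero]

/-- Rolle's theorem gives a root of the next derivative between consecutive roots, and the endpoints
remain roots, so each derivative of order less than `N` has at least one more root than the previous
one. -/
theorem card_roots_iterate_derivative {N k : ℕ} (hk : k < N) :
    k + 2 ≤ (derivative^[k] ((X ^ 2 - 1 : ℝ[X]) ^ N)).roots.toFinset.card := by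
  have hmem : ∀ k < N, ({-1, 1} : Finset ℝ) ⊆
      (derivative^[k] ((X ^ 2 - 1 : ℝ[X]) ^ N)).roots.toFinset := by
    intro k hk t ht
    rw [Multiset.mem_toFinset, mem_roots (iterate_derivative_sq_sub_one_pow_ne_zero hk.le), IsRoot]
    refine eval_iterate_derivative_sq_sub_one_pow hk ?_
    rcases Finset.mem_insert.1 ht with rfl | h
    · norm_num
    · rw [Finset.mem_singleton.1 h]; norm_num
  have hcard : ({-1, 1} : Finset ℝ).card = 2 := Finset.card_pair (by norm_num)
  induction k with
  | zero =>
    have := Finset.card_le_card (hmem 0 hk)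
    omega
  | succ k ih =>
    have h1 := ih (by omega)
    have h2 := card_roots_toFinset_le_card_roots_derivative_sdiff_roots_succ
      (derivative^[k] ((X ^ 2 - 1 : ℝ[X]) ^ N))
    rw [← Function.iterate_succ_apply' derivative] at h2
    have h3 := hmem k (by omega)
    have h4 := hmem (k + 1) hk
    set A := (derivative^[k] ((X ^ 2 - 1 : ℝ[X]) ^ N)).roots.toFinset
    set B := (derivative^[k + 1] ((X ^ 2 - 1 : ℝ[X]) ^ N)).roots.toFinset
    have h5 : (B \ A) ∪ {-1, 1} ⊆ B := Finset.union_subset Finset.sdiff_subset h4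
    have h6 : Disjoint (B \ A) ({-1, 1} : Finset ℝ) :=
      Finset.disjoint_of_subset_right h3 Finset.sdiff_disjoint
    have h7 := Finset.card_le_card h5
    rw [Finset.card_union_of_disjoint h6, hcard] at h7
    change (A.card ≤ (B \ A).card + 1) at h2
    omega

/-- Two further applications of Rolle's theorem to the derivative of order `N - 1` of `(t² - 1)^N`. -/
theorem le_card_roots_derivative_legendre (N : ℕ) :
    N ≤ (derivative (legendre N)).roots.toFinset.card + 1 := by
  cases N with
  | zero => simp
  | succ n =>
    have h1 := card_roots_iterate_derivative (N := n + 1) (Nat.lt_succ_self n)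
    have h2 := card_roots_toFinset_le_derivative (derivative^[n] ((X ^ 2 - 1 : ℝ[X]) ^ (n + 1)))
    have h3 := card_roots_toFinset_le_derivative (legendre (n + 1))
    have h4 : (legendre (n + 1)).roots =
        (derivative (derivative^[n] ((X ^ 2 - 1 : ℝ[X]) ^ (n + 1)))).roots := by
      rw [legendre, roots_C_mul _ (by positivity), Function.iterate_succ_apply']
    rw [h4] at h3
    omega

theorem derivative_legendre_ne_zero {N : ℕ} (hN : 1 ≤ N) : derivative (legendre N) ≠ 0 := by
  intro h
  have := eval_derivative_legendre_ne_zero hN (t := 1) (by simp)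
  simp [h] at this

theorem abs_lt_one_of_mem_roots {N : ℕ} (hN : 1 ≤ N) {t : ℝ}
    (ht : t ∈ (derivative (legendre N)).roots.toFinset) : |t| < 1 := by
  by_contra h
  refine eval_derivative_legendre_ne_zero hN (not_lt.1 h) ?_
  rw [Multiset.mem_toFinset, mem_roots (derivative_legendre_ne_zero hN)] at ht
  exact ht

theorem card_lglNodes {N : ℕ} (hN : 1 ≤ N) : (lglNodes N).card = N + 1 := by
  have h1 : (1 : ℝ) ∉ (derivative (legendre N)).roots.toFinset := fun h => by
    simpa using abs_lt_one_of_mem_roots hN h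
  have h2 : (-1 : ℝ) ∉ insert 1 (derivative (legendre N)).roots.toFinset := fun h => by
    rcases Finset.mem_insert.1 h with h | h
    · norm_num at h
    · simpa using abs_lt_one_of_mem_roots hN h
  rw [lglNodes, Finset.card_insert_of_notMem h2, Finset.card_insert_of_notMem h1]
  have h3 := le_card_roots_derivative_legendre N
  have h4 : (derivative (legendre N)).roots.toFinset.card ≤ N - 1 :=
    (Multiset.toFinset_card_le _).trans ((card_roots' _).trans
      ((natDegree_derivative_le _).trans (by rw [natDegree_legendre])))
  omega

theorem mem_lglNodes {N : ℕ} (hN : 1 ≤ N) {t : ℝ} :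
    t ∈ lglNodes N ↔ t = -1 ∨ t = 1 ∨ (derivative (legendre N)).eval t = 0 := by
  rw [lglNodes, Finset.mem_insert, Finset.mem_insert, Multiset.mem_toFinset,
    mem_roots (derivative_legendre_ne_zero hN), IsRoot]

theorem node_eq_orderEmbOfFin {N : ℕ} (hN : 1 ≤ N) (k : Fin (N + 1)) :
    node N k = (lglNodes N).orderEmbOfFin (card_lglNodes hN) k := by
  rw [node, Finset.orderEmbOfFin_apply, List.getD_eq_getElem]
  rfl

theorem node_mem {N : ℕ} (hN : 1 ≤ N) (k : Fin (N + 1)) : node N k ∈ lglNodes N := by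
  rw [node_eq_orderEmbOfFin hN]
  exact Finset.orderEmbOfFin_mem _ _ _

theorem node_injective {N : ℕ} (hN : 1 ≤ N) : Function.Injective (node N) := by
  have : node N = (lglNodes N).orderEmbOfFin (card_lglNodes hN) :=
    funext (node_eq_orderEmbOfFin hN)
  rw [this]
  exact ((lglNodes N).orderEmbOfFin (card_lglNodes hN)).injective

theorem mem_Icc_of_mem_lglNodes {N : ℕ} (hN : 1 ≤ N) {t : ℝ} (ht : t ∈ lglNodes N) :
    t ∈ Icc (-1 : ℝ) 1 := by
  rcases Finset.mem_insert.1 ht with rfl | h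
  · norm_num
  · rcases Finset.mem_insert.1 h with rfl | h
    · norm_num
    · exact abs_le.1 (abs_lt_one_of_mem_roots hN h).le

theorem node_mem_Icc {N : ℕ} (hN : 1 ≤ N) (k : Fin (N + 1)) : node N k ∈ Icc (-1 : ℝ) 1 :=
  mem_Icc_of_mem_lglNodes hN (node_mem hN k)

theorem node_zero {N : ℕ} (hN : 1 ≤ N) : node N 0 = -1 := by
  rw [node_eq_orderEmbOfFin hN]
  refine (Finset.orderEmbOfFin_zero (card_lglNodes hN) (Nat.succ_pos N)).trans ?_
  refine le_antisymm (Finset.min'_le _ _ ((mem_lglNodes hN).2 (Or.inl rfl))) ?_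
  exact (mem_Icc_of_mem_lglNodes hN (Finset.min'_mem _ _)).1

theorem node_last {N : ℕ} (hN : 1 ≤ N) : node N (Fin.last N) = 1 := by
  rw [node_eq_orderEmbOfFin hN]
  refine (Finset.orderEmbOfFin_last (card_lglNodes hN) (Nat.succ_pos N)).trans ?_
  refine le_antisymm ?_ (Finset.le_max' _ _ ((mem_lglNodes hN).2 (Or.inr (Or.inl rfl))))
  exact (mem_Icc_of_mem_lglNodes hN (Finset.max'_mem _ _)).2

theorem eval_lglPoly_node {N : ℕ} (hN : 1 ≤ N) (k : Fin (N + 1)) :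
    (lglPoly N).eval (node N k) = 0 := by
  rcases (mem_lglNodes hN).1 (node_mem hN k) with h | h | h
  · rw [h, eval_neg_one_lglPoly]
  · rw [h, eval_one_lglPoly]
  · rw [lglPoly, eval_mul, h, mul_zero]

theorem eval_derivative_legendre_node {N : ℕ} (hN : 1 ≤ N) {k : Fin (N + 1)} (h0 : k ≠ 0)
    (hl : k ≠ Fin.last N) : (derivative (legendre N)).eval (node N k) = 0 := by
  rcases (mem_lglNodes hN).1 (node_mem hN k) with h | h | h
  · exact absurd (node_injective hN (h.trans (node_zero hN).symm)) h0
  · exact absurd (node_injective hN (h.trans (node_last hN).symm)) hl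
  · exact h

/-! ### The Lagrange basis at the nodes and the differentiation matrix -/

/-- The Lagrange basis polynomial of the node `t_k`. -/
noncomputable def lglBasis (N : ℕ) (k : Fin (N + 1)) : ℝ[X] :=
  Lagrange.basis Finset.univ (node N) k

theorem natDegree_lglPoly_le (N : ℕ) : (lglPoly N).natDegree ≤ N + 1 := by
  cases N with
  | zero => simp [lglPoly_zero]
  | succ n =>
    have h1 : (derivative (legendre (n + 1))).natDegree ≤ n := by
      have := natDegree_derivative_le (legendre (n + 1))
      rwa [natDegree_legendre] at this
    have h2 : (1 - X ^ 2 : ℝ[X]).natDegree ≤ 2 := by compute_degree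
    have := natDegree_mul_le_of_le h2 h1
    rw [lglPoly]
    omega

theorem coeff_lglPoly (N : ℕ) : (lglPoly N).coeff (N + 1) = -N * (legendre N).coeff N := by
  have h := congrArg (fun p => p.coeff N) (derivative_lglPoly N)
  simp only [coeff_derivative, neg_mul, coeff_neg, coeff_C_mul] at h
  have hN : (N : ℝ) + 1 ≠ 0 := by positivity
  refine mul_right_cancel₀ hN ?_
  rw [h]
  ring

/-- Both sides have degree `N + 1`, the same leading coefficient and the nodes as roots. -/
theorem lglPoly_eq_nodal {N : ℕ} (hN : 1 ≤ N) :
    lglPoly N = C (-N * (legendre N).coeff N) * Lagrange.nodal Finset.univ (node N) := by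
  have hinj : Set.InjOn (node N) (Finset.univ : Finset (Fin (N + 1))) :=
    (node_injective hN).injOn
  refine Polynomial.eq_of_degree_sub_lt_of_eval_index_eq _ hinj ?_ ?_
  · set p := lglPoly N - C (-N * (legendre N).coeff N) * Lagrange.nodal Finset.univ (node N)
    have h1 : (Lagrange.nodal Finset.univ (node N)).natDegree = N + 1 := by
      simp [Lagrange.natDegree_nodal]
    have h2 : (Lagrange.nodal Finset.univ (node N)).coeff (N + 1) = 1 := by
      have h := Lagrange.nodal_monic (s := Finset.univ) (v := node N)
      rwa [Monic, leadingCoeff, h1] at h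
    have h3 : p.natDegree ≤ N + 1 := by
      refine (natDegree_sub_le _ _).trans (max_le (natDegree_lglPoly_le N) ?_)
      exact (natDegree_C_mul_le _ _).trans h1.le
    have h4 : p.coeff (N + 1) = 0 := by
      simp only [p, coeff_sub, coeff_C_mul, h2, coeff_lglPoly]
      ring
    rw [Finset.card_univ, Fintype.card_fin, degree_lt_iff_coeff_zero]
    intro m hm
    rcases hm.eq_or_lt with h | h
    · rw [← h, h4]
    · exact coeff_eq_zero_of_natDegree_lt (h3.trans_lt h)
  · intro k hk
    rw [eval_lglPoly_node hN, eval_mul, Lagrange.eval_nodal_at_node hk, mul_zero]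

/-- The nodes are simple roots of `lglPoly N`, whose derivative is a multiple of `L_N`. In particular
the quotients in the weights and in the differentiation matrix are meaningful. -/
theorem eval_legendre_node_ne_zero {N : ℕ} (hN : 1 ≤ N) (k : Fin (N + 1)) :
    (legendre N).eval (node N k) ≠ 0 := by
  intro h
  have h1 := congrArg (fun p => (derivative p).eval (node N k)) (lglPoly_eq_nodal hN)
  have h2 : Lagrange.nodalWeight Finset.univ (node N) k ≠ 0 :=
    Lagrange.nodalWeight_ne_zero (node_injective hN).injOn (Finset.mem_univ k)
  rw [Lagrange.nodalWeight_eq_eval_derivative_nodal (Finset.mem_univ k)] at h2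
  have h3 : (N : ℝ) ≠ 0 := by positivity
  simp only [derivative_lglPoly, eval_mul, h, mul_zero, derivative_C_mul, eval_C] at h1
  rcases mul_eq_zero.1 h1.symm with h4 | h4
  · exact (mul_ne_zero (neg_ne_zero.2 h3) (coeff_legendre_ne_zero N)) h4
  · rw [h4, inv_zero] at h2
    exact h2 rfl

/-- `ℓ_k(t) = - (1 - t²) L_N'(t) / (N (N + 1) L_N(t_k) (t - t_k))`. -/
theorem C_mul_lglBasis {N : ℕ} (hN : 1 ≤ N) (k : Fin (N + 1)) :
    C (-(N * (N + 1)) * (legendre N).eval (node N k)) * ((X - C (node N k)) * lglBasis N k) =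
      lglPoly N := by
  have h1 := congrArg (fun p => (derivative p).eval (node N k)) (lglPoly_eq_nodal hN)
  have h2 := Lagrange.nodalWeight_eq_eval_derivative_nodal (v := node N) (Finset.mem_univ k)
  have h3 : Lagrange.nodalWeight Finset.univ (node N) k ≠ 0 :=
    Lagrange.nodalWeight_ne_zero (node_injective hN).injOn (Finset.mem_univ k)
  have h4 : (X - C (node N k)) * lglBasis N k =
      C (Lagrange.nodalWeight Finset.univ (node N) k) * Lagrange.nodal Finset.univ (node N) := by
    rw [lglBasis, Lagrange.basis_eq_prod_sub_inv_mul_nodal_div (Finset.mem_univ k),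
      ← Lagrange.nodal_erase_eq_nodal_div (Finset.mem_univ k), mul_left_comm,
      ← Lagrange.nodal_eq_mul_nodal_erase (Finset.mem_univ k)]
  simp only [derivative_lglPoly, eval_mul, derivative_C_mul, eval_C, ← C_neg] at h1
  rw [h4, lglPoly_eq_nodal hN, ← mul_assoc, ← C_mul, h1, mul_assoc]
  congr 2
  rw [h2, mul_inv_cancel₀, mul_one]
  intro h
  rw [h2, h, inv_zero] at h3
  exact h3 rfl

/-- The derivative of `C_mul_lglBasis`. Evaluating it, or its derivative, at the nodes gives the entries
of the differentiation matrix. -/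
theorem lglBasis_add_derivative {N : ℕ} (hN : 1 ≤ N) (k : Fin (N + 1)) :
    C ((legendre N).eval (node N k)) *
      (lglBasis N k + (X - C (node N k)) * derivative (lglBasis N k)) = legendre N := by
  have h := congrArg derivative (C_mul_lglBasis hN k)
  rw [derivative_lglPoly, derivative_C_mul, derivative_mul] at h
  have h3 : (C (-(N * (N + 1)) : ℝ)) ≠ 0 := by
    rw [Ne, C_eq_zero]
    have : (0 : ℝ) < N := by exact_mod_cast hN
    have : (0 : ℝ) < N * (N + 1) := by positivity
    linarith
  refine mul_left_cancel₀ h3 ?_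
  rw [C_mul, derivative_sub, derivative_X, derivative_C, sub_zero, one_mul, mul_assoc, ← C_neg] at h
  exact h

theorem eval_lglBasis_self {N : ℕ} (hN : 1 ≤ N) (k : Fin (N + 1)) :
    (lglBasis N k).eval (node N k) = 1 :=
  Lagrange.eval_basis_self (node_injective hN).injOn (Finset.mem_univ k)

theorem eval_lglBasis_of_ne {N : ℕ} {i k : Fin (N + 1)} (h : k ≠ i) :
    (lglBasis N k).eval (node N i) = 0 :=
  Lagrange.eval_basis_of_ne h (Finset.mem_univ i)

theorem natDegree_lglBasis {N : ℕ} (hN : 1 ≤ N) (k : Fin (N + 1)) :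
    (lglBasis N k).natDegree = N := by
  rw [lglBasis, Lagrange.natDegree_basis (node_injective hN).injOn (Finset.mem_univ k)]
  simp

theorem two_mul_eval_derivative_lglPoly (N : ℕ) {t : ℝ} (ht : t ^ 2 = 1) :
    2 * t * (derivative (legendre N)).eval t = N * (N + 1) * (legendre N).eval t := by
  have h := congrArg (eval t) (derivative_lglPoly N)
  simp only [lglPoly, derivative_mul, derivative_sub, derivative_one, derivative_X_pow, eval_add,
    eval_mul, eval_sub, eval_one, eval_pow, eval_X, eval_zero, ht, eval_neg, eval_C] at h
  norm_num at h
  linarith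

/-- The differentiation matrix consists of the derivatives of the Lagrange basis at the nodes. -/
theorem diffMatrix_eq {N : ℕ} (hN : 1 ≤ N) (i k : Fin (N + 1)) :
    diffMatrix N i k = (derivative (lglBasis N k)).eval (node N i) := by
  have hk := eval_legendre_node_ne_zero hN k
  have h := lglBasis_add_derivative hN k
  by_cases hik : i = k
  · subst hik
    have h2 := congrArg (fun p => (derivative p).eval (node N i)) h
    simp only [derivative_add, derivative_mul, derivative_sub, derivative_X,
      derivative_C, eval_mul, eval_add, eval_sub, eval_C, eval_X, sub_zero, sub_self,
      zero_mul, zero_add, add_zero, one_mul] at h2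
    have hL : (derivative (lglBasis N i)).eval (node N i) =
        (derivative (legendre N)).eval (node N i) / (2 * (legendre N).eval (node N i)) := by
      rw [eq_div_iff (by simpa using hk)]
      linarith
    rw [hL, diffMatrix, if_neg (by simp)]
    split_ifs with h0 hl
    · have h3 := two_mul_eval_derivative_lglPoly N (t := -1) (by norm_num)
      rw [h0, node_zero hN] at hk ⊢
      field_simp
      linarith
    · have h3 := two_mul_eval_derivative_lglPoly N (t := 1) (by norm_num)
      rw [hl, node_last hN] at hk ⊢
      field_simp
      linarith
    · rw [eval_derivative_legendre_node hN h0 hl, zero_div]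
  · have h2 := congrArg (eval (node N i)) h
    simp only [eval_mul, eval_add, eval_sub, eval_C, eval_X, eval_lglBasis_of_ne (Ne.symm hik),
      zero_add] at h2
    have h3 : node N i - node N k ≠ 0 := sub_ne_zero.2 fun h => hik (node_injective hN h)
    rw [diffMatrix, if_pos hik, legendreAt, legendreAt, ← h2]
    field_simp

theorem eq_sum_lglBasis {N : ℕ} (hN : 1 ≤ N) {p : ℝ[X]} (hp : p.natDegree ≤ N) :
    p = ∑ k, C (p.eval (node N k)) * lglBasis N k := by
  have hdeg : p.degree < (Finset.univ : Finset (Fin (N + 1))).card := by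
    rw [Finset.card_univ, Fintype.card_fin]
    exact (degree_le_of_natDegree_le hp).trans_lt (by exact_mod_cast Nat.lt_succ_self N)
  have := Lagrange.eq_interpolate (s := Finset.univ) (v := node N) (node_injective hN).injOn hdeg
  rwa [Lagrange.interpolate_apply] at this

/-- The differentiation matrix is exact on polynomials of degree at most `N`. -/
theorem diffMatrix_mulVec {N : ℕ} (hN : 1 ≤ N) {p : ℝ[X]} (hp : p.natDegree ≤ N) :
    (diffMatrix N *ᵥ fun k => p.eval (node N k)) = fun k => (derivative p).eval (node N k) := by
  funext i
  conv_rhs => rw [eq_sum_lglBasis hN hp]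
  rw [derivative_sum, eval_finsetSum]
  simp only [Matrix.mulVec, dotProduct, derivative_C_mul, eval_mul, eval_C, diffMatrix_eq hN]
  exact Finset.sum_congr rfl fun k _ => mul_comm _ _

theorem diffMatrix_pow_mulVec {N : ℕ} (hN : 1 ≤ N) {p : ℝ[X]} (hp : p.natDegree ≤ N) (j : ℕ) :
    ((diffMatrix N ^ j) *ᵥ fun k => p.eval (node N k)) =
      fun k => (derivative^[j] p).eval (node N k) := by
  induction j with
  | zero => simp
  | succ j ih =>
    rw [pow_succ', ← Matrix.mulVec_mulVec, ih, Function.iterate_succ_apply']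
    exact diffMatrix_mulVec hN ((natDegree_iterate_derivative _ _).trans (by omega))

/-! ### The Legendre-Gauss-Lobatto quadrature rule -/

/-- The node polynomial is orthogonal to the polynomials of degree at most `N - 2`: integrate by parts
and use the orthogonality of `L_N`. -/
theorem polyInt_lglPoly_mul {N : ℕ} {s : ℝ[X]} (hs : s.natDegree + 1 < N) :
    polyInt (lglPoly N * s) = 0 := by
  obtain ⟨S, hS, -, hd⟩ := exists_derivative_eq s 0
  rw [← hS, polyInt_lglPoly_mul_derivative, polyInt_legendre_mul_of_natDegree_lt (by omega),
    mul_zero]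

/-- The interpolatory quadrature rule at the nodes is exact up to degree `2 N - 1`. -/
theorem sum_eval_mul_polyInt_lglBasis {N : ℕ} (hN : 2 ≤ N) {p : ℝ[X]}
    (hp : p.natDegree ≤ 2 * N - 1) :
    ∑ k, p.eval (node N k) * polyInt (lglBasis N k) = polyInt p := by
  have hN1 : 1 ≤ N := by omega
  set Q := Lagrange.nodal Finset.univ (node N) with hQ
  have hmon : Q.Monic := Lagrange.nodal_monic
  have hdeg : Q.natDegree = N + 1 := by simp [hQ, Lagrange.natDegree_nodal]
  have hsplit := modByMonic_add_div p Q
  have hr : (p %ₘ Q).natDegree ≤ N := by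
    have := natDegree_modByMonic_lt p hmon (fun h => by simp [h] at hdeg)
    omega
  have hs : (p /ₘ Q).natDegree + 1 < N := by
    rw [natDegree_divByMonic p hmon, hdeg]
    omega
  have hc : (-N * (legendre N).coeff N : ℝ) ≠ 0 := by
    have : (N : ℝ) ≠ 0 := by positivity
    exact mul_ne_zero (neg_ne_zero.2 this) (coeff_legendre_ne_zero N)
  have h0 : polyInt (Q * (p /ₘ Q)) = 0 := by
    have := polyInt_lglPoly_mul hs
    rw [lglPoly_eq_nodal hN1, mul_assoc, polyInt_C_mul] at this
    exact (mul_eq_zero.1 this).resolve_left hc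
  have h1 : ∀ k, p.eval (node N k) = (p %ₘ Q).eval (node N k) := by
    intro k
    conv_lhs => rw [← hsplit]
    rw [eval_add, eval_mul, hQ, Lagrange.eval_nodal_at_node (Finset.mem_univ k), zero_mul, add_zero]
  have h2 : polyInt p = polyInt (p %ₘ Q) := by
    conv_lhs => rw [← hsplit]
    rw [map_add, h0, add_zero]
  rw [h2]
  conv_rhs => rw [eq_sum_lglBasis hN1 hr]
  rw [map_sum]
  exact Finset.sum_congr rfl fun k _ => by rw [h1, polyInt_C_mul]

/-- The discrete norm of `L_N`, computed from `L_N² + (1 - t²) L_N'² / N²`, which agrees with `L_N²`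
at the nodes and has degree at most `2 N - 1` because the leading terms cancel. -/
theorem sum_legendre_sq_mul_polyInt_lglBasis {N : ℕ} (hN : 2 ≤ N) :
    ∑ k, (legendre N).eval (node N k) ^ 2 * polyInt (lglBasis N k) = 2 / N := by
  have hN1 : 1 ≤ N := by omega
  have hN0 : (N : ℝ) ≠ 0 := by positivity
  set G : ℝ[X] := legendre N * legendre N +
    C (1 / (N : ℝ) ^ 2) * (lglPoly N * derivative (legendre N)) with hG
  have hd' : (derivative (legendre N)).natDegree ≤ N - 1 := by
    have := natDegree_derivative_le (legendre N)
    rwa [natDegree_legendre] at this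
  have hdeg : G.natDegree ≤ 2 * N - 1 := by
    have h1 : G.natDegree ≤ 2 * N := by
      refine (natDegree_add_le _ _).trans (max_le ?_ ?_)
      · have := natDegree_mul_le_of_le (natDegree_legendre_le N) (natDegree_legendre_le N)
        omega
      · refine (natDegree_C_mul_le _ _).trans ?_
        have := natDegree_mul_le_of_le (natDegree_lglPoly_le N) hd'
        omega
    have h2 : G.coeff (2 * N) = 0 := by
      rw [hG, coeff_add, coeff_C_mul]
      have e1 : (legendre N * legendre N).coeff (2 * N) =
          (legendre N).coeff N * (legendre N).coeff N := by
        rw [two_mul]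
        exact coeff_mul_add_eq_of_natDegree_le (natDegree_legendre_le N) (natDegree_legendre_le N)
      have e2 : (lglPoly N * derivative (legendre N)).coeff (2 * N) =
          (lglPoly N).coeff (N + 1) * (derivative (legendre N)).coeff (N - 1) := by
        rw [show 2 * N = N + 1 + (N - 1) by omega]
        exact coeff_mul_add_eq_of_natDegree_le (natDegree_lglPoly_le N) hd'
      rw [e1, e2, coeff_lglPoly, coeff_derivative, Nat.sub_add_cancel hN1]
      have : ((N - 1 : ℕ) : ℝ) + 1 = N := by
        rw [Nat.cast_sub hN1]; simp
      rw [this]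
      field_simp
      ring
    refine natDegree_le_iff_coeff_eq_zero.2 fun m hm => ?_
    rcases (show 2 * N ≤ m by omega).eq_or_lt with h | h
    · rw [← h, h2]
    · exact coeff_eq_zero_of_natDegree_lt (h1.trans_lt h)
  have h := sum_eval_mul_polyInt_lglBasis hN hdeg
  have hL : ∑ k, G.eval (node N k) * polyInt (lglBasis N k) =
      ∑ k, (legendre N).eval (node N k) ^ 2 * polyInt (lglBasis N k) := by
    refine Finset.sum_congr rfl fun k _ => ?_
    simp [hG, eval_lglPoly_node hN1, sq]
  rw [← hL, h, hG, map_add, polyInt_C_mul, polyInt_lglPoly_mul_derivative, polyInt_legendre_sq]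
  field_simp
  ring

theorem coeff_lglBasis {N : ℕ} (hN : 1 ≤ N) (k : Fin (N + 1)) :
    ((N : ℝ) + 1) * (legendre N).eval (node N k) * (lglBasis N k).coeff N =
      (legendre N).coeff N := by
  have h := congrArg (fun p => p.coeff (N + 1)) (C_mul_lglBasis hN k)
  have h0 : (lglBasis N k).coeff (N + 1) = 0 :=
    coeff_eq_zero_of_natDegree_lt (by rw [natDegree_lglBasis hN]; omega)
  simp only [coeff_C_mul, sub_mul, coeff_sub, coeff_X_mul, h0, coeff_lglPoly, mul_zero,
    sub_zero] at h
  have hN0 : (-N : ℝ) ≠ 0 := by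
    rw [neg_ne_zero]; positivity
  refine mul_left_cancel₀ hN0 ?_
  rw [← h]
  ring

/-- The closed form of the LGL weights: test exactness on `(ℓ_k - c L_N) L_N`, where `c` is chosen
such that the leading terms of `ℓ_k` and `c L_N` agree. -/
theorem polyInt_lglBasis {N : ℕ} (hN : 2 ≤ N) (k : Fin (N + 1)) :
    polyInt (lglBasis N k) = weight N k := by
  have hN1 : 1 ≤ N := by omega
  have hk := eval_legendre_node_ne_zero hN1 k
  have hN0 : (N : ℝ) ≠ 0 := by positivity
  have hN2 : (N : ℝ) + 1 ≠ 0 := by positivity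
  set c : ℝ := 1 / ((N + 1) * (legendre N).eval (node N k)) with hc
  set p : ℝ[X] := lglBasis N k - C c * legendre N with hp
  have hpd : p.natDegree ≤ N - 1 := by
    have h1 : p.natDegree ≤ N := (natDegree_sub_le _ _).trans
      (max_le (natDegree_lglBasis hN1 k).le
        ((natDegree_C_mul_le _ _).trans (natDegree_legendre_le N)))
    have h2 : p.coeff N = 0 := by
      rw [hp, coeff_sub, coeff_C_mul, ← coeff_lglBasis hN1 k, hc]
      field_simp
      ring
    refine natDegree_le_iff_coeff_eq_zero.2 fun m hm => ?_
    rcases (show N ≤ m by omega).eq_or_lt with h | h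
    · rw [← h, h2]
    · exact coeff_eq_zero_of_natDegree_lt (h1.trans_lt h)
  have h := sum_eval_mul_polyInt_lglBasis hN (p := legendre N * p) (by
    have := natDegree_mul_le_of_le (natDegree_legendre_le N) hpd
    omega)
  rw [polyInt_legendre_mul_of_natDegree_lt (by omega)] at h
  have h3 : ∑ i, (legendre N * p).eval (node N i) * polyInt (lglBasis N i) =
      (legendre N).eval (node N k) * polyInt (lglBasis N k) - c *
        ∑ i, (legendre N).eval (node N i) ^ 2 * polyInt (lglBasis N i) := by
    have e1 : ∑ i, (legendre N).eval (node N i) * (lglBasis N k).eval (node N i) *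
        polyInt (lglBasis N i) = (legendre N).eval (node N k) * polyInt (lglBasis N k) := by
      rw [Finset.sum_eq_single k]
      · rw [eval_lglBasis_self hN1, mul_one]
      · intro i _ hik
        rw [eval_lglBasis_of_ne hik.symm, mul_zero, zero_mul]
      · simp
    rw [← e1, Finset.mul_sum, ← Finset.sum_sub_distrib]
    refine Finset.sum_congr rfl fun i _ => ?_
    simp only [hp, eval_mul, eval_sub, eval_C]
    ring
  rw [h3, sum_legendre_sq_mul_polyInt_lglBasis hN, hc] at h
  rw [weight, legendreAt]
  field_simp at h ⊢
  linarith

theorem sum_eval_mul_weight {N : ℕ} (hN : 2 ≤ N) {p : ℝ[X]} (hp : p.natDegree ≤ 2 * N - 1) :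
    ∑ k, p.eval (node N k) * weight N k = polyInt p := by
  rw [← sum_eval_mul_polyInt_lglBasis hN hp]
  exact Finset.sum_congr rfl fun k _ => by rw [polyInt_lglBasis hN]

theorem weight_nonneg (N : ℕ) (k : Fin (N + 1)) : 0 ≤ weight N k := by
  rw [weight]; positivity

theorem sum_weight {N : ℕ} (hN : 2 ≤ N) : ∑ k, weight N k = 2 := by
  have h := sum_eval_mul_weight hN (p := 1) (by simp)
  rw [polyInt_apply] at h
  norm_num at h
  exact h

theorem abs_sum_mul_weight_le {N : ℕ} (hN : 2 ≤ N) {a : Fin (N + 1) → ℝ} {ε : ℝ}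
    (ha : ∀ k, |a k| ≤ ε) : |∑ k, a k * weight N k| ≤ 2 * ε := by
  refine (Finset.abs_sum_le_sum_abs _ _).trans ?_
  rw [← sum_weight hN, Finset.sum_mul]
  refine Finset.sum_le_sum fun k _ => ?_
  rw [abs_mul, abs_of_nonneg (weight_nonneg N k), mul_comm]
  exact mul_le_mul_of_nonneg_left (ha k) (weight_nonneg N k)

theorem abs_integral_le_two_mul {f : ℝ → ℝ} {ε : ℝ} (hf : ∀ t ∈ Icc (-1 : ℝ) 1, |f t| ≤ ε) :
    |∫ t in (-1 : ℝ)..1, f t| ≤ 2 * ε := by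
  have := intervalIntegral.norm_integral_le_of_norm_le_const (a := -1) (b := 1) (f := f) (C := ε)
    (fun x hx => hf x (by
      rw [uIoc_of_le (by norm_num)] at hx
      exact ⟨hx.1.le, hx.2⟩))
  rw [Real.norm_eq_abs] at this
  refine this.trans (le_of_eq ?_)
  norm_num
  ring

theorem intervalIntegrable_of_continuousOn_Icc {f : ℝ → ℝ} (hf : ContinuousOn f (Icc (-1) 1)) :
    IntervalIntegrable f volume (-1) 1 :=
  ContinuousOn.intervalIntegrable (by rwa [uIcc_of_le (by norm_num)])

/-- Convergence of the quadrature rule for continuous functions, with perturbed function values. -/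
theorem tendsto_sum_mul_weight {φ : ℕ → ℕ} (hφ : Tendsto φ atTop atTop) {f : ℝ → ℝ}
    (hf : ContinuousOn f (Icc (-1) 1)) (G : (j : ℕ) → Fin (φ j + 1) → ℝ)
    (hG : ∀ ε > 0, ∀ᶠ j in atTop, ∀ k, |G j k - f (node (φ j) k)| ≤ ε) :
    Tendsto (fun j => ∑ k, G j k * weight (φ j) k) atTop (𝓝 (∫ t in (-1 : ℝ)..1, f t)) := by
  rw [Metric.tendsto_atTop']
  intro ε hε
  obtain ⟨q, hq⟩ := exists_polynomial_near_of_continuousOn (-1) 1 f hf (ε / 10) (by positivity)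
  have hev := (hG (ε / 10) (by positivity)).and
    (hφ.eventually (eventually_ge_atTop (q.natDegree + 2)))
  obtain ⟨J, hJ⟩ := eventually_atTop.1 hev
  refine ⟨J, fun j hj => ?_⟩
  obtain ⟨h1, h2⟩ := hJ j hj.le
  have hN2 : 2 ≤ φ j := by omega
  have e1 : |∑ k, (G j k - q.eval (node (φ j) k)) * weight (φ j) k| ≤ 2 * (ε / 5) := by
    refine abs_sum_mul_weight_le hN2 fun k => ?_
    have h3 := hq _ (node_mem_Icc (by omega) k)
    rw [abs_sub_comm] at h3
    calc |G j k - q.eval (node (φ j) k)|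
        = |(G j k - f (node (φ j) k)) + (f (node (φ j) k) - q.eval (node (φ j) k))| := by ring_nf
      _ ≤ _ := abs_add_le _ _
      _ ≤ ε / 10 + ε / 10 := add_le_add (h1 k) h3.le
      _ = ε / 5 := by ring
  have e2 : |∫ t in (-1 : ℝ)..1, (q.eval t - f t)| ≤ 2 * (ε / 10) :=
    abs_integral_le_two_mul fun t ht => (hq t ht).le
  rw [intervalIntegral.integral_sub (q.continuous.intervalIntegrable _ _)
    (intervalIntegrable_of_continuousOn_Icc hf), ← polyInt_apply] at e2
  simp only [sub_mul, Finset.sum_sub_distrib] at e1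
  rw [sum_eval_mul_weight hN2 (by omega)] at e1
  rw [Real.dist_eq]
  calc |∑ k, G j k * weight (φ j) k - ∫ t in (-1 : ℝ)..1, f t|
      = |(∑ k, G j k * weight (φ j) k - polyInt q) + (polyInt q - ∫ t in (-1 : ℝ)..1, f t)| := by
        ring_nf
    _ ≤ _ := abs_add_le _ _
    _ ≤ 2 * (ε / 5) + 2 * (ε / 10) := add_le_add e1 e2
    _ < ε := by linarith

/-- The nodes become dense in `[-1, 1]`, because the quadrature rule integrates a bump function
asymptotically correctly. -/
theorem eventually_exists_node_near {φ : ℕ → ℕ} (hφ : Tendsto φ atTop atTop) {t : ℝ}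
    (ht : t ∈ Icc (-1 : ℝ) 1) {ε : ℝ} (hε : 0 < ε) :
    ∀ᶠ j in atTop, ∃ k, |node (φ j) k - t| < ε := by
  set f : ℝ → ℝ := fun s => max 0 (ε - |s - t|) with hf
  have hc : Continuous f := by fun_prop
  have hpos : 0 < ∫ s in (-1 : ℝ)..1, f s := by
    refine intervalIntegral.integral_pos (by norm_num) hc.continuousOn
      (fun s _ => le_max_left _ _) ⟨t, ht, ?_⟩
    simp [hf, hε]
  have h := tendsto_sum_mul_weight hφ hc.continuousOn (fun j k => f (node (φ j) k))
    (fun δ hδ => Eventually.of_forall fun j k => by simpa using hδ.le)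
  filter_upwards [h.eventually (lt_mem_nhds hpos)] with j hj
  obtain ⟨k, -, hk⟩ := Finset.exists_ne_zero_of_sum_ne_zero hj.ne'
  refine ⟨k, ?_⟩
  by_contra hcon
  refine hk ?_
  rw [hf]
  simp only
  rw [max_eq_left (by linarith [not_lt.1 hcon]), zero_mul]

/-! ### Weak derivatives and primitives -/

/-- `v` is a primitive of `w` on `[-1, 1]`: `w` is integrable and `v t = v (-1) + ∫_{-1}^t w`. -/
structure IsPrimitive (v w : ℝ → ℝ) : Prop where
  integrable : IntegrableOn w (Icc (-1) 1)
  eq : ∀ t ∈ Icc (-1 : ℝ) 1, v t = v (-1) + ∫ s in (-1 : ℝ)..t, w s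

theorem intervalIntegrable_neg_one_one_iff {w : ℝ → ℝ} :
    IntervalIntegrable w volume (-1) 1 ↔ IntegrableOn w (Icc (-1) 1) :=
  intervalIntegrable_iff_integrableOn_Icc_of_le (by norm_num)

theorem intervalIntegrable_sub_Icc {w : ℝ → ℝ} (hw : IntegrableOn w (Icc (-1) 1)) {s t : ℝ}
    (hs : s ∈ Icc (-1 : ℝ) 1) (ht : t ∈ Icc (-1 : ℝ) 1) : IntervalIntegrable w volume s t := by
  refine (intervalIntegrable_neg_one_one_iff.2 hw).mono_set ?_
  rw [uIcc_of_le (show (-1 : ℝ) ≤ 1 by norm_num)]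
  exact uIcc_subset_Icc hs ht

/-- Integration by parts for a primitive and a smooth function. -/
theorem IsPrimitive.integral_mul_deriv {v w : ℝ → ℝ} (h : IsPrimitive v w) {p : ℝ → ℝ}
    (hp : ContDiff ℝ 1 p) :
    ∫ t in (-1 : ℝ)..1, v t * deriv p t =
      v 1 * p 1 - v (-1) * p (-1) - ∫ t in (-1 : ℝ)..1, w t * p t := by
  have hle : (-1 : ℝ) ≤ 1 := by norm_num
  have hw := intervalIntegrable_neg_one_one_iff.2 h.integrable
  set W : ℝ → ℝ := fun t => ∫ s in (-1 : ℝ)..t, w s with hW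
  have hWac : AbsolutelyContinuousOnInterval W (-1) 1 :=
    hw.absolutelyContinuousOnInterval_intervalIntegral (by simp)
  have hpac : AbsolutelyContinuousOnInterval p (-1) 1 :=
    hp.contDiffOn.absolutelyContinuousOnInterval
  have h1 := hWac.integral_mul_deriv_eq_deriv_mul hpac
  have h2 : ∫ t in (-1 : ℝ)..1, deriv W t * p t = ∫ t in (-1 : ℝ)..1, w t * p t := by
    refine intervalIntegral.integral_congr_ae ?_
    filter_upwards [hw.ae_hasDerivAt_integral] with t ht hmem
    rw [(ht (uIoc_subset_uIcc hmem) (-1) (by simp)).deriv]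
  have h3 : ∫ t in (-1 : ℝ)..1, v t * deriv p t =
      ∫ t in (-1 : ℝ)..1, (v (-1) * deriv p t + W t * deriv p t) := by
    refine intervalIntegral.integral_congr fun t ht => ?_
    rw [uIcc_of_le hle] at ht
    rw [h.eq t ht, add_mul]
  have hdp : Continuous (deriv p) := hp.continuous_deriv le_rfl
  have hWc : ContinuousOn W (uIcc (-1) 1) := hWac.continuousOn
  rw [h3, intervalIntegral.integral_add ((hdp.intervalIntegrable _ _).const_mul _)
    ((hWc.fun_mul hdp.continuousOn).intervalIntegrable), intervalIntegral.integral_const_mul, h1, h2,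
    intervalIntegral.integral_deriv_eq_sub (fun x _ => hp.differentiable one_ne_zero x)
      (hdp.intervalIntegrable _ _), h.eq 1 (by norm_num), hW]
  simp only [intervalIntegral.integral_same]
  ring

theorem IsPrimitive.continuousOn {v w : ℝ → ℝ} (h : IsPrimitive v w) :
    ContinuousOn v (Icc (-1) 1) := by
  have hw := intervalIntegrable_neg_one_one_iff.2 h.integrable
  have h1 : ContinuousOn (fun t => ∫ s in (-1 : ℝ)..t, w s) (Icc (-1) 1) := by
    have := (hw.absolutelyContinuousOnInterval_intervalIntegral (c := -1) (by simp)).continuousOn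
    rwa [uIcc_of_le (by norm_num)] at this
  exact (continuousOn_const.add h1).congr h.eq

theorem eq_zero_of_tsupport_subset_Ioo {φ : ℝ → ℝ} (h : tsupport φ ⊆ Ioo (-1) 1) {t : ℝ}
    (ht : t ∉ Ioo (-1 : ℝ) 1) : φ t = 0 :=
  image_eq_zero_of_notMem_tsupport fun h' => ht (h h')

theorem IsPrimitive.isWeakDeriv {v w : ℝ → ℝ} (h : IsPrimitive v w) : IsWeakDeriv 1 v w where
  integrable_left := h.continuousOn.integrableOn_Icc
  integrable_right := h.integrable
  integral_eq φ hφ _ hs := by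
    rw [iteratedDeriv_one, h.integral_mul_deriv (hφ.of_le (by exact_mod_cast le_top)),
      eq_zero_of_tsupport_subset_Ioo hs (by simp), eq_zero_of_tsupport_subset_Ioo hs (by simp)]
    ring

/-- The fundamental lemma of the calculus of variations on `[-1, 1]`. -/
theorem ae_eq_zero_of_integral_mul_eq_zero {z : ℝ → ℝ} (hz : IntegrableOn z (Icc (-1) 1))
    (h : ∀ φ : ℝ → ℝ, ContDiff ℝ ∞ φ → HasCompactSupport φ → tsupport φ ⊆ Ioo (-1) 1 →
      ∫ t in (-1 : ℝ)..1, z t * φ t = 0) :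
    z =ᵐ[volume.restrict (Icc (-1) 1)] 0 := by
  have h1 := isOpen_Ioo.ae_eq_zero_of_integral_contDiff_smul_eq_zero (U := Ioo (-1 : ℝ) 1)
    (μ := volume) (f := z) (hz.mono_set Ioo_subset_Icc_self).locallyIntegrableOn
    (fun φ h1 h2 h3 => by
      rw [← h φ h1 h2 h3, intervalIntegral.integral_of_le (by norm_num),
        ← integral_Icc_eq_integral_Ioc, ← setIntegral_eq_integral_of_forall_compl_eq_zero
          (s := Icc (-1 : ℝ) 1)]
      · simp only [smul_eq_mul, mul_comm]
      · intro t ht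
        rw [eq_zero_of_tsupport_subset_Ioo h3 (fun h' => ht (Ioo_subset_Icc_self h')), zero_smul])
  rw [← restrict_Ioo_eq_restrict_Icc, EventuallyEq, ae_restrict_iff' measurableSet_Ioo]
  exact h1

theorem IsWeakDeriv.ae_unique {j : ℕ} {ξ v v' : ℝ → ℝ} (h : IsWeakDeriv j ξ v)
    (h' : IsWeakDeriv j ξ v') : v =ᵐ[volume.restrict (Icc (-1) 1)] v' := by
  have h1 : (fun t => v t - v' t) =ᵐ[volume.restrict (Icc (-1) 1)] 0 := by
    refine ae_eq_zero_of_integral_mul_eq_zero (h.integrable_right.sub h'.integrable_right)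
      fun φ hφ hc hs => ?_
    have e := (h.integral_eq φ hφ hc hs).symm.trans (h'.integral_eq φ hφ hc hs)
    have e2 := mul_left_cancel₀ (pow_ne_zero j (by norm_num : (-1 : ℝ) ≠ 0)) e
    have hi : ∀ {v : ℝ → ℝ}, IntegrableOn v (Icc (-1) 1) →
        IntervalIntegrable (fun t => v t * φ t) volume (-1) 1 := fun hv =>
      (intervalIntegrable_neg_one_one_iff.2 hv).mul_continuousOn hφ.continuous.continuousOn
    simp only [sub_mul]
    rw [intervalIntegral.integral_sub (hi h.integrable_right) (hi h'.integrable_right), e2, sub_self]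
  filter_upwards [h1] with t ht
  exact sub_eq_zero.1 ht

theorem IsWeakDeriv.of_succ {j : ℕ} {ξ v w : ℝ → ℝ} (h : IsWeakDeriv j ξ v)
    (h' : IsWeakDeriv (j + 1) ξ w) : IsWeakDeriv 1 v w where
  integrable_left := h.integrable_right
  integrable_right := h'.integrable_right
  integral_eq φ hφ hc hs := by
    have hφ' : ContDiff ℝ ∞ (deriv φ) := (contDiff_infty_iff_deriv.1 hφ).2
    have e1 := h.integral_eq (deriv φ) hφ' hc.deriv (tsupport_deriv_subset.trans hs)
    have e2 := h'.integral_eq φ hφ hc hs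
    rw [iteratedDeriv_succ', e1, pow_succ, mul_assoc] at e2
    rw [iteratedDeriv_one, mul_left_cancel₀ (pow_ne_zero j (by norm_num : (-1 : ℝ) ≠ 0)) e2,
      pow_one]

/-- A test function of mean zero is the derivative of a test function. -/
theorem exists_deriv_eq_of_integral_eq_zero {ρ : ℝ → ℝ} (hρ : ContDiff ℝ ∞ ρ)
    (hs : tsupport ρ ⊆ Ioo (-1) 1) (h0 : ∫ t in (-1 : ℝ)..1, ρ t = 0) :
    ∃ φ : ℝ → ℝ, ContDiff ℝ ∞ φ ∧ HasCompactSupport φ ∧ tsupport φ ⊆ Ioo (-1) 1 ∧ deriv φ = ρ := by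
  have hcomp : IsCompact (tsupport ρ) :=
    isCompact_Icc.of_isClosed_subset (isClosed_tsupport ρ) (hs.trans Ioo_subset_Icc_self)
  obtain ⟨a, b, ha, hb, hab, hsub⟩ : ∃ a b : ℝ, -1 < a ∧ b < 1 ∧ a ≤ b ∧ tsupport ρ ⊆ Icc a b := by
    rcases (tsupport ρ).eq_empty_or_nonempty with he | hne
    · exact ⟨0, 0, by norm_num, by norm_num, le_rfl, by simp [he]⟩
    · obtain ⟨a, ha, ha'⟩ := hcomp.exists_isLeast hne
      obtain ⟨b, hb, hb'⟩ := hcomp.exists_isGreatest hne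
      exact ⟨a, b, (hs ha).1, (hs hb).2, ha' hb, fun t ht => ⟨ha' ht, hb' ht⟩⟩
  have hzero : ∀ t, t ∉ Icc a b → ρ t = 0 := fun t ht =>
    image_eq_zero_of_notMem_tsupport fun h => ht (hsub h)
  set φ : ℝ → ℝ := fun t => ∫ s in (-1 : ℝ)..t, ρ s with hφ
  have hder : ∀ t, HasDerivAt φ (ρ t) t := fun t =>
    intervalIntegral.integral_hasDerivAt_right (hρ.continuous.intervalIntegrable _ _)
      hρ.continuous.stronglyMeasurable.stronglyMeasurableAtFilter hρ.continuous.continuousAt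
  have hderiv : deriv φ = ρ := funext fun t => (hder t).deriv
  have hsup : tsupport φ ⊆ Icc a b := by
    refine closure_minimal (fun t ht => ?_) isClosed_Icc
    by_contra hn
    refine ht ?_
    rcases not_and_or.1 hn with h | h
    · have hint : ∫ s in (-1 : ℝ)..t, ρ s = ∫ s in (-1 : ℝ)..t, (0 : ℝ) := by
        refine intervalIntegral.integral_congr fun s hs' => hzero s fun h' => ?_
        have : s ≤ max (-1) t := hs'.2
        have h2 : max (-1) t < a := max_lt ha (not_le.1 h)
        linarith [h'.1]
      simp only [hφ]
      rw [hint, intervalIntegral.integral_zero]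
    · have hint : ∫ s in t..1, ρ s = ∫ s in t..1, (0 : ℝ) := by
        refine intervalIntegral.integral_congr fun s hs' => hzero s fun h' => ?_
        have : min t 1 ≤ s := hs'.1
        have h2 : b < min t 1 := lt_min (not_le.1 h) hb
        linarith [h'.2]
      simp only [hφ]
      have := intervalIntegral.integral_add_adjacent_intervals
        (hρ.continuous.intervalIntegrable (μ := volume) (-1) t)
        (hρ.continuous.intervalIntegrable (μ := volume) t 1)
      rw [h0, hint, intervalIntegral.integral_zero, add_zero] at this
      exact this
  refine ⟨φ, ?_, ?_, hsup.trans fun t ht => ⟨ha.trans_le ht.1, ht.2.trans_lt hb⟩, hderiv⟩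
  · exact contDiff_infty_iff_deriv.2 ⟨fun t => (hder t).differentiableAt, by rwa [hderiv]⟩
  · exact isCompact_Icc.of_isClosed_subset (isClosed_tsupport φ) hsup

/-- The du Bois-Reymond lemma: a function with zero weak derivative is constant. -/
theorem ae_eq_const_of_integral_mul_deriv_eq_zero {z : ℝ → ℝ} (hz : IntegrableOn z (Icc (-1) 1))
    (h : ∀ φ : ℝ → ℝ, ContDiff ℝ ∞ φ → HasCompactSupport φ → tsupport φ ⊆ Ioo (-1) 1 →
      ∫ t in (-1 : ℝ)..1, z t * deriv φ t = 0) :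
    ∃ c : ℝ, z =ᵐ[volume.restrict (Icc (-1) 1)] fun _ => c := by
  let B : ContDiffBump (0 : ℝ) := ⟨1 / 4, 1 / 2, by norm_num, by norm_num⟩
  have hB : ContDiff ℝ ∞ B := B.contDiff
  have hBs : tsupport B ⊆ Ioo (-1) 1 := by
    rw [B.tsupport_eq]
    intro t ht
    rw [Metric.mem_closedBall, Real.dist_eq, sub_zero] at ht
    have := abs_le.1 ht
    have hr : B.rOut = 1 / 2 := rfl
    rw [hr] at this
    constructor <;> linarith
  have hBpos : 0 < ∫ t in (-1 : ℝ)..1, B t := by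
    refine intervalIntegral.integral_pos (by norm_num) hB.continuous.continuousOn
      (fun s _ => B.nonneg) ⟨0, by norm_num, ?_⟩
    rw [B.one_of_mem_closedBall (by simp [B.rIn_pos.le])]
    norm_num
  set I := ∫ t in (-1 : ℝ)..1, B t
  set c := (∫ t in (-1 : ℝ)..1, z t * B t) / I with hc
  have hi : ∀ {φ : ℝ → ℝ}, Continuous φ →
      IntervalIntegrable (fun t => z t * φ t) volume (-1) 1 := fun hφ =>
    (intervalIntegrable_neg_one_one_iff.2 hz).mul_continuousOn hφ.continuousOn
  refine ⟨c, ?_⟩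
  have h1 : (fun t => z t - c) =ᵐ[volume.restrict (Icc (-1) 1)] 0 := by
    refine ae_eq_zero_of_integral_mul_eq_zero
      (hz.sub (continuousOn_const.integrableOn_Icc)) fun ψ hψ hψc hψs => ?_
    -- subtract a multiple of the fixed bump to make the mean vanish
    set a := (∫ t in (-1 : ℝ)..1, ψ t) / I with ha
    have hIi : ∫ t in (-1 : ℝ)..1, (ψ t - a * B t) = 0 := by
      rw [intervalIntegral.integral_sub (hψ.continuous.intervalIntegrable _ _)
        ((hB.continuous.intervalIntegrable _ _).const_mul _), intervalIntegral.integral_const_mul,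
        ha, div_mul_cancel₀ _ hBpos.ne', sub_self]
    have hsub : tsupport (fun t => ψ t - a * B t) ⊆ Ioo (-1) 1 := by
      refine (closure_minimal (fun t ht => ?_)
        ((isClosed_tsupport ψ).union (isClosed_tsupport B))).trans (union_subset hψs hBs)
      by_contra hn
      rw [mem_union, not_or] at hn
      refine ht ?_
      simp only
      rw [image_eq_zero_of_notMem_tsupport hn.1, image_eq_zero_of_notMem_tsupport hn.2]
      simp
    obtain ⟨φ, h1, h2, h3, h4⟩ := exists_deriv_eq_of_integral_eq_zero
      (hψ.sub (contDiff_const.mul hB)) hsub hIi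
    have h5 := h φ h1 h2 h3
    rw [h4] at h5
    have e1 : ∫ t in (-1 : ℝ)..1, z t * (ψ t - a * B t) =
        (∫ t in (-1 : ℝ)..1, z t * ψ t) - a * ∫ t in (-1 : ℝ)..1, z t * B t := by
      rw [← intervalIntegral.integral_const_mul, ← intervalIntegral.integral_sub
        (hi hψ.continuous) ((hi hB.continuous).const_mul a)]
      refine intervalIntegral.integral_congr fun t _ => ?_
      ring
    rw [e1] at h5
    simp only [sub_mul]
    rw [intervalIntegral.integral_sub (hi hψ.continuous)
      ((hψ.continuous.intervalIntegrable _ _).const_mul _), intervalIntegral.integral_const_mul]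
    rw [ha] at h5
    rw [hc]
    have hI := hBpos.ne'
    field_simp at h5 ⊢
    linarith
  filter_upwards [h1] with t ht
  exact sub_eq_zero.1 ht

theorem eqOn_Icc_of_ae_eq {v w : ℝ → ℝ} (hv : ContinuousOn v (Icc (-1) 1))
    (hw : ContinuousOn w (Icc (-1) 1)) (h : v =ᵐ[volume.restrict (Icc (-1) 1)] w) :
    EqOn v w (Icc (-1) 1) :=
  Measure.eqOn_Icc_of_ae_eq volume (by norm_num) h hv hw

/-- A continuous function is a primitive of its weak derivative. -/
theorem IsWeakDeriv.isPrimitive {v w : ℝ → ℝ} (h : IsWeakDeriv 1 v w)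
    (hv : ContinuousOn v (Icc (-1) 1)) : IsPrimitive v w := by
  refine ⟨h.integrable_right, ?_⟩
  set W : ℝ → ℝ := fun t => ∫ s in (-1 : ℝ)..t, w s with hW
  have hW1 : W (-1) = 0 := intervalIntegral.integral_same
  have hWp : IsPrimitive W w := ⟨h.integrable_right, fun t _ => by rw [hW1, zero_add]⟩
  have hWc := hWp.continuousOn
  have hz : ContinuousOn (fun t => v t - W t) (Icc (-1) 1) := hv.sub hWc
  obtain ⟨c, hc⟩ := ae_eq_const_of_integral_mul_deriv_eq_zero hz.integrableOn_Icc
    fun φ hφ hcs hs => by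
      have e1 := h.integral_eq φ hφ hcs hs
      have e2 := hWp.isWeakDeriv.integral_eq φ hφ hcs hs
      rw [iteratedDeriv_one] at e1 e2
      have hdc : Continuous (deriv φ) := hφ.continuous_deriv (by exact_mod_cast le_top)
      simp only [sub_mul]
      rw [intervalIntegral.integral_sub
        (intervalIntegrable_of_continuousOn_Icc (hv.fun_mul hdc.continuousOn))
        (intervalIntegrable_of_continuousOn_Icc (hWc.fun_mul hdc.continuousOn)), e1, e2, sub_self]
  have h2 := eqOn_Icc_of_ae_eq hz continuousOn_const hc
  intro t ht
  have e1 := h2 ht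
  have e2 := h2 (show (-1 : ℝ) ∈ Icc (-1 : ℝ) 1 by norm_num)
  simp only [hW1] at e1 e2
  change v t = v (-1) + W t
  linarith

theorem isWeakDeriv_zero {ξ : ℝ → ℝ} (h : IntegrableOn ξ (Icc (-1) 1)) : IsWeakDeriv 0 ξ ξ :=
  ⟨h, h, fun φ _ _ _ => by simp⟩

theorem IsBVDerivFamily.isPrimitive {m : ℕ} {ξ : ℝ → ℝ} {y : ℕ → ℝ → ℝ}
    (hy : IsBVDerivFamily m ξ y) {j : ℕ} (hj : j < m) : IsPrimitive (y j) (y (j + 1)) :=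
  ((hy.weakDeriv j hj.le).of_succ (hy.weakDeriv (j + 1) hj)).isPrimitive (hy.continuousOn j hj)

/-! ### Legendre coefficients of functions of bounded variation -/

theorem IsPrimitive.boundedVariationOn {v w : ℝ → ℝ} (h : IsPrimitive v w) :
    BoundedVariationOn v (Icc (-1) 1) := by
  have hw := intervalIntegrable_neg_one_one_iff.2 h.integrable
  have h1 : AbsolutelyContinuousOnInterval (fun t => v (-1) + ∫ s in (-1 : ℝ)..t, w s) (-1) 1 := by
    have hc : AbsolutelyContinuousOnInterval (fun _ : ℝ => v (-1)) (-1) 1 :=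
      contDiff_const.contDiffOn.absolutelyContinuousOnInterval
    exact hc.add (hw.absolutelyContinuousOnInterval_intervalIntegral (c := -1) (by simp))
  have h2 := h1.boundedVariationOn
  rw [uIcc_of_le (by norm_num)] at h2
  rw [BoundedVariationOn, eVariationOn.congr h.eq]
  exact h2

theorem totalVar_nonneg (w : ℝ → ℝ) : 0 ≤ totalVar w := ENNReal.toReal_nonneg

theorem abs_le_supAbs {w : ℝ → ℝ} (hw : BoundedVariationOn w (Icc (-1) 1)) {t : ℝ}
    (ht : t ∈ Icc (-1 : ℝ) 1) : |w t| ≤ supAbs w := by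
  refine le_csSup ⟨|w (-1)| + totalVar w, ?_⟩ ⟨t, ht, rfl⟩
  rintro _ ⟨s, hs, rfl⟩
  have h := hw.dist_le hs (show (-1 : ℝ) ∈ Icc (-1 : ℝ) 1 by norm_num)
  rw [Real.dist_eq] at h
  have h2 := abs_sub_abs_le_abs_sub (w s) (w (-1))
  change |w s| ≤ |w (-1)| + (eVariationOn w (Icc (-1) 1)).toReal
  linarith

theorem supAbs_nonneg {w : ℝ → ℝ} (hw : BoundedVariationOn w (Icc (-1) 1)) : 0 ≤ supAbs w :=
  (abs_nonneg _).trans (abs_le_supAbs hw (show (0 : ℝ) ∈ Icc (-1 : ℝ) 1 by norm_num))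

theorem sum_mul_sub_eq (w G : ℕ → ℝ) (n : ℕ) :
    ∑ i ∈ Finset.range n, w i * (G (i + 1) - G i) =
      w n * G n - w 0 * G 0 - ∑ i ∈ Finset.range n, G (i + 1) * (w (i + 1) - w i) := by
  induction n with
  | zero => simp
  | succ n ih => rw [Finset.sum_range_succ, Finset.sum_range_succ, ih]; ring

/-- `|∫ w G'| ≤ V(w) sup |G|` if `G` vanishes at the endpoints: summation by parts on uniform
partitions. -/
theorem abs_integral_mul_derivative_le {w : ℝ → ℝ} (hw : BoundedVariationOn w (Icc (-1) 1))
    (hi : IntegrableOn w (Icc (-1) 1)) {G : ℝ[X]} (h1 : G.eval 1 = 0) (h2 : G.eval (-1) = 0)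
    {B : ℝ} (hB : ∀ t ∈ Icc (-1 : ℝ) 1, |G.eval t| ≤ B) :
    |∫ t in (-1 : ℝ)..1, w t * (derivative G).eval t| ≤ totalVar w * B := by
  obtain ⟨M, hM⟩ := isCompact_Icc.exists_bound_of_continuousOn
    (s := Icc (-1 : ℝ) 1) (derivative G).continuous.continuousOn
  have hM0 : 0 ≤ M := (norm_nonneg _).trans (hM 0 (by norm_num))
  have key : ∀ n : ℕ, |∫ t in (-1 : ℝ)..1, w t * (derivative G).eval t| ≤
      totalVar w * B + totalVar w * (M * 2) * (1 / ((n : ℝ) + 1)) := by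
    intro n
    set N := n + 1 with hN
    have hN0 : (0 : ℝ) < N := by positivity
    set s : ℕ → ℝ := fun i => -1 + 2 * i / N with hs
    have hmono : Monotone s := by
      intro i j hij
      simp only [hs]
      gcongr
    have hs0 : s 0 = -1 := by simp [hs]
    have hsN : s N = 1 := by simp only [hs]; field_simp; norm_num
    have hsI : ∀ i ≤ N, s i ∈ Icc (-1 : ℝ) 1 := fun i hi => by
      rw [← hs0, ← hsN]; exact ⟨hmono (Nat.zero_le _), hmono hi⟩
    have hstep : ∀ i, s (i + 1) - s i = 2 / N := fun i => by
      simp only [hs]; push_cast; ring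
    set V : ℕ → ℝ := fun i => (eVariationOn w (Icc (s i) (s (i + 1)))).toReal with hV
    have hsubI : ∀ i < N, Icc (s i) (s (i + 1)) ⊆ Icc (-1 : ℝ) 1 := fun i hi =>
      Icc_subset_Icc (hsI i hi.le).1 (hsI (i + 1) hi).2
    have hVsum : ∑ i ∈ Finset.range N, V i = totalVar w := by
      have := eVariationOn.sum' w hmono (n := N)
      rw [hs0, hsN] at this
      rw [totalVar, ← this, ENNReal.toReal_sum]
      intro i hi
      exact hw.mono (hsubI i (Finset.mem_range.1 hi))
    have hVd : ∀ i < N, ∀ t ∈ Icc (s i) (s (i + 1)), |w t - w (s i)| ≤ V i := by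
      intro i hi t ht
      have := (hw.mono (hsubI i hi)).dist_le ht (left_mem_Icc.2 (hmono (Nat.le_succ i)))
      rwa [Real.dist_eq] at this
    have hint : ∀ i < N, IntervalIntegrable (fun t => w t * (derivative G).eval t) volume
        (s i) (s (i + 1)) := fun i hi' =>
      (intervalIntegrable_sub_Icc hi (hsI i hi'.le) (hsI (i + 1) hi')).mul_continuousOn
        (derivative G).continuous.continuousOn
    have hsplit : ∫ t in (-1 : ℝ)..1, w t * (derivative G).eval t =
        ∑ i ∈ Finset.range N, ∫ t in s i..s (i + 1), w t * (derivative G).eval t := by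
      rw [intervalIntegral.sum_integral_adjacent_intervals hint, hs0, hsN]
    have herr : ∀ i < N, |(∫ t in s i..s (i + 1), w t * (derivative G).eval t) -
        w (s i) * (G.eval (s (i + 1)) - G.eval (s i))| ≤ V i * M * (2 / N) := by
      intro i hi'
      have e : ∫ t in s i..s (i + 1), (derivative G).eval t = G.eval (s (i + 1)) - G.eval (s i) :=
        intervalIntegral.integral_eq_sub_of_hasDerivAt (fun x _ => G.hasDerivAt x)
          ((derivative G).continuous.intervalIntegrable _ _)
      rw [← e, ← intervalIntegral.integral_const_mul, ← intervalIntegral.integral_sub (hint i hi')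
        (((derivative G).continuous.intervalIntegrable _ _).const_mul _)]
      have hb := intervalIntegral.norm_integral_le_of_norm_le_const (a := s i) (b := s (i + 1))
        (f := fun t => w t * (derivative G).eval t - w (s i) * (derivative G).eval t)
        (C := V i * M) (fun t ht => by
          rw [uIoc_of_le (hmono (Nat.le_succ i))] at ht
          have ht' : t ∈ Icc (s i) (s (i + 1)) := ⟨ht.1.le, ht.2⟩
          rw [← sub_mul, norm_mul]
          exact mul_le_mul (hVd i hi' t ht') (hM t (hsubI i hi' ht')) (norm_nonneg _)
            ENNReal.toReal_nonneg)
      rwa [hstep i, abs_of_nonneg (by positivity)] at hb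
    have hmain : |∑ i ∈ Finset.range N, w (s i) * (G.eval (s (i + 1)) - G.eval (s i))| ≤
        totalVar w * B := by
      rw [sum_mul_sub_eq (fun i => w (s i)) (fun i => G.eval (s i)), hs0, hsN, h1, h2, mul_zero,
        mul_zero, sub_zero, zero_sub, abs_neg, ← hVsum, Finset.sum_mul]
      refine (Finset.abs_sum_le_sum_abs _ _).trans (Finset.sum_le_sum fun i hi' => ?_)
      have hiN := Finset.mem_range.1 hi'
      rw [abs_mul, mul_comm]
      exact mul_le_mul (hVd i hiN _ (right_mem_Icc.2 (hmono (Nat.le_succ i))))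
        (hB _ (hsI (i + 1) hiN)) (abs_nonneg _) ENNReal.toReal_nonneg
    have hdiff : |(∫ t in (-1 : ℝ)..1, w t * (derivative G).eval t) -
        ∑ i ∈ Finset.range N, w (s i) * (G.eval (s (i + 1)) - G.eval (s i))| ≤
        totalVar w * (M * 2) * (1 / ((n : ℝ) + 1)) := by
      rw [hsplit, ← Finset.sum_sub_distrib]
      refine (Finset.abs_sum_le_sum_abs _ _).trans
        ((Finset.sum_le_sum fun i hi' => herr i (Finset.mem_range.1 hi')).trans (le_of_eq ?_))
      rw [← Finset.sum_mul, ← Finset.sum_mul, hVsum, hN]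
      push_cast
      ring
    have := abs_sub_abs_le_abs_sub (∫ t in (-1 : ℝ)..1, w t * (derivative G).eval t)
      (∑ i ∈ Finset.range N, w (s i) * (G.eval (s (i + 1)) - G.eval (s i)))
    linarith
  have hlim : Tendsto (fun n : ℕ => totalVar w * B + totalVar w * (M * 2) * (1 / ((n : ℝ) + 1)))
      atTop (𝓝 (totalVar w * B)) := by
    have := (tendsto_one_div_add_atTop_nhds_zero_nat (𝕜 := ℝ)).const_mul (totalVar w * (M * 2))
    simpa using this.const_add (totalVar w * B)
  exact ge_of_tendsto' hlim key

/-- The integral of `L_n v` over `[-1, 1]`, that is, the Legendre coefficient of `v` up to its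
normalizing factor. -/
noncomputable def legendreInt (v : ℝ → ℝ) (n : ℕ) : ℝ :=
  ∫ t in (-1 : ℝ)..1, (legendre n).eval t * v t

theorem legendreCoeff_eq (v : ℝ → ℝ) (n : ℕ) :
    legendreCoeff v n = ((n : ℝ) + 1 / 2) * legendreInt v n := rfl

theorem mul_integral_legendre_mul (v : ℝ → ℝ) (n : ℕ) :
    (n : ℝ) * (n + 1) * legendreInt v n =
      -∫ t in (-1 : ℝ)..1, v t * (derivative (lglPoly n)).eval t := by
  rw [legendreInt, ← intervalIntegral.integral_const_mul, ← intervalIntegral.integral_neg]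
  refine intervalIntegral.integral_congr fun t _ => ?_
  simp only [derivative_lglPoly, eval_mul, eval_neg, eval_C]
  ring

/-- The decay `O(n^(-3/2))` of the Legendre integrals of a function of bounded variation, from
`n (n + 1) L_n = -((1 - t²) L_n')'` and `(1 - t²) |L_n'| ≤ √n`. -/
theorem abs_legendreInt_le {w : ℝ → ℝ} (hw : BoundedVariationOn w (Icc (-1) 1))
    (hi : IntegrableOn w (Icc (-1) 1)) (n : ℕ) :
    |legendreInt w n| ≤ 2 * (supAbs w + totalVar w) / (((n : ℝ) + 1) * √((n : ℝ) + 1)) := by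
  have hU := supAbs_nonneg hw
  have hV := totalVar_nonneg w
  rcases Nat.eq_zero_or_pos n with rfl | hn
  · have h : |legendreInt w 0| ≤ 2 * supAbs w :=
      abs_integral_le_two_mul fun t ht => by
        simpa [legendre_zero] using abs_le_supAbs hw ht
    simp only [CharP.cast_eq_zero, zero_add, Real.sqrt_one, mul_one, div_one]
    linarith
  · have h := abs_integral_mul_derivative_le hw hi (eval_one_lglPoly n) (eval_neg_one_lglPoly n)
      (abs_eval_lglPoly_le n)
    rw [← abs_neg, ← mul_integral_legendre_mul, abs_mul, abs_of_nonneg (by positivity)] at h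
    have hn1 : (1 : ℝ) ≤ n := by exact_mod_cast hn
    have hsq : √(n : ℝ) * √(n : ℝ) = n := Real.mul_self_sqrt (by positivity)
    have hs0 : 0 < √(n : ℝ) := Real.sqrt_pos.2 (by linarith)
    have hs1 : √((n : ℝ) + 1) ≤ 2 * √(n : ℝ) := by
      rw [Real.sqrt_le_left (by positivity)]
      nlinarith
    rw [le_div_iff₀ (by positivity)]
    have h3 : √(n : ℝ) * (√(n : ℝ) * (n + 1) * |legendreInt w n|) ≤ √(n : ℝ) * totalVar w := by
      calc _ = (√(n : ℝ) * √(n : ℝ)) * (n + 1) * |legendreInt w n| := by ring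
        _ = (n : ℝ) * (n + 1) * |legendreInt w n| := by rw [hsq]
        _ ≤ _ := h
        _ = _ := mul_comm _ _
    have h4 := le_of_mul_le_mul_left h3 hs0
    have h5 : 0 ≤ ((n : ℝ) + 1) * |legendreInt w n| := by positivity
    calc |legendreInt w n| * (((n : ℝ) + 1) * √((n : ℝ) + 1))
        = (((n : ℝ) + 1) * |legendreInt w n|) * √((n : ℝ) + 1) := by ring
      _ ≤ (((n : ℝ) + 1) * |legendreInt w n|) * (2 * √(n : ℝ)) := by gcongr
      _ = 2 * (√(n : ℝ) * (n + 1) * |legendreInt w n|) := by ring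
      _ ≤ 2 * totalVar w := by linarith
      _ ≤ 2 * (supAbs w + totalVar w) := by linarith

/-- Integration by parts against `(1 - t²) L_{n+1}'`, which is a multiple of `L_n - L_{n+2}` and
vanishes at the endpoints. -/
theorem IsPrimitive.legendreInt_succ {v w : ℝ → ℝ} (h : IsPrimitive v w) (n : ℕ) :
    (2 * (n : ℝ) + 3) * legendreInt v (n + 1) = legendreInt w n - legendreInt w (n + 2) := by
  have h1 := mul_integral_legendre_mul v (n + 1)
  have h2 := h.integral_mul_deriv (p := fun t => (lglPoly (n + 1)).eval t)
    (by simpa using (lglPoly (n + 1)).contDiff_aeval (𝕜 := ℝ) 1)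
  simp only [Polynomial.deriv, eval_one_lglPoly, eval_neg_one_lglPoly] at h2
  rw [h2] at h1
  have hw := intervalIntegrable_neg_one_one_iff.2 h.integrable
  have h3 : (2 * (n : ℝ) + 3) * ∫ t in (-1 : ℝ)..1, w t * (lglPoly (n + 1)).eval t =
      ((n : ℝ) + 1) * (n + 2) * (legendreInt w n - legendreInt w (n + 2)) := by
    rw [legendreInt, legendreInt, ← intervalIntegral.integral_sub
      (hw.continuousOn_mul (legendre n).continuous.continuousOn)
      (hw.continuousOn_mul (legendre (n + 2)).continuous.continuousOn),
      ← intervalIntegral.integral_const_mul, ← intervalIntegral.integral_const_mul]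
    refine intervalIntegral.integral_congr fun t _ => ?_
    have := congrArg (eval t) (lglPoly_succ_eq_sub n)
    simp only [eval_mul, eval_sub, eval_C] at this
    linear_combination w t * this
  have hn : ((n : ℝ) + 1) * (n + 2) ≠ 0 := by positivity
  refine mul_left_cancel₀ hn ?_
  push_cast at h1
  linear_combination (2 * (n : ℝ) + 3) * h1 + h3

theorem IsPrimitive.abs_legendreCoeff_succ_le {v w : ℝ → ℝ} (h : IsPrimitive v w) (n : ℕ) :
    |legendreCoeff v (n + 1)| ≤ (|legendreInt w n| + |legendreInt w (n + 2)|) / 2 := by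
  have h1 := h.legendreInt_succ n
  have h2 : legendreCoeff v (n + 1) = (legendreInt w n - legendreInt w (n + 2)) / 2 := by
    rw [legendreCoeff_eq, ← h1]
    push_cast
    ring
  rw [h2, abs_div, abs_two]
  gcongr
  exact abs_sub _ _

/-- Integration improves the decay of the Legendre integrals by one power of `n`. -/
theorem IsPrimitive.exists_legendreInt_le {v w : ℝ → ℝ} (h : IsPrimitive v w) {k : ℕ}
    (hw : ∃ C, ∀ n : ℕ, |legendreInt w n| ≤ C / (((n : ℝ) + 1) ^ k * √((n : ℝ) + 1))) :
    ∃ C, ∀ n : ℕ, |legendreInt v n| ≤ C / (((n : ℝ) + 1) ^ (k + 1) * √((n : ℝ) + 1)) := by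
  obtain ⟨C, hC⟩ := hw
  have hC0 : 0 ≤ C := by simpa using (abs_nonneg _).trans (hC 0)
  refine ⟨max |legendreInt v 0| (C * 2 ^ (k + 2)), fun n => ?_⟩
  cases n with
  | zero => simp
  | succ n =>
    have h1 := h.legendreInt_succ n
    have hn : (0 : ℝ) ≤ n := Nat.cast_nonneg n
    have h2 : C / (((n + 2 : ℕ) + 1 : ℝ) ^ k * √((n + 2 : ℕ) + 1 : ℝ)) ≤
        C / (((n : ℝ) + 1) ^ k * √((n : ℝ) + 1)) := by
      push_cast
      gcongr <;> linarith
    have h3 : (2 * (n : ℝ) + 3) * |legendreInt v (n + 1)| ≤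
        2 * (C / (((n : ℝ) + 1) ^ k * √((n : ℝ) + 1))) := by
      rw [← abs_of_nonneg (show 0 ≤ 2 * (n : ℝ) + 3 by positivity), ← abs_mul, h1]
      refine (abs_sub _ _).trans ?_
      have e1 := hC n
      have e2 := (hC (n + 2)).trans h2
      linarith
    have hA : 0 < ((n : ℝ) + 1) ^ k * √((n : ℝ) + 1) := by positivity
    rw [← mul_div_assoc, le_div_iff₀ hA] at h3
    refine le_trans ?_ (div_le_div_of_nonneg_right (le_max_right _ _) (by positivity))
    rw [le_div_iff₀ (by positivity)]
    push_cast
    have h4 : ((n : ℝ) + 1 + 1) ^ (k + 1) ≤ 2 ^ k * ((n : ℝ) + 1) ^ k * (2 * n + 3) := by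
      rw [pow_succ, ← mul_pow]
      refine mul_le_mul ?_ (by linarith) (by positivity) (by positivity)
      exact pow_le_pow_left₀ (by positivity) (by linarith) k
    have h5 : √((n : ℝ) + 1 + 1) ≤ 2 * √((n : ℝ) + 1) := by
      rw [Real.sqrt_le_left (by positivity), mul_pow, Real.sq_sqrt (by positivity)]
      linarith
    calc |legendreInt v (n + 1)| * (((n : ℝ) + 1 + 1) ^ (k + 1) * √((n : ℝ) + 1 + 1))
        ≤ |legendreInt v (n + 1)| *
          ((2 ^ k * ((n : ℝ) + 1) ^ k * (2 * n + 3)) * (2 * √((n : ℝ) + 1))) := by gcongr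
      _ = 2 ^ (k + 1) * ((2 * (n : ℝ) + 3) * |legendreInt v (n + 1)| *
          (((n : ℝ) + 1) ^ k * √((n : ℝ) + 1))) := by ring
      _ ≤ 2 ^ (k + 1) * (2 * C) := by gcongr
      _ = C * 2 ^ (k + 2) := by ring

theorem rpow_three_halves {x : ℝ} (hx : 0 ≤ x) : x ^ (3 / 2 : ℝ) = x * √x := by
  rcases hx.eq_or_lt with rfl | hx
  · simp
  · rw [Real.sqrt_eq_rpow, ← Real.rpow_one_add' hx.le (by norm_num)]
    norm_num

theorem summable_one_div_add_one_rpow {s : ℝ} (hs : 1 < s) :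
    Summable fun k : ℕ => 1 / ((k : ℝ) + 1) ^ s := by
  have := (summable_nat_add_iff 1).2 (Real.summable_one_div_nat_rpow.2 hs)
  simpa using this

/-- The absolute Legendre coefficients of `v` sum to at most the threshold for `d`. The coefficients
of positive order are bounded by a multiple of `n ^ (-3/2)`, with the constant `2 ≤ 6 / √π`. -/
theorem IsPrimitive.sum_abs_legendreCoeff_le {v w : ℝ → ℝ} (h : IsPrimitive v w)
    (hw : BoundedVariationOn w (Icc (-1) 1)) (M : ℕ) :
    ∑ n ∈ Finset.range (M + 1), |legendreCoeff v n| ≤ spectralThreshold v w := by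
  have hU := supAbs_nonneg hw
  have hV := totalVar_nonneg w
  set A := supAbs w + totalVar w with hA
  have hA0 : 0 ≤ A := by positivity
  have hterm : ∀ n : ℕ, |legendreCoeff v (n + 1)| ≤ 2 * A * (1 / ((n : ℝ) + 1) ^ (3 / 2 : ℝ)) := by
    intro n
    have h1 := h.abs_legendreCoeff_succ_le n
    have h2 := abs_legendreInt_le hw h.integrable n
    have h3 := abs_legendreInt_le hw h.integrable (n + 2)
    have h4 : 2 * A / (((n + 2 : ℕ) + 1 : ℝ) * √((n + 2 : ℕ) + 1 : ℝ)) ≤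
        2 * A / (((n : ℝ) + 1) * √((n : ℝ) + 1)) := by
      push_cast
      gcongr <;> linarith
    rw [rpow_three_halves (by positivity), mul_one_div]
    linarith
  rw [Finset.sum_range_succ', spectralThreshold, add_comm]
  refine add_le_add (le_of_eq ?_) ?_
  · simp [legendreCoeff, legendre_zero]
  · have hs := summable_one_div_add_one_rpow (s := 3 / 2) (by norm_num)
    have h5 : 2 ≤ 6 / √Real.pi := by
      rw [le_div_iff₀ (Real.sqrt_pos.2 Real.pi_pos)]
      have : √Real.pi ≤ 2 := by
        rw [Real.sqrt_le_left (by norm_num)]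
        linarith [Real.pi_le_four]
      linarith
    calc ∑ n ∈ Finset.range M, |legendreCoeff v (n + 1)|
        ≤ ∑ n ∈ Finset.range M, 2 * A * (1 / ((n : ℝ) + 1) ^ (3 / 2 : ℝ)) :=
          Finset.sum_le_sum fun n _ => hterm n
      _ = 2 * A * ∑ n ∈ Finset.range M, (1 / ((n : ℝ) + 1) ^ (3 / 2 : ℝ)) := by rw [Finset.mul_sum]
      _ ≤ 2 * A * ∑' n : ℕ, (1 / ((n : ℝ) + 1) ^ (3 / 2 : ℝ)) := by
          gcongr
          exact hs.sum_le_tsum _ fun n _ => by positivity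
      _ ≤ 6 / √Real.pi * A * ∑' n : ℕ, (1 / ((n : ℝ) + 1) ^ (3 / 2 : ℝ)) := by
          have : 0 ≤ ∑' n : ℕ, (1 / ((n : ℝ) + 1) ^ (3 / 2 : ℝ)) := tsum_nonneg fun n => by positivity
          gcongr

/-! ### Uniform convergence of Legendre series -/

theorem intervalIntegrable_eval_mul (q : ℝ[X]) {z : ℝ → ℝ} (hz : ContinuousOn z (Icc (-1) 1)) :
    IntervalIntegrable (fun t => q.eval t * z t) volume (-1) 1 :=
  intervalIntegrable_of_continuousOn_Icc (q.continuous.continuousOn.mul hz)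

/-- By Weierstrass approximation, `∫ z² = 0` if `z` is orthogonal to all polynomials. -/
theorem eq_zero_of_forall_legendreInt_eq_zero {z : ℝ → ℝ} (hz : ContinuousOn z (Icc (-1) 1))
    (h : ∀ n, legendreInt z n = 0) {t : ℝ} (ht : t ∈ Icc (-1 : ℝ) 1) : z t = 0 := by
  have hpoly : ∀ q : ℝ[X], ∫ t in (-1 : ℝ)..1, q.eval t * z t = 0 := by
    intro q
    obtain ⟨b, hb⟩ := exists_eq_sum_legendre q.natDegree q le_rfl
    have e : (fun t => q.eval t * z t) = fun t => ∑ n ∈ Finset.range (q.natDegree + 1),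
        b n * ((legendre n).eval t * z t) := by
      funext t
      conv_lhs => rw [hb]
      rw [eval_finsetSum, Finset.sum_mul]
      exact Finset.sum_congr rfl fun n _ => by rw [eval_mul, eval_C, mul_assoc]
    rw [e, intervalIntegral.integral_finsetSum
      fun n _ => (intervalIntegrable_eval_mul (legendre n) hz).const_mul _]
    refine Finset.sum_eq_zero fun n _ => ?_
    rw [intervalIntegral.integral_const_mul]
    exact mul_eq_zero_of_right _ (h n)
  obtain ⟨Z, hZ⟩ := isCompact_Icc.exists_bound_of_continuousOn hz
  have hZ0 : 0 ≤ Z := (norm_nonneg _).trans (hZ 0 (by norm_num))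
  by_contra hne
  have hpos : 0 < ∫ t in (-1 : ℝ)..1, z t * z t :=
    intervalIntegral.integral_pos (by norm_num) (hz.mul hz) (fun s _ => mul_self_nonneg _)
      ⟨t, ht, mul_self_pos.2 hne⟩
  set I := ∫ t in (-1 : ℝ)..1, z t * z t with hI
  obtain ⟨q, hq⟩ := exists_polynomial_near_of_continuousOn (-1) 1 z hz (I / (4 * (Z + 1)))
    (by positivity)
  have e1 : ∫ t in (-1 : ℝ)..1, (z t * z t - q.eval t * z t) = I := by
    rw [intervalIntegral.integral_sub (intervalIntegrable_of_continuousOn_Icc (hz.fun_mul hz))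
      (intervalIntegrable_eval_mul q hz), hpoly, sub_zero]
  have e2 : |∫ t in (-1 : ℝ)..1, (z t * z t - q.eval t * z t)| ≤ 2 * (I / (4 * (Z + 1)) * Z) := by
    refine abs_integral_le_two_mul fun s hs => ?_
    rw [← sub_mul, abs_mul, abs_sub_comm]
    exact mul_le_mul (hq s hs).le (hZ s hs) (abs_nonneg _) (by positivity)
  rw [e1, abs_of_pos hpos] at e2
  have e3 : 2 * (I / (4 * (Z + 1)) * Z) ≤ I / 2 := by
    rw [← sub_nonneg]
    have : I / 2 - 2 * (I / (4 * (Z + 1)) * Z) = I / (2 * (Z + 1)) := by field_simp; ring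
    rw [this]
    positivity
  linarith

theorem abs_mul_eval_legendre_le (a : ℕ → ℝ) (n : ℕ) {t : ℝ} (ht : t ∈ Icc (-1 : ℝ) 1) :
    |a n * (legendre n).eval t| ≤ |a n| := by
  rw [abs_mul]
  exact mul_le_of_le_one_right (abs_nonneg _) (abs_eval_legendre_le_one n ht)

theorem abs_tsum_sub_legendreSum_le {a : ℕ → ℝ} (ha : Summable fun n => |a n|) (M : ℕ) {t : ℝ}
    (ht : t ∈ Icc (-1 : ℝ) 1) :
    |∑' n, a n * (legendre n).eval t - (legendreSum a M).eval t| ≤ ∑' n, |a (n + (M + 1))| := by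
  have hs : Summable fun n => a n * (legendre n).eval t :=
    Summable.of_norm_bounded ha fun n => abs_mul_eval_legendre_le a n ht
  rw [eval_legendreSum, ← hs.sum_add_tsum_nat_add (M + 1), add_sub_cancel_left]
  have hs' := (summable_nat_add_iff (f := fun n => |a n|) (M + 1)).2 ha
  exact tsum_of_norm_bounded (f := fun n => a (n + (M + 1)) * (legendre (n + (M + 1))).eval t)
    hs'.hasSum fun n => abs_mul_eval_legendre_le a (n + (M + 1)) ht

/-- A continuous function with absolutely summable Legendre coefficients is the sum of its Legendre
series. -/
theorem eq_tsum_legendre {v : ℝ → ℝ} (hv : ContinuousOn v (Icc (-1) 1))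
    (ha : Summable fun n => |legendreCoeff v n|) {t : ℝ} (ht : t ∈ Icc (-1 : ℝ) 1) :
    v t = ∑' n, legendreCoeff v n * (legendre n).eval t := by
  set a := legendreCoeff v with hadef
  set s : ℝ → ℝ := fun t => ∑' n, a n * (legendre n).eval t with hs
  have hsc : ContinuousOn s (Icc (-1) 1) :=
    continuousOn_tsum (fun n => (continuous_const.mul (legendre n).continuous).continuousOn) ha
      fun n t ht => abs_mul_eval_legendre_le a n ht
  refine sub_eq_zero.1 (eq_zero_of_forall_legendreInt_eq_zero (z := fun t => v t - s t)
    (hv.sub hsc) (fun n => ?_) ht)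
  have key : ∀ M, n ≤ M →
      |legendreInt (fun t => v t - s t) n| ≤ 2 * ∑' k, |a (k + (M + 1))| := by
    intro M hM
    set S := legendreSum a M
    have hS : ContinuousOn (fun t => S.eval t) (Icc (-1) 1) := S.continuous.continuousOn
    have e1 : legendreInt (fun t => S.eval t) n = legendreInt v n := by
      have h1 := legendreCoeff_legendreSum a hM
      rw [hadef, legendreCoeff_eq, legendreCoeff_eq] at h1
      exact mul_left_cancel₀ (by positivity) h1
    have e2 : legendreInt (fun t => v t - s t) n =
        ∫ t in (-1 : ℝ)..1, (legendre n).eval t * (S.eval t - s t) := by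
      have h1 : legendreInt (fun t => v t - s t) n =
          legendreInt v n - ∫ t in (-1 : ℝ)..1, (legendre n).eval t * s t := by
        rw [legendreInt, legendreInt, ← intervalIntegral.integral_sub
          (intervalIntegrable_eval_mul _ hv) (intervalIntegrable_eval_mul _ hsc)]
        exact intervalIntegral.integral_congr fun t _ => mul_sub _ _ _
      rw [h1, ← e1, legendreInt, ← intervalIntegral.integral_sub
          (intervalIntegrable_eval_mul _ hS) (intervalIntegrable_eval_mul _ hsc)]
      exact intervalIntegral.integral_congr fun t _ => (mul_sub _ _ _).symm
    rw [e2]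
    refine abs_integral_le_two_mul fun t ht => ?_
    rw [abs_mul, abs_sub_comm]
    exact (mul_le_of_le_one_left (abs_nonneg _) (abs_eval_legendre_le_one n ht)).trans
      (abs_tsum_sub_legendreSum_le ha M ht)
  have hlim : Tendsto (fun M : ℕ => 2 * ∑' k, |a (k + (M + 1))|) atTop (𝓝 0) := by
    have := ((tendsto_add_atTop_iff_nat 1).2
      (tendsto_sum_nat_add fun n => |a n|)).const_mul 2
    simpa using this
  have := ge_of_tendsto hlim (eventually_atTop.2 ⟨n, fun M hM => key M hM⟩)
  exact abs_nonpos_iff.1 this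

/-- The rate of convergence of Legendre series. The coefficients are of order
`n ^ (-(k + 1 / 2))`; the power `n ^ (-(k - 3 / 4))` is extracted from the tail of the series. -/
theorem exists_abs_sub_legendreSum_le {v : ℝ → ℝ} (hv : ContinuousOn v (Icc (-1) 1)) {k : ℕ}
    (hk : 1 ≤ k)
    (h : ∃ C, ∀ n : ℕ, |legendreInt v n| ≤ C / (((n : ℝ) + 1) ^ (k + 1) * √((n : ℝ) + 1))) :
    ∃ C, ∀ M : ℕ, ∀ t ∈ Icc (-1 : ℝ) 1,
      |v t - (legendreSum (legendreCoeff v) M).eval t| ≤ C * ((M : ℝ) + 1) ^ (-((k : ℝ) - 3 / 4)) := by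
  obtain ⟨C, hC⟩ := h
  have hC0 : 0 ≤ C := by simpa using (abs_nonneg _).trans (hC 0)
  have hk1 : (1 : ℝ) ≤ k := by exact_mod_cast hk
  have hcoef : ∀ n : ℕ, |legendreCoeff v n| ≤
      C * ((n : ℝ) + 1) ^ (-((k : ℝ) - 3 / 4)) * (1 / ((n : ℝ) + 1) ^ (5 / 4 : ℝ)) := by
    intro n
    have hn : (0 : ℝ) < (n : ℝ) + 1 := by positivity
    have e1 : ((n : ℝ) + 1) ^ (-((k : ℝ) - 3 / 4)) * (1 / ((n : ℝ) + 1) ^ (5 / 4 : ℝ)) =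
        ((n : ℝ) + 1) * (1 / (((n : ℝ) + 1) ^ (k + 1) * √((n : ℝ) + 1))) := by
      rw [one_div, ← Real.rpow_neg hn.le, ← Real.rpow_add hn, Real.sqrt_eq_rpow,
        ← Real.rpow_natCast, ← Real.rpow_add hn, one_div, ← Real.rpow_neg hn.le]
      conv_rhs => rw [← Real.rpow_one_add' hn.le (by push_cast; linarith)]
      congr 1
      push_cast
      ring
    rw [mul_assoc, e1, legendreCoeff_eq, abs_mul, abs_of_nonneg (by positivity)]
    calc ((n : ℝ) + 1 / 2) * |legendreInt v n|
        ≤ ((n : ℝ) + 1) * (C / (((n : ℝ) + 1) ^ (k + 1) * √((n : ℝ) + 1))) := by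
          gcongr
          · linarith
          · exact hC n
      _ = _ := by ring
  have hsum := summable_one_div_add_one_rpow (s := 5 / 4) (by norm_num)
  have hle : ∀ n M : ℕ, M ≤ n → ((n : ℝ) + 1) ^ (-((k : ℝ) - 3 / 4)) ≤
      ((M : ℝ) + 1) ^ (-((k : ℝ) - 3 / 4)) := fun n M hnM =>
    Real.rpow_le_rpow_of_nonpos (by positivity) (by gcongr) (by linarith)
  have hbound : ∀ n M : ℕ, M ≤ n → |legendreCoeff v n| ≤
      C * ((M : ℝ) + 1) ^ (-((k : ℝ) - 3 / 4)) * (1 / ((n : ℝ) + 1) ^ (5 / 4 : ℝ)) := by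
    intro n M hnM
    exact (hcoef n).trans (mul_le_mul_of_nonneg_right
      (mul_le_mul_of_nonneg_left (hle n M hnM) hC0) (by positivity))
  have habs : Summable fun n => |legendreCoeff v n| := by
    refine Summable.of_nonneg_of_le (fun n => abs_nonneg _) (fun n => hbound n 0 (Nat.zero_le n)) ?_
    exact hsum.mul_left _
  refine ⟨C * ∑' n : ℕ, 1 / ((n : ℝ) + 1) ^ (5 / 4 : ℝ), fun M t ht => ?_⟩
  rw [eq_tsum_legendre hv habs ht]
  refine (abs_tsum_sub_legendreSum_le habs M ht).trans ?_
  have hs1 := (summable_nat_add_iff (f := fun n => |legendreCoeff v n|) (M + 1)).2 habs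
  have hs2 := (summable_nat_add_iff (f := fun n : ℕ => 1 / ((n : ℝ) + 1) ^ (5 / 4 : ℝ)) (M + 1)).2 hsum
  set c := C * ((M : ℝ) + 1) ^ (-((k : ℝ) - 3 / 4)) with hc
  have hc0 : 0 ≤ c := by positivity
  calc ∑' n, |legendreCoeff v (n + (M + 1))|
      ≤ ∑' n : ℕ, c * (1 / (((n + (M + 1) : ℕ) : ℝ) + 1) ^ (5 / 4 : ℝ)) :=
        hs1.tsum_le_tsum (fun n => hbound _ M (by omega)) (hs2.mul_left c)
    _ = c * ∑' n : ℕ, (1 / (((n + (M + 1) : ℕ) : ℝ) + 1) ^ (5 / 4 : ℝ)) := tsum_mul_left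
    _ ≤ c * ∑' n : ℕ, (1 / ((n : ℝ) + 1) ^ (5 / 4 : ℝ)) := by
        refine mul_le_mul_of_nonneg_left ?_ hc0
        rw [← hsum.sum_add_tsum_nat_add (M + 1)]
        exact le_add_of_nonneg_left (Finset.sum_nonneg fun n _ => by positivity)
    _ = _ := by rw [hc]; ring

/-- Start with the `m`-th derivative, which has bounded variation, and integrate `k` times. -/
theorem IsBVDerivFamily.exists_legendreInt_le {m : ℕ} {ξ : ℝ → ℝ} {y : ℕ → ℝ → ℝ}
    (hy : IsBVDerivFamily m ξ y) {k : ℕ} (hk : k ≤ m) :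
    ∃ C, ∀ n : ℕ, |legendreInt (y (m - k)) n| ≤ C / (((n : ℝ) + 1) ^ (k + 1) * √((n : ℝ) + 1)) := by
  induction k with
  | zero =>
    refine ⟨2 * (supAbs (y m) + totalVar (y m)), fun n => ?_⟩
    rw [zero_add, pow_one]
    exact abs_legendreInt_le hy.boundedVariation (hy.weakDeriv m le_rfl).integrable_right n
  | succ k ih =>
    have h := hy.isPrimitive (j := m - (k + 1)) (by omega)
    rw [show m - (k + 1) + 1 = m - k by omega] at h
    exact h.exists_legendreInt_le (ih (by omega))

theorem IsBVDerivFamily.boundedVariationOn {m : ℕ} {ξ : ℝ → ℝ} {y : ℕ → ℝ → ℝ}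
    (hy : IsBVDerivFamily m ξ y) {j : ℕ} (hj : j ≤ m) : BoundedVariationOn (y j) (Icc (-1) 1) := by
  rcases hj.eq_or_lt with rfl | h
  · exact hy.boundedVariation
  · exact (hy.isPrimitive h).boundedVariationOn

/-! ### The discrete problem in terms of a single polynomial -/

theorem eval_interpPoly_node {r N : ℕ} (hN : 1 ≤ N) (X : Fin (N + 1) → Fin r → ℝ) (i : Fin r)
    (k : Fin (N + 1)) : (interpPoly X i).eval (node N k) = X k i :=
  Lagrange.eval_interpolate_at_node _ (node_injective hN).injOn (Finset.mem_univ k)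

theorem natDegree_interpPoly_le {r N : ℕ} (hN : 1 ≤ N) (X : Fin (N + 1) → Fin r → ℝ) (i : Fin r) :
    (interpPoly X i).natDegree ≤ N := by
  have h := Lagrange.degree_interpolate_le (s := Finset.univ) (v := node N) (fun k => X k i)
    (node_injective hN).injOn
  rw [Finset.card_univ, Fintype.card_fin, Nat.add_sub_cancel] at h
  exact natDegree_le_of_degree_le h

/-- A polynomial of degree at most `N` is determined by its values at the `N + 1` nodes. -/
theorem eq_of_eval_node_eq {N : ℕ} (hN : 1 ≤ N) {p q : ℝ[X]} (hp : p.natDegree ≤ N)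
    (hq : q.natDegree ≤ N) (h : ∀ k, p.eval (node N k) = q.eval (node N k)) : p = q := by
  rw [eq_sum_lglBasis hN hp, eq_sum_lglBasis hN hq]
  simp only [h]

theorem natDegree_iterate_derivative_le {N : ℕ} {p : ℝ[X]} (hp : p.natDegree ≤ N) (i : ℕ) :
    (derivative^[i] p).natDegree ≤ N :=
  (natDegree_iterate_derivative p i).trans (by omega)

section Sample

variable {r : ℕ}

/-- The curve `t ↦ (p, p', …, p^(r-1))`. -/
noncomputable def polyState (r : ℕ) (p : ℝ[X]) (t : ℝ) : Fin r → ℝ :=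
  fun i => (derivative^[(i : ℕ)] p).eval t

/-- The jet `t ↦ ((p, p', …, p^(r-1)), p^(r))`. -/
noncomputable def polyJet (r : ℕ) (p : ℝ[X]) (t : ℝ) : (Fin r → ℝ) × ℝ :=
  (polyState r p t, (derivative^[r] p).eval t)

/-- The values of `(p, p', …, p^(r-1))` at the nodes. -/
noncomputable def sample (r N : ℕ) (p : ℝ[X]) : Fin (N + 1) → Fin r → ℝ :=
  fun k => polyState r p (node N k)

theorem derivative_iterate_lastIdx [NeZero r] (p : ℝ[X]) :
    derivative (derivative^[(lastIdx r : ℕ)] p) = derivative^[r] p := by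
  rw [← Function.iterate_succ_apply' derivative]
  congr 2
  have := NeZero.pos r
  simp only [lastIdx]
  omega

theorem interpPoly_sample {N : ℕ} (hN : 1 ≤ N) {p : ℝ[X]} (hp : p.natDegree ≤ N) (i : Fin r) :
    interpPoly (sample r N p) i = derivative^[(i : ℕ)] p :=
  eq_of_eval_node_eq hN (natDegree_interpPoly_le hN _ _) (natDegree_iterate_derivative_le hp _)
    fun _ => eval_interpPoly_node hN _ _ _

theorem interpState_sample {N : ℕ} (hN : 1 ≤ N) {p : ℝ[X]} (hp : p.natDegree ≤ N) :
    interpState (sample r N p) = polyState r p := by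
  funext t i
  rw [interpState, interpPoly_sample hN hp, polyState]

theorem lastStateDeriv_sample [NeZero r] {N : ℕ} (hN : 1 ≤ N)
    {p : ℝ[X]} (hp : p.natDegree ≤ N) (j : ℕ) :
    lastStateDeriv (sample r N p) j = fun k => (derivative^[r - 1 + j] p).eval (node N k) := by
  have h := diffMatrix_pow_mulVec hN (natDegree_iterate_derivative_le hp (r - 1)) j
  rw [← Function.iterate_add_apply, add_comm j] at h
  exact h

/-- The spectral coefficients are true Legendre coefficients as long as the quadrature rule is exact
for the products that occur in them. -/
theorem spectralCoeff_sample [NeZero r] {N : ℕ} (hN : 2 ≤ N)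
    {p : ℝ[X]} (hp : p.natDegree ≤ N) {j n : ℕ}
    (hn : n + (N - (r - 1 + j)) ≤ 2 * N - 1) :
    spectralCoeff (sample r N p) j n =
      legendreCoeff (fun t => (derivative^[r - 1 + j] p).eval t) n := by
  rw [spectralCoeff, lastStateDeriv_sample (by omega) hp, legendreCoeff_polynomial,
    ← sum_eval_mul_weight hN]
  · congr 1
    refine Finset.sum_congr rfl fun k _ => ?_
    rw [legendreAt, eval_mul]
    ring
  · refine (natDegree_mul_le_of_le (natDegree_legendre_le n)
      (natDegree_iterate_derivative _ _)).trans ?_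
    omega

/-- Discrete states that satisfy the discretized chain of integrators are the samples of the
derivatives of one polynomial, the interpolation polynomial of the first state variable. -/
theorem exists_eq_sample [NeZero r] {N : ℕ} (hN : 1 ≤ N) {X : Fin (N + 1) → Fin r → ℝ}
    (h : ∀ (i : ℕ) (hi : i + 1 < r),
      diffMatrix N *ᵥ (fun k => X k ⟨i, Nat.lt_of_succ_lt hi⟩) = fun k => X k ⟨i + 1, hi⟩) :
    ∃ p : ℝ[X], p.natDegree ≤ N ∧ X = sample r N p := by
  have h0 := NeZero.pos r
  refine ⟨interpPoly X ⟨0, h0⟩, natDegree_interpPoly_le hN _ _, ?_⟩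
  have key : ∀ (i : ℕ) (hi : i < r),
      interpPoly X ⟨i, hi⟩ = derivative^[i] (interpPoly X ⟨0, h0⟩) := by
    intro i
    induction i with
    | zero => intro _; rfl
    | succ i ih =>
      intro hi
      rw [Function.iterate_succ_apply', ← ih (by omega)]
      refine eq_of_eval_node_eq hN (natDegree_interpPoly_le hN _ _)
        ((natDegree_derivative_le _).trans
          ((Nat.sub_le _ _).trans (natDegree_interpPoly_le hN _ _))) fun k => ?_
      have h1 := congrFun (diffMatrix_mulVec hN
        (natDegree_interpPoly_le hN X ⟨i, Nat.lt_of_succ_lt hi⟩)) k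
      simp only [eval_interpPoly_node hN] at h1
      rw [← h1, h i hi, eval_interpPoly_node hN]
  funext k i
  rw [sample, polyState, ← key i i.2, eval_interpPoly_node hN]

variable {Ne Nh : ℕ} (P : BolzaProblem r Ne Nh)

/-- The state together with the control that produces the derivative `z.2` of the last state
variable: `(x, v) ↦ (x, (v - f x) / g x)`. -/
noncomputable def BolzaProblem.stateControl (z : (Fin r → ℝ) × ℝ) : (Fin r → ℝ) × ℝ :=
  (z.1, (z.2 - P.f z.1) / P.g z.1)

theorem BolzaProblem.interpControl_sample [NeZero r] {N : ℕ} (hN : 1 ≤ N)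
    {p : ℝ[X]} (hp : p.natDegree ≤ N) :
    P.interpControl (sample r N p) = fun t => (P.stateControl (polyJet r p t)).2 := by
  funext t
  rw [BolzaProblem.interpControl, interpState_sample hN hp, interpPoly_sample hN hp,
    derivative_iterate_lastIdx]
  rfl

theorem diffMatrix_mulVec_lastIdx_sample [NeZero r] {N : ℕ} (hN : 1 ≤ N)
    {p : ℝ[X]} (hp : p.natDegree ≤ N) :
    (diffMatrix N *ᵥ fun k => sample r N p k (lastIdx r)) =
      fun k => (derivative^[r] p).eval (node N k) := by
  rw [← derivative_iterate_lastIdx]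
  exact diffMatrix_mulVec hN (natDegree_iterate_derivative_le hp _)

/-- The discretized last state equation determines the discrete control, because `g` does not vanish. -/
theorem BolzaProblem.control_eq [NeZero r] {N : ℕ} (hN : 1 ≤ N) {p : ℝ[X]} (hp : p.natDegree ≤ N)
    {U : Fin (N + 1) → ℝ}
    (h : (diffMatrix N *ᵥ fun k => sample r N p k (lastIdx r)) =
      fun k => P.f (sample r N p k) + P.g (sample r N p k) * U k) (k : Fin (N + 1)) :
    (sample r N p k, U k) = P.stateControl (polyJet r p (node N k)) := by
  rw [diffMatrix_mulVec_lastIdx_sample hN hp] at h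
  have h1 := congrFun h k
  refine Prod.ext rfl ?_
  have hg := P.g_ne_zero (polyState r p (node N k))
  simp only [BolzaProblem.stateControl, polyJet]
  rw [eq_div_iff hg, h1]
  simp only [sample]
  ring

/-! ### Local Lipschitz continuity -/

theorem BolzaProblem.locallyLipschitz_stateControl : LocallyLipschitz P.stateControl := by
  have hfst : LocallyLipschitz (Prod.fst : (Fin r → ℝ) × ℝ → Fin r → ℝ) :=
    LipschitzWith.prod_fst.locallyLipschitz
  have hsnd : LocallyLipschitz (Prod.snd : (Fin r → ℝ) × ℝ → ℝ) :=
    LipschitzWith.prod_snd.locallyLipschitz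
  refine hfst.prodMk ?_
  have h3 : LocallyLipschitz fun z : (Fin r → ℝ) × ℝ => (z.2, P.f z.1, P.g z.1) :=
    hsnd.prodMk ((P.lipschitz_f.comp hfst).prodMk (P.lipschitz_g.comp hfst))
  intro z
  -- the quotient `(a, b, c) ↦ (a - b) / c` is smooth where `c ≠ 0`
  have hc : ContDiffAt ℝ 1 (fun q : ℝ × ℝ × ℝ => (q.1 - q.2.1) / q.2.2)
      (z.2, P.f z.1, P.g z.1) := by
    refine ContDiffAt.div (by fun_prop) (by fun_prop) (P.g_ne_zero z.1)
  obtain ⟨K, t, ht, hK⟩ := hc.exists_lipschitzOnWith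
  obtain ⟨L, s, hs, hL⟩ := h3 z
  exact ⟨K * L, s ∩ (fun z : (Fin r → ℝ) × ℝ => (z.2, P.f z.1, P.g z.1)) ⁻¹' t,
    inter_mem hs (h3.continuous.continuousAt ht),
    hK.comp (hL.mono inter_subset_left) fun y hy => hy.2⟩

theorem BolzaProblem.continuous_stateControl : Continuous P.stateControl :=
  P.locallyLipschitz_stateControl.continuous

/-- A locally Lipschitz function is Lipschitz near a compact set, with uniform constants. -/
theorem _root_.LocallyLipschitz.exists_dist_le_of_isCompact {E F : Type*} [PseudoMetricSpace E]
    [ProperSpace E] [PseudoMetricSpace F] {f : E → F} (hf : LocallyLipschitz f) {s : Set E}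
    (hs : IsCompact s) :
    ∃ K : ℝ, 0 ≤ K ∧ ∀ a ∈ s, ∀ b, dist b a ≤ 1 → dist (f b) (f a) ≤ K * dist b a := by
  obtain ⟨K, hK⟩ := hf.locallyLipschitzOn.exists_lipschitzOnWith_of_compact
    (hs.cthickening (r := 1))
  refine ⟨K, K.2, fun a ha b hab => hK.dist_le_mul b ?_ a ?_⟩
  · exact Metric.mem_cthickening_of_dist_le b a 1 s ha hab
  · exact Metric.self_subset_cthickening s ha

/-! ### Convergence of the discrete and continuous costs -/

theorem tendstoUniformlyOn_comp_of_continuous {E F : Type*} [PseudoMetricSpace E]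
    [PseudoMetricSpace F] {Z : ℕ → ℝ → E} {z : ℝ → E} {s : Set ℝ} (hs : IsCompact s)
    (hz : ContinuousOn z s) (h : TendstoUniformlyOn Z z atTop s) {Φ : E → F} (hΦ : Continuous Φ) :
    TendstoUniformlyOn (fun j t => Φ (Z j t)) (fun t => Φ (z t)) atTop s := by
  rw [Metric.tendstoUniformlyOn_iff] at h ⊢
  intro ε hε
  have h1 := (hs.image_of_continuousOn hz).uniformContinuousAt_of_continuousAt Φ
    (fun a _ => hΦ.continuousAt) (Metric.dist_mem_uniformity hε)
  obtain ⟨δ, hδ, h2⟩ := Metric.mem_uniformity_dist.1 h1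
  filter_upwards [h δ hδ] with j hj t ht
  exact h2 (hj t ht) ⟨t, ht, rfl⟩

theorem continuous_polyJet (r : ℕ) (p : ℝ[X]) : Continuous (polyJet r p) := by
  have h : Continuous (polyState r p) :=
    continuous_pi fun i => (derivative^[(i : ℕ)] p).continuous
  exact h.prodMk (derivative^[r] p).continuous

theorem tendsto_integral_of_tendstoUniformlyOn {G : ℕ → ℝ → ℝ} {f : ℝ → ℝ}
    (hG : ∀ j, ContinuousOn (G j) (Icc (-1) 1)) (hf : ContinuousOn f (Icc (-1) 1))
    (h : TendstoUniformlyOn G f atTop (Icc (-1) 1)) :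
    Tendsto (fun j => ∫ t in (-1 : ℝ)..1, G j t) atTop (𝓝 (∫ t in (-1 : ℝ)..1, f t)) := by
  rw [Metric.tendsto_nhds]
  intro ε hε
  filter_upwards [Metric.tendstoUniformlyOn_iff.1 h (ε / 4) (by positivity)] with j hj
  rw [Real.dist_eq, ← intervalIntegral.integral_sub (intervalIntegrable_of_continuousOn_Icc (hG j))
    (intervalIntegrable_of_continuousOn_Icc hf)]
  refine (abs_integral_le_two_mul (ε := ε / 4) fun t ht => ?_).trans_lt (by linarith)
  have := hj t ht
  rw [dist_comm, Real.dist_eq] at this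
  exact this.le

theorem tendsto_polyState_endpoints {p : ℕ → ℝ[X]} {z : ℝ → (Fin r → ℝ) × ℝ}
    (h : TendstoUniformlyOn (fun j => polyJet r (p j)) z atTop (Icc (-1) 1)) :
    Tendsto (fun j => (polyState r (p j) (-1), polyState r (p j) 1)) atTop
      (𝓝 ((z (-1)).1, (z 1).1)) := by
  have h1 := h.tendsto_at (show (-1 : ℝ) ∈ Icc (-1 : ℝ) 1 by norm_num)
  have h2 := h.tendsto_at (show (1 : ℝ) ∈ Icc (-1 : ℝ) 1 by norm_num)
  exact ((continuous_fst.tendsto _).comp h1).prodMk_nhds ((continuous_fst.tendsto _).comp h2)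

/-- If the jets of polynomials converge uniformly, the discrete costs of their samples converge. -/
theorem BolzaProblem.tendsto_discCost {φ : ℕ → ℕ} (hφ : Tendsto φ atTop atTop) (hφ1 : ∀ j, 1 ≤ φ j)
    {p : ℕ → ℝ[X]} {z : ℝ → (Fin r → ℝ) × ℝ} (hz : ContinuousOn z (Icc (-1) 1))
    (h : TendstoUniformlyOn (fun j => polyJet r (p j)) z atTop (Icc (-1) 1))
    {U : (j : ℕ) → Fin (φ j + 1) → ℝ}
    (hU : ∀ j k, (sample r (φ j) (p j) k, U j k) =
      P.stateControl (polyJet r (p j) (node (φ j) k))) :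
    Tendsto (fun j => P.discCost (sample r (φ j) (p j)) (U j)) atTop
      (𝓝 (P.cost (fun t => (z t).1) fun t => (P.stateControl (z t)).2)) := by
  have hF : Continuous fun q => P.F (P.stateControl q) :=
    P.lipschitz_F.continuous.comp P.continuous_stateControl
  have h1 := tendstoUniformlyOn_comp_of_continuous isCompact_Icc hz h hF
  have h2 := tendsto_sum_mul_weight hφ (hF.comp_continuousOn hz)
    (fun j k => P.F (sample r (φ j) (p j) k, U j k)) (fun ε hε => by
      filter_upwards [Metric.tendstoUniformlyOn_iff.1 h1 ε hε] with j hj k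
      have := hj _ (node_mem_Icc (hφ1 j) k)
      rw [dist_comm, Real.dist_eq] at this
      rw [hU]
      exact this.le)
  have h3 := (P.lipschitz_E.continuous.tendsto _).comp (tendsto_polyState_endpoints h)
  refine (h2.add h3).congr fun j => ?_
  simp only [BolzaProblem.discCost, sample, Function.comp_apply, node_zero (hφ1 j),
    node_last (hφ1 j)]

/-- If the jets of polynomials converge uniformly, the costs of the associated trajectories
converge. -/
theorem BolzaProblem.tendsto_cost {p : ℕ → ℝ[X]} {z : ℝ → (Fin r → ℝ) × ℝ}
    (hz : ContinuousOn z (Icc (-1) 1))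
    (h : TendstoUniformlyOn (fun j => polyJet r (p j)) z atTop (Icc (-1) 1)) :
    Tendsto (fun j => P.cost (polyState r (p j)) fun t => (P.stateControl (polyJet r (p j) t)).2)
      atTop (𝓝 (P.cost (fun t => (z t).1) fun t => (P.stateControl (z t)).2)) := by
  have hF : Continuous fun q => P.F (P.stateControl q) :=
    P.lipschitz_F.continuous.comp P.continuous_stateControl
  have h1 := tendstoUniformlyOn_comp_of_continuous isCompact_Icc hz h hF
  have h2 := tendsto_integral_of_tendstoUniformlyOn
    (fun j => (hF.comp (continuous_polyJet r (p j))).continuousOn) (hF.comp_continuousOn hz) h1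
  exact h2.add ((P.lipschitz_E.continuous.tendsto _).comp (tendsto_polyState_endpoints h))

end Sample

/-! ### Compactness of the discrete trajectories -/

/-- The Arzelà-Ascoli theorem for uniformly bounded, uniformly Lipschitz sequences. -/
theorem exists_subseq_tendstoUniformlyOn {E : Type*} [NormedAddCommGroup E] [ProperSpace E]
    {F : ℕ → ℝ → E} {B : ℝ} {K : NNReal} (hB : ∀ j, ∀ t ∈ Icc (-1 : ℝ) 1, ‖F j t‖ ≤ B)
    (hK : ∀ j, LipschitzOnWith K (F j) (Icc (-1) 1)) :
    ∃ (ψ : ℕ → ℕ) (z : ℝ → E), StrictMono ψ ∧ ContinuousOn z (Icc (-1) 1) ∧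
      TendstoUniformlyOn (fun j => F (ψ j)) z atTop (Icc (-1) 1) := by
  let G : ℕ → BoundedContinuousFunction (Icc (-1 : ℝ) 1) E := fun j =>
    BoundedContinuousFunction.mkOfCompact
      ⟨(Icc (-1 : ℝ) 1).domRestrict (F j),
        continuousOn_iff_continuous_domRestrict.1 (hK j).continuousOn⟩
  have hcomp : IsCompact (closure (range G)) := by
    refine BoundedContinuousFunction.arzela_ascoli (Metric.closedBall 0 B)
      (isCompact_closedBall 0 B) _ ?_ ?_
    · rintro f x ⟨j, rfl⟩
      rw [mem_closedBall_zero_iff]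
      exact hB j x x.2
    · have : ∀ f : range G, LipschitzWith K
          (fun x => (f : BoundedContinuousFunction (Icc (-1 : ℝ) 1) E) x) := by
        rintro ⟨_, j, rfl⟩
        exact (hK j).to_restrict
      exact (LipschitzWith.uniformEquicontinuous _ K this).equicontinuous
  obtain ⟨g, -, ψ, hψ, hlim⟩ := hcomp.tendsto_subseq fun j => subset_closure (mem_range_self j)
  have hu := BoundedContinuousFunction.tendsto_iff_tendstoUniformly.1 hlim
  refine ⟨ψ, IccExtend (by norm_num) g, hψ, ?_, ?_⟩
  · exact (g.continuous.Icc_extend' ).continuousOn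
  · rw [Metric.tendstoUniformlyOn_iff]
    rw [Metric.tendstoUniformly_iff] at hu
    intro ε hε
    filter_upwards [hu ε hε] with j hj t ht
    have := hj ⟨t, ht⟩
    rw [IccExtend_of_mem _ _ ht]
    exact this

/-- Bounds at the left endpoint for the lower derivatives and a uniform bound for the highest
derivative give uniform bounds for all of them. -/
theorem abs_eval_iterate_derivative_le {B : ℝ} (hB : 0 ≤ B) (k : ℕ) :
    ∀ p : ℝ[X], (∀ i < k, |(derivative^[i] p).eval (-1)| ≤ B) →
      (∀ t ∈ Icc (-1 : ℝ) 1, |(derivative^[k] p).eval t| ≤ B) →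
      ∀ i ≤ k, ∀ t ∈ Icc (-1 : ℝ) 1, |(derivative^[i] p).eval t| ≤ 3 ^ k * B := by
  induction k with
  | zero =>
    intro p _ h i hi t ht
    rw [Nat.le_zero.1 hi, pow_zero, one_mul]
    exact h t ht
  | succ k ih =>
    intro p h0 h i hi t ht
    have hd := ih (derivative p) (fun i hi => h0 (i + 1) (by omega)) h
    have h3 : (1 : ℝ) ≤ 3 ^ k := one_le_pow₀ (by norm_num)
    cases i with
    | succ i =>
      refine (hd i (by omega) t ht).trans ?_
      rw [pow_succ]
      nlinarith
    | zero =>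
      have e : p.eval t = p.eval (-1) + ∫ s in (-1 : ℝ)..t, (derivative p).eval s := by
        rw [intervalIntegral.integral_eq_sub_of_hasDerivAt (fun x _ => p.hasDerivAt x)
          ((derivative p).continuous.intervalIntegrable _ _)]
        ring
      have e2 := intervalIntegral.norm_integral_le_of_norm_le_const (a := -1) (b := t)
        (f := fun s => (derivative p).eval s) (C := 3 ^ k * B) (fun s hs => by
          rw [uIoc_of_le ht.1] at hs
          exact hd 0 (by omega) s ⟨hs.1.le, hs.2.trans ht.2⟩)
      rw [Real.norm_eq_abs, abs_of_nonneg (by linarith [ht.1] : 0 ≤ t - -1)] at e2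
      have e3 := h0 0 (by omega)
      simp only [Function.iterate_zero, id] at e3 ⊢
      rw [e]
      refine (abs_add_le _ _).trans ?_
      have e4 : 3 ^ k * B * (t - -1) ≤ 3 ^ k * B * 2 := by
        refine mul_le_mul_of_nonneg_left (by linarith [ht.2]) (by positivity)
      have e5 : B ≤ 3 ^ k * B := le_mul_of_one_le_left hB h3
      rw [pow_succ]
      linarith

theorem polyJet_lipschitzOnWith {r : ℕ} {p : ℝ[X]} {K : NNReal}
    (h : ∀ i ≤ r + 1, ∀ t ∈ Icc (-1 : ℝ) 1, |(derivative^[i] p).eval t| ≤ K) :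
    LipschitzOnWith K (polyJet r p) (Icc (-1) 1) := by
  have key : ∀ i ≤ r, LipschitzOnWith K (fun t => (derivative^[i] p).eval t) (Icc (-1) 1) := by
    intro i hi
    refine Convex.lipschitzOnWith_of_nnnorm_hasDerivWithin_le (convex_Icc _ _)
      (fun t _ => ((derivative^[i] p).hasDerivAt t).hasDerivWithinAt) fun t ht => ?_
    have := h (i + 1) (by omega) t ht
    rw [Function.iterate_succ_apply'] at this
    exact_mod_cast this
  rw [lipschitzOnWith_iff_dist_le_mul]
  intro s hs t ht
  rw [Prod.dist_eq]
  refine max_le ?_ ((key r le_rfl).dist_le_mul s hs t ht)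
  rw [dist_pi_le_iff (by positivity)]
  exact fun i => (key i i.2.le).dist_le_mul s hs t ht

theorem norm_polyJet_le {r : ℕ} {p : ℝ[X]} {B : ℝ} {t : ℝ} (hB : 0 ≤ B)
    (h : ∀ i ≤ r, |(derivative^[i] p).eval t| ≤ B) : ‖polyJet r p t‖ ≤ B := by
  rw [Prod.norm_def]
  refine max_le ?_ (h r le_rfl)
  rw [pi_norm_le_iff_of_nonneg hB]
  exact fun i => h i i.2.le

theorem isPrimitive_of_tendstoUniformlyOn {q : ℕ → ℝ[X]} {v w : ℝ → ℝ}
    (hw : ContinuousOn w (Icc (-1) 1))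
    (h1 : TendstoUniformlyOn (fun j t => (q j).eval t) v atTop (Icc (-1) 1))
    (h2 : TendstoUniformlyOn (fun j t => (derivative (q j)).eval t) w atTop (Icc (-1) 1)) :
    IsPrimitive v w := by
  refine ⟨hw.integrableOn_Icc, fun t ht => ?_⟩
  have hm : (-1 : ℝ) ∈ Icc (-1 : ℝ) 1 := by norm_num
  have e1 : Tendsto (fun j => (q j).eval t - (q j).eval (-1)) atTop (𝓝 (v t - v (-1))) :=
    (h1.tendsto_at ht).sub (h1.tendsto_at hm)
  have e2 : Tendsto (fun j => (q j).eval t - (q j).eval (-1)) atTop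
      (𝓝 (∫ s in (-1 : ℝ)..t, w s)) := by
    rw [Metric.tendsto_nhds]
    intro ε hε
    filter_upwards [Metric.tendstoUniformlyOn_iff.1 h2 (ε / 4) (by positivity)] with j hj
    rw [← intervalIntegral.integral_eq_sub_of_hasDerivAt (fun x _ => (q j).hasDerivAt x)
      ((derivative (q j)).continuous.intervalIntegrable _ _), Real.dist_eq,
      ← intervalIntegral.integral_sub ((derivative (q j)).continuous.intervalIntegrable _ _)
        (intervalIntegrable_sub_Icc hw.integrableOn_Icc hm ht)]
    have := intervalIntegral.norm_integral_le_of_norm_le_const (a := -1) (b := t)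
      (f := fun s => (derivative (q j)).eval s - w s) (C := ε / 4) (fun s hs => by
        rw [uIoc_of_le ht.1] at hs
        have := hj s ⟨hs.1.le, hs.2.trans ht.2⟩
        rw [dist_comm, dist_eq_norm] at this
        exact this.le)
    rw [Real.norm_eq_abs, abs_of_nonneg (by linarith [ht.1] : 0 ≤ t - -1)] at this
    have h4 : ε / 4 * (t - -1) ≤ ε / 4 * 2 := by
      refine mul_le_mul_of_nonneg_left (by linarith [ht.2]) (by positivity)
    linarith
  have := tendsto_nhds_unique e1 e2
  linarith

section DiscFeasible

variable {r Ne Nh : ℕ} [NeZero r] (P : BolzaProblem r Ne Nh)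

/-- The derivatives occurring in the jet of the polynomial behind a feasible discrete trajectory
are bounded independently of the number of nodes. -/
theorem BolzaProblem.exists_bound_of_isDiscFeasible (R : DiscParams r) (hm₁ : 1 ≤ R.m₁) :
    ∃ B : ℝ, 0 ≤ B ∧ ∀ N, r + R.m₁ ≤ N → 2 ≤ N → ∀ (p : ℝ[X]) (U : Fin (N + 1) → ℝ),
      p.natDegree ≤ N → P.IsDiscFeasible R (sample r N p) U →
      ∀ i ≤ r - 1 + R.m₁, ∀ t ∈ Icc (-1 : ℝ) 1, |(derivative^[i] p).eval t| ≤ B := by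
  set k := r - 1 + R.m₁ with hk
  have hr := NeZero.pos r
  set B0 : ℝ := |R.d| + (∑ i : Fin r, (|R.lo.1 i| + |R.hi.1 i|)) +
    ∑ j ∈ Finset.range R.m₁, (|R.dlo j| + |R.dhi j|) with hB0
  have hsum1 : ∀ i : Fin r, |R.lo.1 i| + |R.hi.1 i| ≤ ∑ i : Fin r, (|R.lo.1 i| + |R.hi.1 i|) :=
    fun i => Finset.single_le_sum (f := fun i => |R.lo.1 i| + |R.hi.1 i|)
      (fun i _ => by positivity) (Finset.mem_univ i)
  have hsum2 : ∀ j < R.m₁, |R.dlo j| + |R.dhi j| ≤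
      ∑ j ∈ Finset.range R.m₁, (|R.dlo j| + |R.dhi j|) := fun j hj =>
    Finset.single_le_sum (f := fun j => |R.dlo j| + |R.dhi j|)
      (fun j _ => by positivity) (Finset.mem_range.2 hj)
  have hs1 : 0 ≤ ∑ i : Fin r, (|R.lo.1 i| + |R.hi.1 i|) :=
    Finset.sum_nonneg fun i _ => by positivity
  have hs2 : 0 ≤ ∑ j ∈ Finset.range R.m₁, (|R.dlo j| + |R.dhi j|) :=
    Finset.sum_nonneg fun i _ => by positivity
  have hB0' : 0 ≤ B0 := by positivity
  have habs : ∀ {x a b : ℝ}, a ≤ x → x ≤ b → |x| ≤ |a| + |b| := by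
    intro x a b h1 h2
    have := abs_le_max_abs_abs h1 h2
    have := max_le_add_of_nonneg (abs_nonneg a) (abs_nonneg b)
    linarith
  refine ⟨3 ^ k * B0, by positivity, fun N hN hN2 p U hp hfeas => ?_⟩
  have hN1 : 1 ≤ N := by omega
  refine abs_eval_iterate_derivative_le hB0' k p (fun i hi => ?_) fun t ht => ?_
  · rcases lt_or_ge i r with hir | hir
    · have h1 := hfeas.box 0
      have h2 := h1.1.1 ⟨i, hir⟩
      have h3 := h1.2.1 ⟨i, hir⟩
      simp only [sample, polyState, node_zero hN1] at h2 h3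
      have := habs h2 h3
      have := hsum1 ⟨i, hir⟩
      have := abs_nonneg R.d
      linarith
    · obtain ⟨j, hj⟩ : ∃ j, i = r - 1 + j := ⟨i - (r - 1), by omega⟩
      have h1 := hfeas.initialDeriv j (by omega) (by omega)
      rw [lastStateDeriv_sample hN1 hp, ← hj] at h1
      simp only [node_zero hN1] at h1
      have := habs h1.1 h1.2
      have := hsum2 j (by omega)
      have := abs_nonneg R.d
      linarith
  · have hdeg : (derivative^[k] p).natDegree ≤ N + 1 - r - R.m₁ :=
      (natDegree_iterate_derivative p k).trans (by omega)
    refine (abs_eval_le_sum_legendreCoeff hdeg ht).trans ?_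
    have h1 := hfeas.spectral
    have h2 : ∑ n ∈ Finset.range (N + 2 - r - R.m₁), |spectralCoeff (sample r N p) R.m₁ n| =
        ∑ n ∈ Finset.range (N + 1 - r - R.m₁ + 1),
          |legendreCoeff (fun t => (derivative^[k] p).eval t) n| := by
      rw [show N + 2 - r - R.m₁ = N + 1 - r - R.m₁ + 1 by omega]
      refine Finset.sum_congr rfl fun n hn => ?_
      have := Finset.mem_range.1 hn
      rw [spectralCoeff_sample hN2 hp (by omega)]
    rw [← h2]
    have := le_abs_self R.d
    linarith

theorem tendsto_sub_rpow_neg {a β : ℝ} (hβ : 0 < β) {φ : ℕ → ℕ} (hφ : Tendsto φ atTop atTop) :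
    Tendsto (fun j => ((φ j : ℝ) - a) ^ (-β)) atTop (𝓝 0) :=
  (tendsto_rpow_neg_atTop hβ).comp
    (tendsto_atTop_add_const_right atTop (-a) (tendsto_natCast_atTop_atTop.comp hφ))

/-- A uniform limit of feasible discrete trajectories is feasible for the continuous problem. -/
theorem BolzaProblem.isFeasible_of_tendstoUniformlyOn (R : DiscParams r) (hβ : 0 < R.β)
    {φ : ℕ → ℕ} (hφ : Tendsto φ atTop atTop) (hφ1 : ∀ j, 1 ≤ φ j)
    {p : ℕ → ℝ[X]} (hp : ∀ j, (p j).natDegree ≤ φ j) {U : (j : ℕ) → Fin (φ j + 1) → ℝ}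
    (hfeas : ∀ j, P.IsDiscFeasible R (sample r (φ j) (p j)) (U j))
    {z : ℝ → (Fin r → ℝ) × ℝ} (hz : ContinuousOn z (Icc (-1) 1))
    (h : TendstoUniformlyOn (fun j => polyJet r (p j)) z atTop (Icc (-1) 1)) :
    P.IsFeasible (fun t => (z t).1) fun t => (P.stateControl (z t)).2 := by
  have hδ := tendsto_sub_rpow_neg (a := r + 1) hβ hφ
  have hδ' : Tendsto (fun j => ((φ j : ℝ) - r - 1) ^ (-R.β)) atTop (𝓝 0) := by
    simpa only [sub_sub] using hδ
  have hfst : ContinuousOn (fun t => (z t).1) (Icc (-1) 1) := continuous_fst.comp_continuousOn hz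
  have hsnd : ContinuousOn (fun t => (z t).2) (Icc (-1) 1) := continuous_snd.comp_continuousOn hz
  have hcomp : ∀ i : Fin r, TendstoUniformlyOn (fun j t => (derivative^[(i : ℕ)] (p j)).eval t)
      (fun t => (z t).1 i) atTop (Icc (-1) 1) := fun i =>
    tendstoUniformlyOn_comp_of_continuous isCompact_Icc hz h
      (Φ := fun q : (Fin r → ℝ) × ℝ => q.1 i) (by fun_prop)
  have hlast : TendstoUniformlyOn (fun j t => (derivative^[r] (p j)).eval t)
      (fun t => (z t).2) atTop (Icc (-1) 1) :=
    tendstoUniformlyOn_comp_of_continuous isCompact_Icc hz h continuous_snd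
  refine ⟨hfst, fun i hi => ?_, ?_, ?_, ?_, ?_⟩
  · have h1 := hcomp ⟨i, Nat.lt_of_succ_lt hi⟩
    have h2 := hcomp ⟨i + 1, hi⟩
    simp only [Function.iterate_succ_apply'] at h2
    exact (isPrimitive_of_tendstoUniformlyOn
      ((continuous_apply (⟨i + 1, hi⟩ : Fin r)).comp_continuousOn hfst) h1 h2).isWeakDeriv
  · have h1 := hcomp (lastIdx r)
    have h2 := isPrimitive_of_tendstoUniformlyOn hsnd h1 (by
      simpa only [derivative_iterate_lastIdx] using hlast)
    have e : (fun t => P.f (z t).1 + P.g (z t).1 * (P.stateControl (z t)).2) =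
        fun t => (z t).2 := by
      funext t
      simp only [BolzaProblem.stateControl]
      rw [mul_div_cancel₀ _ (P.g_ne_zero _)]
      ring
    rw [e]
    exact h2.isWeakDeriv
  · have h1 := (P.lipschitz_e.continuous.tendsto _).comp (tendsto_polyState_endpoints h)
    have h2 : ∀ j, ‖P.e (polyState r (p j) (-1), polyState r (p j) 1)‖ ≤
        ((φ j : ℝ) - r - 1) ^ (-R.β) := fun j => by
      have := (hfeas j).endpoint
      rwa [sample, sample, node_zero (hφ1 j), node_last (hφ1 j)] at this
    have h3 := le_of_tendsto_of_tendsto' h1.norm hδ' h2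
    exact norm_le_zero_iff.1 h3
  · refine (ae_restrict_iff' measurableSet_Icc).2 (Eventually.of_forall fun t ht => ?_)
    intro i
    have hH : Continuous fun q => P.h (P.stateControl q) i :=
      (continuous_apply i).comp (P.lipschitz_h.continuous.comp P.continuous_stateControl)
    have hunif := tendstoUniformlyOn_comp_of_continuous isCompact_Icc hz h hH
    refine le_of_forall_pos_le_add fun ε hε => ?_
    have hcont := (hH.comp_continuousOn hz) t ht
    obtain ⟨δ, hδ0, hδ1⟩ := Metric.continuousWithinAt_iff.1 hcont (ε / 3) (by positivity)
    obtain ⟨j, ⟨hj1, hj2⟩, hj3⟩ := ((Metric.tendstoUniformlyOn_iff.1 hunif (ε / 3)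
      (by positivity)).and ((eventually_exists_node_near hφ ht hδ0))).and
        (hδ'.eventually (gt_mem_nhds (show 0 < ε / 3 by positivity))) |>.exists
    obtain ⟨k, hk⟩ := hj2
    have hnode := node_mem_Icc (hφ1 j) k
    have e1 := hδ1 hnode (by rwa [Real.dist_eq])
    have e2 := hj1 _ hnode
    have e3 := (hfeas j).path k i
    rw [P.control_eq (hφ1 j) (hp j) (hfeas j).control k] at e3
    rw [Real.dist_eq] at e1 e2
    simp only [Function.comp_apply] at e1 e2
    have e1' := abs_lt.1 e1
    have e2' := abs_lt.1 e2
    change P.h (P.stateControl (z t)) i ≤ 0 + ε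
    linarith [e1'.1, e2'.2]
  · exact (P.lipschitz_F.continuous.comp P.continuous_stateControl).comp_continuousOn hz
      |>.integrableOn_Icc

end DiscFeasible

/-! ### The comparison sequence -/

theorem IsPrimitive.congr_right {v w w' : ℝ → ℝ} (h : IsPrimitive v w)
    (hw : EqOn w w' (Icc (-1) 1)) : IsPrimitive v w' := by
  refine ⟨h.integrable.congr_fun hw measurableSet_Icc, fun t ht => ?_⟩
  rw [h.eq t ht]
  congr 1
  refine intervalIntegral.integral_congr fun s hs => hw ?_
  exact uIcc_subset_Icc (by norm_num) ht hs

theorem IsPrimitive.abs_eval_sub_le {v w : ℝ → ℝ} (h : IsPrimitive v w) {q : ℝ[X]}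
    (h0 : q.eval (-1) = v (-1)) {ε : ℝ}
    (hε : ∀ t ∈ Icc (-1 : ℝ) 1, |(derivative q).eval t - w t| ≤ ε) {t : ℝ}
    (ht : t ∈ Icc (-1 : ℝ) 1) : |q.eval t - v t| ≤ 2 * ε := by
  have hm : (-1 : ℝ) ∈ Icc (-1 : ℝ) 1 := by norm_num
  have hε0 : 0 ≤ ε := (abs_nonneg _).trans (hε _ hm)
  have e : q.eval t - v t = ∫ s in (-1 : ℝ)..t, ((derivative q).eval s - w s) := by
    rw [intervalIntegral.integral_sub ((derivative q).continuous.intervalIntegrable _ _)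
      (intervalIntegrable_sub_Icc h.integrable hm ht),
      intervalIntegral.integral_eq_sub_of_hasDerivAt (fun x _ => q.hasDerivAt x)
        ((derivative q).continuous.intervalIntegrable _ _), h.eq t ht, h0]
    ring
  have := intervalIntegral.norm_integral_le_of_norm_le_const (a := -1) (b := t)
    (f := fun s => (derivative q).eval s - w s) (C := ε) (fun s hs => by
      rw [uIoc_of_le ht.1] at hs
      exact hε s ⟨hs.1.le, hs.2.trans ht.2⟩)
  rw [Real.norm_eq_abs, abs_of_nonneg (by linarith [ht.1] : 0 ≤ t - -1)] at this
  have h4 : ε * (t - -1) ≤ ε * 2 := mul_le_mul_of_nonneg_left (by linarith [ht.2]) hε0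
  rw [e]
  linarith

/-- A polynomial with the same initial values as a chain of primitives is as close to the chain as
its highest derivative, up to a constant. -/
theorem abs_eval_iterate_derivative_sub_le {ε : ℝ} (hε0 : 0 ≤ ε) (k : ℕ) :
    ∀ (ζ : ℕ → ℝ → ℝ) (p : ℝ[X]), (∀ i < k, IsPrimitive (ζ i) (ζ (i + 1))) →
      (∀ i < k, (derivative^[i] p).eval (-1) = ζ i (-1)) →
      (∀ t ∈ Icc (-1 : ℝ) 1, |(derivative^[k] p).eval t - ζ k t| ≤ ε) →
      ∀ i ≤ k, ∀ t ∈ Icc (-1 : ℝ) 1, |(derivative^[i] p).eval t - ζ i t| ≤ 2 ^ k * ε := by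
  induction k with
  | zero =>
    intro ζ p _ _ h i hi t ht
    rw [Nat.le_zero.1 hi, pow_zero, one_mul]
    exact h t ht
  | succ k ih =>
    intro ζ p hζ h0 h i hi t ht
    have hd := ih (fun i => ζ (i + 1)) (derivative p) (fun i hi => hζ (i + 1) (by omega))
      (fun i hi => h0 (i + 1) (by omega)) h
    have h2 : 0 ≤ 2 ^ k * ε := by positivity
    cases i with
    | succ i =>
      refine (hd i (by omega) t ht).trans ?_
      rw [pow_succ]
      linarith
    | zero =>
      refine ((hζ 0 (by omega)).abs_eval_sub_le (h0 0 (by omega)) (hd 0 (by omega)) ht).trans ?_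
      rw [pow_succ]
      linarith

/-- An algebraic rate with the larger exponent eventually beats the relaxation of the discrete
constraints. -/
theorem eventually_mul_rpow_le {β γ : ℝ} (hγ : 0 < γ) (hβγ : β < γ) (r m₁ : ℕ) {C : ℝ}
    (hC : 0 ≤ C) : ∀ᶠ N : ℕ in atTop,
      C * (((N + 1 - r - m₁ : ℕ) : ℝ) + 1) ^ (-γ) ≤ ((N : ℝ) - r - 1) ^ (-β) := by
  have h1 := tendsto_sub_rpow_neg (a := r + 1) (sub_pos.2 hβγ) tendsto_id
  have h2 := (h1.const_mul (C * 2 ^ γ)).eventually (gt_mem_nhds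
    (show C * 2 ^ γ * 0 < 1 by rw [mul_zero]; exact one_pos))
  filter_upwards [h2, eventually_ge_atTop (r + 2 * m₁ + 2)] with N hN hN2
  simp only [id, ← sub_sub] at hN
  set s : ℝ := (N : ℝ) - r - 1 with hs
  have hN3 : (r : ℝ) + 2 * m₁ + 2 ≤ N := by exact_mod_cast hN2
  have hs0 : 0 < s := by
    have : (0 : ℝ) ≤ m₁ := Nat.cast_nonneg _
    linarith
  have hM : s / 2 ≤ ((N + 1 - r - m₁ : ℕ) : ℝ) + 1 := by
    rw [Nat.cast_sub (by omega), Nat.cast_sub (by omega)]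
    push_cast
    linarith
  have h3 : (((N + 1 - r - m₁ : ℕ) : ℝ) + 1) ^ (-γ) ≤ (s / 2) ^ (-γ) :=
    Real.rpow_le_rpow_of_nonpos (by positivity) hM (by linarith)
  have h4 : (s / 2) ^ (-γ) = 2 ^ γ * s ^ (-(γ - β)) * s ^ (-β) := by
    rw [Real.div_rpow hs0.le (by norm_num), mul_assoc, ← Real.rpow_add hs0,
      Real.rpow_neg (by norm_num : (0 : ℝ) ≤ 2), div_inv_eq_mul, mul_comm]
    congr 2
    ring
  have h5 : 0 ≤ s ^ (-β) := Real.rpow_nonneg hs0.le _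
  calc C * (((N + 1 - r - m₁ : ℕ) : ℝ) + 1) ^ (-γ)
      ≤ C * (2 ^ γ * s ^ (-(γ - β)) * s ^ (-β)) := by
        rw [← h4]
        exact mul_le_mul_of_nonneg_left h3 hC
    _ = C * 2 ^ γ * s ^ (-(γ - β)) * s ^ (-β) := by ring
    _ ≤ s ^ (-β) := mul_le_of_le_one_left h5 hN.le

theorem tendsto_mul_rpow_zero {γ : ℝ} (hγ : 0 < γ) (r m₁ : ℕ) (C : ℝ) :
    Tendsto (fun N : ℕ => C * (((N + 1 - r - m₁ : ℕ) : ℝ) + 1) ^ (-γ)) atTop (𝓝 0) := by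
  have h1 : Tendsto (fun N : ℕ => N + 1 - r - m₁) atTop atTop := by
    simp only [Nat.sub_sub]
    exact (tendsto_sub_atTop_nat _).comp (tendsto_add_atTop_nat 1)
  have h2 := tendsto_sub_rpow_neg (a := -1) hγ h1
  simpa using h2.const_mul C

section Comparison

variable {r Ne Nh : ℕ} [NeZero r] {P : BolzaProblem r Ne Nh}

/-- The state variables and the derivatives of the last one form a chain of primitives. -/
theorem BolzaProblem.IsFeasible.exists_chain {xs : ℝ → Fin r → ℝ} {us : ℝ → ℝ}
    (hx : P.IsFeasible xs us) {m : ℕ} (hm : 0 < m) {y : ℕ → ℝ → ℝ}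
    (hy : IsBVDerivFamily m (fun t => xs t (lastIdx r)) y) :
    ∃ ζ : ℕ → ℝ → ℝ, (∀ i < r - 1 + m, IsPrimitive (ζ i) (ζ (i + 1))) ∧
      (∀ t ∈ Icc (-1 : ℝ) 1, ∀ i : Fin r, xs t i = ζ i t) ∧ ∀ j, ζ (r - 1 + j) = y j := by
  have hr := NeZero.pos r
  have hc : ∀ i, ContinuousOn (fun t => xs t i) (Icc (-1) 1) := fun i =>
    (continuous_apply i).comp_continuousOn hx.continuousOn
  have hlast : EqOn (fun t => xs t (lastIdx r)) (y 0) (Icc (-1) 1) :=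
    eqOn_Icc_of_ae_eq (hc _) (hy.continuousOn 0 hm)
      ((isWeakDeriv_zero (hc _).integrableOn_Icc).ae_unique (hy.weakDeriv 0 hm.le))
  let ζ : ℕ → ℝ → ℝ := fun i t => if h : i < r - 1 then xs t ⟨i, by omega⟩ else y (i - (r - 1)) t
  have hζ1 : ∀ (i : ℕ) (h : i < r - 1), ζ i = fun t => xs t ⟨i, by omega⟩ := fun i h => by
    funext t
    exact dif_pos h
  have hζ2 : ∀ j, ζ (r - 1 + j) = y j := fun j => by
    funext t
    simp only [ζ]
    rw [dif_neg (by omega), Nat.add_sub_cancel_left]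
  refine ⟨ζ, fun i hi => ?_, fun t ht i => ?_, hζ2⟩
  · rcases lt_or_ge i (r - 1) with h | h
    · have h1 := (hx.chain i (by omega)).isPrimitive (hc _)
      rw [hζ1 i h]
      rcases lt_or_ge (i + 1) (r - 1) with h' | h'
      · rw [hζ1 _ h']
        exact h1
      · obtain rfl : i = r - 2 := by omega
        have e : r - 2 + 1 = r - 1 + 0 := by omega
        rw [e, hζ2]
        refine h1.congr_right fun t ht => ?_
        rw [← hlast ht]
        simp only [lastIdx]
        congr 2
    · obtain ⟨j, rfl⟩ := Nat.exists_eq_add_of_le h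
      rw [add_assoc, hζ2, hζ2]
      exact hy.isPrimitive (by omega)
  · rcases lt_or_ge (i : ℕ) (r - 1) with h | h
    · rw [hζ1 _ h]
    · have e : i = lastIdx r := Fin.ext (by simp only [lastIdx]; omega)
      have e2 : (i : ℕ) = r - 1 + 0 := by omega
      rw [e2, hζ2, e]
      exact hlast ht

/-- The truncated Legendre expansion of `y m₁`, integrated `r - 1 + m₁` times with the initial values
of the chain `ζ`, gives polynomials whose jets approximate the chain with an algebraic rate. -/
theorem IsBVDerivFamily.exists_polynomial_approx {m : ℕ} {ξ : ℝ → ℝ} {y : ℕ → ℝ → ℝ}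
    (hy : IsBVDerivFamily m ξ y) {m₁ : ℕ} (hm₁ : 1 ≤ m₁) (hm : m₁ < m) {ζ : ℕ → ℝ → ℝ}
    (hζ : ∀ i < r - 1 + m, IsPrimitive (ζ i) (ζ (i + 1))) (hζy : ∀ j, ζ (r - 1 + j) = y j) :
    ∃ (p : ℕ → ℝ[X]) (C : ℝ), 0 ≤ C ∧ ∀ N, r + m₁ ≤ N → (p N).natDegree ≤ N ∧
      (∀ i < r - 1 + m₁, (derivative^[i] (p N)).eval (-1) = ζ i (-1)) ∧
      derivative^[r - 1 + m₁] (p N) = legendreSum (legendreCoeff (y m₁)) (N + 1 - r - m₁) ∧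
      ∀ t ∈ Icc (-1 : ℝ) 1, dist (polyJet r (p N) t) (fun i : Fin r => ζ i t, ζ r t) ≤
        C * (((N + 1 - r - m₁ : ℕ) : ℝ) + 1) ^ (-((m : ℝ) - m₁ - 3 / 4)) := by
  have hr := NeZero.pos r
  obtain ⟨C, hC⟩ := exists_abs_sub_legendreSum_le (hy.continuousOn m₁ hm) (k := m - m₁)
    (by omega) (by
      have := hy.exists_legendreInt_le (k := m - m₁) (by omega)
      rwa [show m - (m - m₁) = m₁ by omega] at this)
  rw [Nat.cast_sub hm.le] at hC
  choose p hp1 hp2 hp3 using fun N : ℕ => exists_iterate_derivative_eq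
    (legendreSum (legendreCoeff (y m₁)) (N + 1 - r - m₁)) (fun i => ζ i (-1)) (r - 1 + m₁)
  refine ⟨p, 2 ^ (r - 1 + m₁) * |C|, by positivity, fun N hN => ⟨?_, hp2 N, hp1 N, fun t ht => ?_⟩⟩
  · have := natDegree_legendreSum_le (legendreCoeff (y m₁)) (N + 1 - r - m₁)
    have := hp3 N
    omega
  · set ρ : ℝ := (((N + 1 - r - m₁ : ℕ) : ℝ) + 1) ^ (-((m : ℝ) - m₁ - 3 / 4)) with hρ
    have hρ0 : 0 ≤ ρ := by positivity
    have key := abs_eval_iterate_derivative_sub_le (ε := |C| * ρ) (by positivity) (r - 1 + m₁) ζ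
      (p N) (fun i hi => hζ i (by omega)) (hp2 N) (fun s hs => by
        rw [hp1, hζy, abs_sub_comm]
        exact (hC _ s hs).trans (mul_le_mul_of_nonneg_right (le_abs_self C) hρ0))
    rw [mul_assoc, Prod.dist_eq]
    refine max_le ?_ (key r (by omega) t ht)
    rw [dist_pi_le_iff (by positivity)]
    exact fun i => key i (by have := i.2; omega) t ht

/-- A condition that holds almost everywhere along a continuous curve holds everywhere if it is
closed. -/
theorem mem_of_ae_mem_of_isClosed {E : Type*} [TopologicalSpace E] {c : ℝ → E} {S : Set E}
    (hS : IsClosed S) (hc : ContinuousOn c (Icc (-1) 1))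
    (h : ∀ᵐ t ∂(volume.restrict (Icc (-1 : ℝ) 1)), c t ∈ S) {t : ℝ} (ht : t ∈ Icc (-1 : ℝ) 1) :
    c t ∈ S := by
  have h1 : ∀ᵐ s ∂(volume.restrict (Ioo (-1 : ℝ) 1)), c s ∈ S :=
    ae_mono (Measure.restrict_mono Ioo_subset_Icc_self le_rfl) h
  have h2 : Ioo (-1 : ℝ) 1 ⊆ closure ({s | c s ∈ S} ∩ Ioo (-1) 1) := by
    intro s hs
    rw [mem_closure_iff]
    intro o ho hso
    by_contra hne
    rw [not_nonempty_iff_eq_empty] at hne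
    have h3 : volume (o ∩ Ioo (-1) 1) = 0 := by
      rw [ae_restrict_iff' measurableSet_Ioo] at h1
      refine measure_mono_null (fun x hx => ?_) (ae_iff.1 h1)
      intro hx'
      have : x ∈ o ∩ ({s | c s ∈ S} ∩ Ioo (-1) 1) := ⟨hx.1, hx' hx.2, hx.2⟩
      rw [hne] at this
      exact this
    exact ((ho.inter isOpen_Ioo).measure_pos volume ⟨s, hso, hs⟩).ne' h3
  have h4 : t ∈ closure ({s | c s ∈ S} ∩ Ioo (-1) 1) := by
    have : t ∈ closure (Ioo (-1 : ℝ) 1) := by rwa [closure_Ioo (by norm_num)]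
    exact closure_minimal h2 isClosed_closure this
  have h5 := (hc t ht).mono (inter_subset_right.trans Ioo_subset_Icc_self :
    {s | c s ∈ S} ∩ Ioo (-1) 1 ⊆ Icc (-1) 1)
  have h6 := h5.mem_closure_image h4
  refine closure_minimal ?_ hS h6
  rintro _ ⟨s, hs, rfl⟩
  exact hs.1

/-- Near a sufficiently regular feasible trajectory there are feasible points of the discrete problem,
for all large numbers of nodes, and they approximate the trajectory. -/
theorem BolzaProblem.exists_comparison_sequence {xs : ℝ → Fin r → ℝ} {us : ℝ → ℝ}
    (hx : P.IsFeasible xs us) {m : ℕ} {y : ℕ → ℝ → ℝ}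
    (hy : IsBVDerivFamily m (fun t => xs t (lastIdx r)) y) {R : DiscParams r}
    (hm₁ : 1 ≤ R.m₁) (hm : R.m₁ < m) (hβ : 0 < R.β) (hβm : R.β < (m : ℝ) - R.m₁ - 3 / 4)
    (hR : R.BoundsAdmissible xs us y) :
    ∃ (p : ℕ → ℝ[X]) (z : ℝ → (Fin r → ℝ) × ℝ), ContinuousOn z (Icc (-1) 1) ∧
      TendstoUniformlyOn (fun N => polyJet r (p N)) z atTop (Icc (-1) 1) ∧
      (∀ᶠ N in atTop, P.IsDiscFeasible R (sample r N (p N))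
        fun k => (P.stateControl (polyJet r (p N) (node N k))).2) ∧
      P.cost (fun t => (z t).1) (fun t => (P.stateControl (z t)).2) = P.cost xs us := by
  have hr := NeZero.pos r
  have hmem1 : (-1 : ℝ) ∈ Icc (-1 : ℝ) 1 := by norm_num
  have hmem2 : (1 : ℝ) ∈ Icc (-1 : ℝ) 1 := by norm_num
  obtain ⟨ζ, hζ, hζx, hζy⟩ := hx.exists_chain (by omega) hy
  obtain ⟨p, C, hC0, hp⟩ := hy.exists_polynomial_approx hm₁ hm hζ hζy
  set γ : ℝ := (m : ℝ) - R.m₁ - 3 / 4 with hγdef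
  have hγ : 0 < γ := hβ.trans hβm
  set z : ℝ → (Fin r → ℝ) × ℝ := fun t => (fun i : Fin r => ζ i t, ζ r t) with hzdef
  have hzc : ContinuousOn z (Icc (-1) 1) :=
    (continuousOn_pi.2 fun i : Fin r => (hζ i (by have := i.2; omega)).continuousOn).prodMk
      (hζ r (by omega)).continuousOn
  have hz1 : ∀ t ∈ Icc (-1 : ℝ) 1, (z t).1 = xs t := fun t ht =>
    funext fun i => (hζx t ht i).symm
  -- the control `us` coincides almost everywhere with the continuous one defined by `z`
  have hae : ∀ᵐ t ∂(volume.restrict (Icc (-1 : ℝ) 1)), (xs t, us t) = P.stateControl (z t) := by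
    have h1 := (hy.weakDeriv 1 (by omega)).ae_unique hx.control
    filter_upwards [h1, ae_restrict_mem measurableSet_Icc] with t ht htm
    have h2 : (z t).2 = P.f (xs t) + P.g (xs t) * us t := by
      rw [← ht, ← hζy 1, show r - 1 + 1 = r by omega]
    refine Prod.ext (hz1 t htm).symm ?_
    simp only [BolzaProblem.stateControl]
    rw [h2, hz1 t htm, add_sub_cancel_left, mul_div_cancel_left₀ _ (P.g_ne_zero _)]
  have hΨc : ContinuousOn (fun t => P.stateControl (z t)) (Icc (-1) 1) :=
    P.continuous_stateControl.comp_continuousOn hzc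
  have hdist0 := tendsto_mul_rpow_zero hγ r R.m₁ C
  refine ⟨p, z, hzc, ?_, ?_, ?_⟩
  · rw [Metric.tendstoUniformlyOn_iff]
    intro ε hε
    filter_upwards [hdist0.eventually (gt_mem_nhds hε), eventually_ge_atTop (r + R.m₁)]
      with N hN hN2 t ht
    rw [dist_comm]
    exact ((hp N hN2).2.2.2 t ht).trans_lt hN
  · obtain ⟨K, hKc, hKi, hK⟩ := hR.box
    have hzK : ∀ t ∈ Icc (-1 : ℝ) 1, P.stateControl (z t) ∈ K := fun t ht =>
      mem_of_ae_mem_of_isClosed hKc.isClosed hΨc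
        (by filter_upwards [hK, hae] with t h1 h2; rwa [← h2]) ht
    have hzh : ∀ t ∈ Icc (-1 : ℝ) 1, P.h (P.stateControl (z t)) ≤ 0 := fun t ht =>
      mem_of_ae_mem_of_isClosed (isClosed_Iic (a := (0 : Fin Nh → ℝ)))
        (P.lipschitz_h.continuous.comp_continuousOn hΨc)
        (by filter_upwards [hx.path, hae] with t h1 h2; rw [h2] at h1; exact h1) ht
    obtain ⟨δ, hδ0, hδ⟩ := hKc.exists_thickening_subset_open isOpen_interior hKi
    have hzcomp : IsCompact (z '' Icc (-1) 1) := isCompact_Icc.image_of_continuousOn hzc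
    obtain ⟨K₁, hK₁0, hK₁⟩ :=
      P.locallyLipschitz_stateControl.exists_dist_le_of_isCompact hzcomp
    obtain ⟨K₂, hK₂0, hK₂⟩ :=
      (P.lipschitz_h.comp P.locallyLipschitz_stateControl).exists_dist_le_of_isCompact hzcomp
    obtain ⟨K₃, hK₃0, hK₃⟩ := P.lipschitz_e.exists_dist_le_of_isCompact
      (isCompact_singleton (x := ((z (-1)).1, (z 1).1)))
    filter_upwards [hdist0.eventually (ge_mem_nhds one_pos),
      (hdist0.const_mul K₁).eventually (gt_mem_nhds
        (show K₁ * 0 < δ by rwa [mul_zero])),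
      eventually_mul_rpow_le hγ hβm r R.m₁ (mul_nonneg hK₂0 hC0),
      eventually_mul_rpow_le hγ hβm r R.m₁ (mul_nonneg hK₃0 hC0),
      eventually_ge_atTop (r + R.m₁)] with N hN1 hN2 hN3 hN4 hN5
    obtain ⟨hdeg, hinit, htop, hdist⟩ := hp N hN5
    set ρ := (((N + 1 - r - R.m₁ : ℕ) : ℝ) + 1) ^ (-γ) with hρ
    rw [mul_assoc] at hN3 hN4
    have hN : 2 ≤ N := by omega
    have hN' : 1 ≤ N := by omega
    have hnode := fun k => node_mem_Icc hN' k
    refine ⟨fun i hi => ?_, ?_, ?_, fun k i => ?_, fun k => ?_, fun j hj1 hj2 => ?_, ?_⟩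
    · have := diffMatrix_mulVec hN' (natDegree_iterate_derivative_le hdeg i)
      simp only [← Function.iterate_succ_apply' derivative] at this
      exact this
    · rw [diffMatrix_mulVec_lastIdx_sample hN' hdeg]
      funext k
      simp only [sample, BolzaProblem.stateControl, polyJet]
      rw [mul_div_cancel₀ _ (P.g_ne_zero _)]
      ring
    · rw [sample, sample, node_zero hN', node_last hN']
      have h1 : dist (polyState r (p N) (-1), polyState r (p N) 1) ((z (-1)).1, (z 1).1) ≤
          C * ρ := by
        rw [Prod.dist_eq]
        exact max_le ((le_max_left _ _).trans (hdist _ hmem1))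
          ((le_max_left _ _).trans (hdist _ hmem2))
      have h2 := hK₃ _ rfl _ (h1.trans hN1)
      rw [hz1 _ hmem1, hz1 _ hmem2, hx.endpoint, dist_zero_right] at h2
      rw [hz1 _ hmem1, hz1 _ hmem2] at h1
      exact h2.trans ((mul_le_mul_of_nonneg_left h1 hK₃0).trans hN4)
    · have h1 := hdist _ (hnode k)
      have h2 := hK₂ _ (mem_image_of_mem z (hnode k)) _ (h1.trans hN1)
      have h3 := (dist_le_pi_dist _ _ i).trans
        (h2.trans ((mul_le_mul_of_nonneg_left h1 hK₂0).trans hN3))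
      rw [Real.dist_eq] at h3
      have h4 := hzh _ (hnode k) i
      have h5 := (abs_le.1 h3).2
      simp only [Function.comp_apply, Pi.zero_apply] at h4 h5
      change P.h (P.stateControl (polyJet r (p N) (node N k))) i ≤ _
      linarith
    · have h1 := hdist _ (hnode k)
      have h2 := hK₁ _ (mem_image_of_mem z (hnode k)) _ (h1.trans hN1)
      refine interior_subset (hδ (Metric.mem_thickening_iff.2 ⟨_, hzK _ (hnode k), ?_⟩))
      exact h2.trans_lt ((mul_le_mul_of_nonneg_left h1 hK₁0).trans_lt hN2)
    · rw [lastStateDeriv_sample hN' hdeg]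
      simp only [node_zero hN']
      rw [hinit _ (by omega), hζy]
      exact Ioo_subset_Icc_self (hR.initialDeriv j hj1 hj2)
    · have h1 := (hy.isPrimitive hm).sum_abs_legendreCoeff_le (hy.boundedVariationOn hm)
        (N + 1 - r - R.m₁)
      refine le_trans (le_of_eq ?_) (h1.trans hR.spectral.le)
      rw [show N + 2 - r - R.m₁ = N + 1 - r - R.m₁ + 1 by omega]
      refine Finset.sum_congr rfl fun n hn => ?_
      have hn' := Finset.mem_range.1 hn
      rw [spectralCoeff_sample hN hdeg (by omega), htop, legendreCoeff_legendreSum _ (by omega)]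
  · simp only [BolzaProblem.cost]
    rw [hz1 _ hmem1, hz1 _ hmem2]
    congr 1
    refine intervalIntegral.integral_congr_ae ?_
    rw [ae_restrict_iff' measurableSet_Icc] at hae
    filter_upwards [hae] with t ht htm
    rw [uIoc_of_le (by norm_num)] at htm
    rw [ht (Ioc_subset_Icc_self htm)]
    rfl

end Comparison

/-! ### Convergence of the discrete optimal solutions -/

end PSControl

theorem mainTheorem5 {r Ne Nh : ℕ} [NeZero r] (P : PSControl.BolzaProblem r Ne Nh)
    (m : ℕ) (hm : 3 ≤ m)
    (xs : ℝ → Fin r → ℝ) (us : ℝ → ℝ) (hopt : P.IsOptimal xs us)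
    (y : ℕ → ℝ → ℝ)
    (hy : PSControl.IsBVDerivFamily m (fun t => xs t (PSControl.lastIdx r)) y)
    (R : PSControl.DiscParams r)
    (hm₁ : 2 ≤ R.m₁) (hm₁m : R.m₁ ≤ m - 1)
    (hβ : 0 < R.β) (hβm : R.β < (m : ℝ) - R.m₁ - 3 / 4)
    (hR : R.BoundsAdmissible xs us y)
    (N₁ : ℕ) (X : (N : ℕ) → Fin (N + 1) → Fin r → ℝ) (U : (N : ℕ) → Fin (N + 1) → ℝ)
    (hXU : ∀ N, N₁ ≤ N → P.IsDiscOptimal R (X N) (U N)) :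
    ∃ (φ : ℕ → ℕ) (x : ℝ → Fin r → ℝ) (u : ℝ → ℝ),
      StrictMono φ ∧ (∀ j, N₁ ≤ φ j) ∧ P.IsOptimal x u ∧
      TendstoUniformlyOn (fun j => PSControl.interpState (X (φ j))) x atTop (Icc (-1) 1) ∧
      TendstoUniformlyOn (fun j => P.interpControl (X (φ j))) u atTop (Icc (-1) 1) ∧
      Tendsto (fun j => P.discCost (X (φ j)) (U (φ j))) atTop (𝓝 (P.cost x u)) ∧
      Tendsto (fun j => P.cost (PSControl.interpState (X (φ j))) (P.interpControl (X (φ j))))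
        atTop (𝓝 (P.cost x u)) := by
  open PSControl in
  have hr := NeZero.pos r
  set N₀ := N₁ + r + R.m₁ + 2 with hN₀
  have hsample : ∀ N, ∃ p : ℝ[X], N₀ ≤ N → p.natDegree ≤ N ∧ X N = sample r N p := fun N => by
    by_cases h : N₀ ≤ N
    · obtain ⟨p, hp⟩ := exists_eq_sample (by omega) (hXU N (by omega)).1.chain
      exact ⟨p, fun _ => hp⟩
    · exact ⟨0, fun h' => absurd h' h⟩
  choose p hp using hsample
  have hfeas : ∀ N, N₀ ≤ N → P.IsDiscFeasible R (sample r N (p N)) (U N) := fun N hN => by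
    rw [← (hp N hN).2]
    exact (hXU N (by omega)).1
  -- compactness: a subsequence of the jets of the optimal discrete trajectories converges
  obtain ⟨B, hB0, hB⟩ := P.exists_bound_of_isDiscFeasible R (by omega)
  have hbound : ∀ j, ∀ i ≤ r + 1, ∀ t ∈ Icc (-1 : ℝ) 1,
      |(derivative^[i] (p (N₀ + j))).eval t| ≤ B := fun j i hi t ht =>
    hB (N₀ + j) (by omega) (by omega) _ (U (N₀ + j)) (hp _ (by omega)).1 (hfeas _ (by omega)) i
      (by omega) t ht
  obtain ⟨ψ, z, hψ, hz, hlim⟩ := exists_subseq_tendstoUniformlyOn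
    (F := fun j => polyJet r (p (N₀ + j))) (B := B) (K := ⟨B, hB0⟩)
    (fun j t ht => norm_polyJet_le hB0 fun i hi => hbound j i (by omega) t ht)
    (fun j => polyJet_lipschitzOnWith (hbound j))
  set φ : ℕ → ℕ := fun j => N₀ + ψ j with hφ
  have hφm : StrictMono φ := fun a b hab => Nat.add_lt_add_left (hψ hab) N₀
  have hφ0 : ∀ j, N₀ ≤ φ j := fun j => Nat.le_add_right _ _
  have hφ1 : ∀ j, 1 ≤ φ j := fun j => le_trans (by omega) (hφ0 j)
  have hXφ : ∀ j, X (φ j) = sample r (φ j) (p (φ j)) := fun j => (hp _ (hφ0 j)).2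
  have hdeg : ∀ j, (p (φ j)).natDegree ≤ φ j := fun j => (hp _ (hφ0 j)).1
  have hstate : ∀ j, interpState (X (φ j)) = polyState r (p (φ j)) := fun j => by
    rw [hXφ, interpState_sample (hφ1 j) (hdeg j)]
  have hcontrol : ∀ j, P.interpControl (X (φ j)) =
      fun t => (P.stateControl (polyJet r (p (φ j)) t)).2 := fun j => by
    rw [hXφ, P.interpControl_sample (hφ1 j) (hdeg j)]
  have hdisc : Tendsto (fun j => P.discCost (X (φ j)) (U (φ j))) atTop
      (𝓝 (P.cost (fun t => (z t).1) fun t => (P.stateControl (z t)).2)) := by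
    simp only [hXφ]
    exact P.tendsto_discCost hφm.tendsto_atTop hφ1 hz hlim
      fun j k => P.control_eq (hφ1 j) (hdeg j) (hfeas _ (hφ0 j)).control k
  refine ⟨φ, fun t => (z t).1, fun t => (P.stateControl (z t)).2, hφm,
    fun j => le_trans (by omega) (hφ0 j), ⟨?_, fun x' u' hx' => ?_⟩, ?_, ?_, hdisc, ?_⟩
  · exact P.isFeasible_of_tendstoUniformlyOn R hβ hφm.tendsto_atTop hφ1 hdeg
      (fun j => hfeas _ (hφ0 j)) hz hlim
  · -- the discrete optimal values are at most those of the comparison sequence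
    obtain ⟨q, ζ, hζ, hq, hqf, hcost⟩ := BolzaProblem.exists_comparison_sequence hopt.1 hy
      (by omega) (by omega) hβ hβm hR
    have hqlim : TendstoUniformlyOn (fun j => polyJet r (q (φ j))) ζ atTop (Icc (-1) 1) :=
      fun u hu => hφm.tendsto_atTop.eventually (hq u hu)
    have h1 := P.tendsto_discCost hφm.tendsto_atTop hφ1 hζ hqlim
      (U := fun j k => (P.stateControl (polyJet r (q (φ j)) (node (φ j) k))).2)
      fun j k => rfl
    rw [hcost] at h1
    refine (le_of_tendsto_of_tendsto hdisc h1 ?_).trans (hopt.2 x' u' hx')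
    filter_upwards [hφm.tendsto_atTop.eventually hqf] with j hj
    exact (hXU (φ j) (le_trans (by omega) (hφ0 j))).2 _ _ hj
  · simp only [hstate]
    exact tendstoUniformlyOn_comp_of_continuous isCompact_Icc hz hlim continuous_fst
  · simp only [hcontrol]
    exact tendstoUniformlyOn_comp_of_continuous isCompact_Icc hz hlim
      (continuous_snd.comp P.continuous_stateControl)
  · simp only [hstate, hcontrol]
    exact P.tendsto_cost hz hlim
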